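/- Let $k$ be a field and $G$ a group. **Controlled objects.** Let $X$ be a $G$-bornological coarse space: a $G$-set with a bornology and a compatible coarse structure on which $G$ acts by automorphisms and whose $G$-invariant entourages are cofinal. For an entourage $U$ and a bounded set $B$ put $U[B]=\{x\in X\mid \exists b\in B,\ (x,b)\in U\}$. Let $\mathcal B(X)$ be the poset of bounded sets; for a functor $M$ on $\mathcal B(X)$ let $(gM)(B)=M(g^{-1}B)$. The $k$-linear category $V_k^G(X)$ has as objects the pairs $(M,\rho)$ of a functor $M$ from $\mathcal B(X)$ to finite-dimensional $k$-vector spaces and natural isomorphisms $\rho(g)\colon M\to gM$ ($g\in G$) with $\rho(gg')=g\rho(g')\circ\rho(g)$, such that $M(\emptyset)=0$, the square formed by $M(B\cap B')$, $M(B)$, $M(B')$, $M(B\cup B')$ is a push-out for all bounded $B,B'$, and every bounded $B$ has a finite subset $F$ such that $M(F)\to M(B)$ is an isomorphism. For a $G$-invariant entourage $U$, a $U$-controlled morphism $(M,\rho)\to(M',\rho')$ is a natural transformation $\phi\colon M\to M'\circ U[-]$ with $\rho'(g)\circ\phi=(g\phi)\circ\rho(g)$ for all $g\in G$; morphisms in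 $V_k^G(X)$ are the elements of the colimit, over all $G$-invariant entourages $U$, of the spaces of $U$-controlled morphisms. Let $G_{\mathrm{can,min}}$ be the set $G$ with left multiplication, the bornology of finite subsets, and the coarse structure generated by the sets $G(B\times B)$ with $B\subseteq G$ finite. **Mixed complexes.** To a $k$-linear category $\mathcal C$ associate the additive cyclic nerve, the cyclic $k$-module with $$\mathrm{CN}_n(\mathcal C)=\bigoplus_{(C_0,\dots,C_n)}\mathrm{Hom}(C_1,C_0)\otimes_k\mathrm{Hom}(C_2,C_1)\otimes_k\cdots\otimes_k\mathrm{Hom}(C_0,C_n),$$ faces $d_i$ ($0\le i<n$) composing $f_i\circ f_{i+1}$, $d_n(f_0\otimes\cdots\otimes f_n)=f_n\circ f_0\otimes f_1\otimes\cdots\otimes f_{n-1}$, degeneracies $s_i$ inserting an identity after $f_i$, and $t(f_0\otimes\cdots\otimes f_n)=(-1)^n f_n\otimes f_0\otimes\cdots\otimes f_{n-1}$. To a $k$-algebra $A$ associate the cyclic module $Z_n(A)=A^{\otimes_k(n+1)}$ with the same formulas (multiplication in place of composition, $1$ in place of identities). A cyclic module gives a mixed complex, zero in negative degrees, with $b=\sum_{i=0}^n(-1)^id_i$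 and $B=(1-t)sN$, where $s=(-1)^{n+1}t\,s_n$ and $N=\sum_{i=0}^n t^i$ on degree $n$. For a mixed complex $(C,b,B)$, let $\mathrm{Tot}(\mathcal BC)$ be the chain complex with $\mathrm{Tot}_n=\bigoplus_{i\ge0}C_{n-2i}$ and $d(c_n,c_{n-2},\dots)=(bc_n+Bc_{n-2},\,bc_{n-2}+Bc_{n-4},\dots)$. Let $\mathrm{XHH}_k^G(X)$ and $\mathrm{XHC}_k^G(X)$ be the chain complexes $(C,b)$ and $\mathrm{Tot}(\mathcal BC)$ for the mixed complex $C$ of $\mathrm{CN}(V_k^G(X))$, and let $C^{\mathrm{HH}}_*(A;k)$ and $C^{\mathrm{HC}}_*(A;k)$ be the chain complexes $(C,b)$ and $\mathrm{Tot}(\mathcal BC)$ for the mixed complex $C$ of $Z_*(A)$. All are regarded as objects of the localization of the category of $\mathbb Z$-graded chain complexes of $k$-vector spaces at the quasi-isomorphisms. **Proposition.** For every field $k$ and every group $G$ there are equivalences of chain complexes $$\mathrm{XHH}_k^G(G_{\mathrm{can,min}})\simeq C^{\mathrm{HH}}_*(k[G];k)\qquad\text{and}\qquad \mathrm{XHC}_k^G(G_{\mathrm{can,min}})\simeq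 C^{\mathrm{HC}}_*(k[G];k),$$ that is, isomorphisms in this localization. -/

import Mathlib

namespace CyclicTuple
variable {T : Type*}

/-- Face of a cyclic word `x₀, …, xₙ₊₁`: for `i ≤ n` multiply the entries `i` and `i + 1`; for
`i = n + 1` multiply the last entry onto the front of the first one. -/
def face (mul : T → T → T) {n : ℕ} (i : Fin (n + 2)) (x : Fin (n + 2) → T) : Fin (n + 1) → T :=
  fun j =>
    if i = Fin.last (n + 1) then
      if j = 0 then mul (x (Fin.last (n + 1))) (x 0) else x j.castSucc
    else if (j : ℕ) < i then x j.castSucc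
    else if (j : ℕ) = i then mul (x j.castSucc) (x j.succ)
    else x j.succ

/-- Degeneracy of a cyclic word: insert a unit `one (x i)` after the entry `x i`. -/
def degen (one : T → T) {n : ℕ} (i : Fin (n + 1)) (x : Fin (n + 1) → T) : Fin (n + 2) → T :=
  fun j =>
    if h : (j : ℕ) ≤ i then x ⟨j, by omega⟩
    else if (j : ℕ) = i + 1 then one (x i)
    else x ⟨j - 1, by omega⟩

/-- Cyclic rotation `x₀, …, xₙ ↦ xₙ, x₀, …, xₙ₋₁`. -/
def rot {n : ℕ} (x : Fin (n + 1) → T) : Fin (n + 1) → T :=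
  fun j => x (j - 1)

/-- Auxiliary version of `face` for entries indexed by `ℕ`. -/
def faceN (mul : T → T → T) (n i : ℕ) (X : ℕ → T) : ℕ → T := fun j =>
  if i = n + 1 then (if j = 0 then mul (X (n + 1)) (X 0) else X j)
  else if j < i then X j else if j = i then mul (X j) (X (j + 1)) else X (j + 1)
/-- Auxiliary version of `degen` for entries indexed by `ℕ`. -/
def degenN (one : T → T) (i : ℕ) (X : ℕ → T) : ℕ → T := fun j =>
  if j ≤ i then X j else if j = i + 1 then one (X i) else X (j - 1)
/-- Auxiliary version of `rot` for entries indexed by `ℕ`. -/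
def rotN (n : ℕ) (X : ℕ → T) : ℕ → T := fun j => if j = 0 then X n else X (j - 1)

theorem exists_rep {n : ℕ} (x : Fin (n + 1) → T) : ∃ X : ℕ → T, x = fun j : Fin (n + 1) => X j :=
  ⟨fun k => x (Fin.ofNat (n + 1) k), by funext j; simp⟩

theorem face_rep (mul : T → T → T) {n : ℕ} (i : Fin (n + 2)) (X : ℕ → T) :
    face mul i (fun j : Fin (n + 2) => X j) = fun j : Fin (n + 1) => faceN mul n i X j := by
  funext j
  simp [face, faceN, Fin.ext_iff, -Fin.val_eq_zero_iff]

theorem degen_rep (one : T → T) {n : ℕ} (i : Fin (n + 1)) (X : ℕ → T) :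
    degen one i (fun j : Fin (n + 1) => X j) = fun j : Fin (n + 2) => degenN one i X j := by
  funext j
  simp [degen, degenN]

theorem val_sub_one {n : ℕ} (j : Fin (n + 1)) :
    ((j - 1 : Fin (n + 1)) : ℕ) = if (j : ℕ) = 0 then n else (j : ℕ) - 1 := by
  rcases n with _ | n
  · simp
  · rw [Fin.coe_sub_one]; simp [Fin.ext_iff, -Fin.val_eq_zero_iff]

theorem val_add_one {n : ℕ} (j : Fin (n + 1)) :
    ((j + 1 : Fin (n + 1)) : ℕ) = if (j : ℕ) = n then 0 else (j : ℕ) + 1 := by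
  rw [Fin.val_add_one]; simp [Fin.ext_iff]

theorem rot_rep {n : ℕ} (X : ℕ → T) :
    rot (fun j : Fin (n + 1) => X j) = fun j : Fin (n + 1) => rotN n X j := by
  funext j
  simp only [rot, rotN, val_sub_one]
  split_ifs <;> rfl

theorem face_face (mul : T → T → T) {n : ℕ} (x : Fin (n + 3) → T)
    (assoc : ∀ i, mul (mul (x i) (x (i + 1))) (x (i + 2)) = mul (x i) (mul (x (i + 1)) (x (i + 2))))
    (i j : Fin (n + 2)) (h : i ≤ j) :
    face mul j (face mul i.castSucc x) = face mul i (face mul j.succ x) := by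
  obtain ⟨X, rfl⟩ := exists_rep x
  have a1 : ∀ p, p ≤ n → mul (mul (X p) (X (p + 1))) (X (p + 2)) =
      mul (X p) (mul (X (p + 1)) (X (p + 2))) := by
    intro p hp
    have := assoc ⟨p, by omega⟩
    simpa [Fin.val_add, Nat.mod_eq_of_lt (show p + 1 < n + 3 by omega),
      Nat.mod_eq_of_lt (show p + 2 < n + 3 by omega)] using this
  have a2 : mul (mul (X (n + 1)) (X (n + 2))) (X 0) =
      mul (X (n + 1)) (mul (X (n + 2)) (X 0)) := by
    have := assoc ⟨n + 1, by omega⟩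
    simpa [Fin.val_add, Nat.mod_eq_of_lt (show n + 2 < n + 3 by omega)] using this
  have a3 : mul (mul (X (n + 2)) (X 0)) (X 1) = mul (X (n + 2)) (mul (X 0) (X 1)) := by
    have := assoc ⟨n + 2, by omega⟩
    have e : (n + 2 + 2) % (n + 3) = 1 := by
      rw [show n + 2 + 2 = 1 + (n + 3) by ring, Nat.add_mod_right, Nat.mod_eq_of_lt (by omega)]
    simpa [Fin.val_add, e] using this
  simp only [face_rep]
  funext l
  obtain ⟨i, hi⟩ := i
  obtain ⟨j, hj⟩ := j
  obtain ⟨l, hl⟩ := l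
  simp only [Fin.castSucc_mk, Fin.succ_mk, Fin.mk_le_mk] at *
  simp only [faceN]
  clear assoc
  grind

theorem face_rot (mul : T → T → T) {n : ℕ} (x : Fin (n + 2) → T) (i : Fin (n + 1)) :
    face mul i.succ (rot x) = rot (face mul i.castSucc x) := by
  obtain ⟨X, rfl⟩ := exists_rep x
  simp only [face_rep, rot_rep]
  funext l
  obtain ⟨i, hi⟩ := i
  obtain ⟨l, hl⟩ := l
  simp only [Fin.castSucc_mk, Fin.succ_mk, faceN, rotN] at *
  grind

theorem face_zero_rot (mul : T → T → T) {n : ℕ} (x : Fin (n + 2) → T) :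
    face mul 0 (rot x) = face mul (Fin.last _) x := by
  obtain ⟨X, rfl⟩ := exists_rep x
  simp only [face_rep, rot_rep]
  funext l
  obtain ⟨l, hl⟩ := l
  simp only [Fin.val_last, Fin.val_zero, faceN, rotN] at *
  grind

theorem degen_rot (one : T → T) {n : ℕ} (x : Fin (n + 1) → T) (i : Fin n) :
    degen one i.succ (rot x) = rot (degen one i.castSucc x) := by
  obtain ⟨X, rfl⟩ := exists_rep x
  simp only [degen_rep, rot_rep]
  funext l
  obtain ⟨i, hi⟩ := i
  obtain ⟨l, hl⟩ := l
  simp only [Fin.castSucc_mk, Fin.succ_mk, degenN, rotN] at *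
  grind

theorem degen_zero_rot (one : T → T) {n : ℕ} (x : Fin (n + 1) → T) :
    degen one 0 (rot x) = rot (rot (degen one (Fin.last n) x)) := by
  obtain ⟨X, rfl⟩ := exists_rep x
  simp only [degen_rep, rot_rep]
  funext l
  obtain ⟨l, hl⟩ := l
  simp only [Fin.val_last, Fin.val_zero, degenN, rotN] at *
  grind

theorem rot_iterate {n : ℕ} (x : Fin (n + 1) → T) : rot^[n + 1] x = x := by
  obtain ⟨X, rfl⟩ := exists_rep x
  have : ∀ m, m ≤ n + 1 → rot^[m] (fun j : Fin (n + 1) => X j) =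
      fun j : Fin (n + 1) => if (j : ℕ) < m then X (j + (n + 1) - m) else X (j - m) := by
    intro m
    induction m with
    | zero => intro _; simp
    | succ m ih =>
      intro hm
      rw [Function.iterate_succ_apply', ih (by omega),
        rot_rep (fun j => if j < m then X (j + (n + 1) - m) else X (j - m))]
      funext l
      obtain ⟨l, hl⟩ := l
      simp only [rotN]
      grind
  rw [this _ le_rfl]
  funext l
  simp [l.2]

theorem degen_degen (one : T → T) (hone : ∀ x, one (one x) = one x) {n : ℕ} (x : Fin (n + 1) → T)
    (i j : Fin (n + 1)) (h : i ≤ j) :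
    degen one j.succ (degen one i x) = degen one i.castSucc (degen one j x) := by
  obtain ⟨X, rfl⟩ := exists_rep x
  simp only [degen_rep]
  funext l
  obtain ⟨i, hi⟩ := i
  obtain ⟨j, hj⟩ := j
  obtain ⟨l, hl⟩ := l
  simp only [Fin.castSucc_mk, Fin.succ_mk, Fin.mk_le_mk, degenN] at *
  grind

theorem face_degen_lt (mul : T → T → T) (one : T → T) {n : ℕ} (x : Fin (n + 2) → T)
    (hone : ∀ i, one (mul (x i) (x (i + 1))) = one (x (i + 1)))
    (i j : Fin (n + 1)) (h : i ≤ j) :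
    face mul i.castSucc.castSucc (degen one j.succ x) = degen one j (face mul i.castSucc x) := by
  obtain ⟨X, rfl⟩ := exists_rep x
  have a1 : ∀ p, p ≤ n → one (mul (X p) (X (p + 1))) = one (X (p + 1)) := by
    intro p hp
    have := hone ⟨p, by omega⟩
    simpa [Fin.val_add, Nat.mod_eq_of_lt (show p + 1 < n + 2 by omega)] using this
  simp only [degen_rep, face_rep]
  funext l
  obtain ⟨i, hi⟩ := i
  obtain ⟨j, hj⟩ := j
  obtain ⟨l, hl⟩ := l
  simp only [Fin.castSucc_mk, Fin.succ_mk, Fin.mk_le_mk, degenN, faceN] at *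
  clear hone
  grind

theorem face_degen_self (mul : T → T → T) (one : T → T) {n : ℕ} (x : Fin (n + 1) → T)
    (hone : ∀ i, mul (x i) (one (x i)) = x i) (i : Fin (n + 1)) :
    face mul i.castSucc (degen one i x) = x := by
  obtain ⟨X, rfl⟩ := exists_rep x
  have a1 : ∀ p, p ≤ n → mul (X p) (one (X p)) = X p := by
    intro p hp
    exact hone ⟨p, by omega⟩
  simp only [degen_rep, face_rep]
  funext l
  obtain ⟨i, hi⟩ := i
  obtain ⟨l, hl⟩ := l
  simp only [Fin.castSucc_mk, degenN, faceN] at *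
  clear hone
  grind

theorem face_succ_degen_self (mul : T → T → T) (one : T → T) {n : ℕ} (x : Fin (n + 1) → T)
    (hone : ∀ i, mul (one (x i)) (x (i + 1)) = x (i + 1)) (i : Fin (n + 1)) :
    face mul i.succ (degen one i x) = x := by
  obtain ⟨X, rfl⟩ := exists_rep x
  have a1 : ∀ p, p < n → mul (one (X p)) (X (p + 1)) = X (p + 1) := by
    intro p hp
    have := hone ⟨p, by omega⟩
    simpa [Fin.val_add, Nat.mod_eq_of_lt (show p + 1 < n + 1 by omega)] using this
  have a2 : mul (one (X n)) (X 0) = X 0 := by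
    have := hone ⟨n, by omega⟩
    simpa [Fin.val_add] using this
  simp only [degen_rep, face_rep]
  funext l
  obtain ⟨i, hi⟩ := i
  obtain ⟨l, hl⟩ := l
  simp only [Fin.succ_mk, degenN, faceN] at *
  clear hone
  grind

theorem face_degen_gt (mul : T → T → T) (one : T → T) {n : ℕ} (x : Fin (n + 2) → T)
    (hone : ∀ i, one (mul (x i) (x (i + 1))) = one (x (i + 1)))
    (i j : Fin (n + 1)) (h : j ≤ i) :
    face mul i.succ.succ (degen one j.castSucc x) = degen one j (face mul i.succ x) := by
  obtain ⟨X, rfl⟩ := exists_rep x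
  have a2 : one (mul (X (n + 1)) (X 0)) = one (X 0) := by
    have := hone ⟨n + 1, by omega⟩
    simpa [Fin.val_add] using this
  simp only [degen_rep, face_rep]
  funext l
  obtain ⟨i, hi⟩ := i
  obtain ⟨j, hj⟩ := j
  obtain ⟨l, hl⟩ := l
  simp only [Fin.castSucc_mk, Fin.succ_mk, Fin.mk_le_mk, degenN, faceN] at *
  clear hone
  grind

end CyclicTuple


open CategoryTheory
universe w u v v'

/-- A cyclic `k`-module: a simplicial `k`-module with operators `t` on `X n` satisfying `t ^ (n + 1) = 1`
and the usual compatibilities with faces and degeneracies, where the sign `(-1) ^ n` of the cyclic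
permutation is part of `t`. -/
structure CyclicModule (k : Type u) [CommRing k] where
  X : ℕ → Type w
  [addCommGroup : ∀ n, AddCommGroup (X n)]
  [module : ∀ n, Module k (X n)]
  d : ∀ {n : ℕ}, Fin (n + 2) → X (n + 1) →ₗ[k] X n
  s : ∀ {n : ℕ}, Fin (n + 1) → X n →ₗ[k] X (n + 1)
  t : ∀ {n : ℕ}, X n →ₗ[k] X n
  d_d : ∀ {n : ℕ} (i j : Fin (n + 2)), i ≤ j →
    ∀ x : X (n + 2), d j (d i.castSucc x) = d i (d j.succ x)
  s_s : ∀ {n : ℕ} (i j : Fin (n + 1)), i ≤ j →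
    ∀ x : X n, s j.succ (s i x) = s i.castSucc (s j x)
  d_s_of_lt : ∀ {n : ℕ} (i j : Fin (n + 1)), i ≤ j →
    ∀ x : X (n + 1), d i.castSucc.castSucc (s j.succ x) = s j (d i.castSucc x)
  d_s_castSucc : ∀ {n : ℕ} (i : Fin (n + 1)) (x : X n), d i.castSucc (s i x) = x
  d_s_succ : ∀ {n : ℕ} (i : Fin (n + 1)) (x : X n), d i.succ (s i x) = x
  d_s_of_gt : ∀ {n : ℕ} (i j : Fin (n + 1)), j ≤ i →
    ∀ x : X (n + 1), d i.succ.succ (s j.castSucc x) = s j (d i.succ x)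
  d_t : ∀ {n : ℕ} (i : Fin (n + 1)) (x : X (n + 1)), d i.succ (t x) = - t (d i.castSucc x)
  d_zero_t : ∀ {n : ℕ} (x : X (n + 1)), d 0 (t x) = (-1 : k) ^ (n + 1) • d (Fin.last (n + 1)) x
  s_t : ∀ {n : ℕ} (i : Fin n) (x : X n), s i.succ (t x) = - t (s i.castSucc x)
  s_zero_t : ∀ {n : ℕ} (x : X n), s 0 (t x) = (-1 : k) ^ n • t (t (s (Fin.last n) x))
  t_pow : ∀ {n : ℕ} (x : X n), (t ^ (n + 1)) x = x

namespace CyclicModule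
attribute [instance] CyclicModule.addCommGroup CyclicModule.module
variable {k : Type u} [CommRing k] (M : CyclicModule.{w} k)

/-- The Hochschild boundary, the alternating sum of the faces. -/
noncomputable def b (n : ℕ) : M.X (n + 1) →ₗ[k] M.X n := ∑ i : Fin (n + 2), (-1 : k) ^ (i : ℕ) • M.d i

/-- The norm operator `1 + t + ⋯ + t ^ n`. -/
noncomputable def N (n : ℕ) : M.X n →ₗ[k] M.X n := ∑ i ∈ Finset.range (n + 1), M.t ^ i

/-- The extra degeneracy `(-1) ^ (n + 1) t sₙ`. -/
def extraDegeneracy (n : ℕ) : M.X n →ₗ[k] M.X (n + 1) := (-1 : k) ^ (n + 1) • (M.t ∘ₗ M.s (Fin.last n))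

/-- The Connes operator `(1 - t) s N`. -/
noncomputable def B (n : ℕ) : M.X n →ₗ[k] M.X (n + 1) := (1 - M.t) ∘ₗ M.extraDegeneracy n ∘ₗ M.N n

/-- Auxiliary: the alternating sum of all faces but the last. -/
noncomputable def b' (n : ℕ) : M.X (n + 1) →ₗ[k] M.X n :=
  ∑ i : Fin (n + 1), (-1 : k) ^ (i : ℕ) • M.d i.castSucc

theorem neg_one_smul_smul {V : Type*} [AddCommGroup V] [Module k V] (n : ℕ) (v : V) :
    (-1 : k) ^ n • (-1 : k) ^ n • v = v := by
  rw [smul_smul, ← mul_pow]; simp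

theorem b_eq (n : ℕ) (x : M.X (n + 1)) :
    M.b n x = M.b' n x + (-1 : k) ^ (n + 1) • M.d (Fin.last (n + 1)) x := by
  simp [b, b', Fin.sum_univ_castSucc (n := n + 1), LinearMap.sum_apply]

theorem b_t (n : ℕ) (x : M.X (n + 1)) : M.b n (M.t x) = M.b n x - M.b' n x + M.t (M.b' n x) := by
  rw [M.b_eq n x, add_sub_cancel_left]
  simp only [b, b', Fin.sum_univ_succ (n := n + 1), LinearMap.add_apply, LinearMap.smul_apply,
    LinearMap.sum_apply, map_sum, map_smul, M.d_t, M.d_zero_t, Fin.val_zero, pow_zero, one_smul,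
    Fin.val_succ, pow_succ, mul_neg, mul_one, neg_smul, smul_neg, neg_neg,
    LinearMap.neg_apply]

theorem b_one_sub_t (n : ℕ) (x : M.X (n + 1)) :
    M.b n ((1 - M.t) x) = (1 - M.t) (M.b' n x) := by
  simp only [LinearMap.sub_apply, Module.End.one_apply, map_sub, b_t]; abel

theorem t_N (n : ℕ) (x : M.X n) : M.t (M.N n x) = M.N n x := by
  have h : M.t * M.N n = M.N n := by
    have h1 : (M.t : Module.End k (M.X n)) ^ (n + 1) = 1 := LinearMap.ext M.t_pow
    have h2 := mul_geom_sum (M.t : Module.End k (M.X n)) (n + 1)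
    rw [h1, sub_self, sub_mul, one_mul, sub_eq_zero] at h2
    exact h2
  exact LinearMap.congr_fun h x

theorem N_t (n : ℕ) (x : M.X n) : M.N n (M.t x) = M.N n x := by
  have h : M.N n * M.t = M.N n := by
    have h1 : (M.t : Module.End k (M.X n)) ^ (n + 1) = 1 := LinearMap.ext M.t_pow
    have h2 := geom_sum_mul (M.t : Module.End k (M.X n)) (n + 1)
    rw [h1, sub_self, mul_sub, mul_one, sub_eq_zero] at h2
    exact h2
  exact LinearMap.congr_fun h x

theorem tpow_N (n m : ℕ) (x : M.X n) : (M.t ^ m) (M.N n x) = M.N n x := by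
  induction m with
  | zero => simp
  | succ m ih => rw [pow_succ', Module.End.mul_apply, ih, t_N]

theorem N_tpow (n m : ℕ) (x : M.X n) : M.N n ((M.t ^ m) x) = M.N n x := by
  induction m with
  | zero => simp
  | succ m ih => rw [pow_succ', Module.End.mul_apply, N_t, ih]

theorem tpow_d_zero (n : ℕ) (i : ℕ) (hi : i < n + 2) (x : M.X (n + 1)) :
    (M.t ^ i) (M.d 0 x) = (-1 : k) ^ i • M.d ⟨i, hi⟩ ((M.t ^ i) x) := by
  induction i with
  | zero => simp
  | succ i ih =>
    rw [pow_succ', Module.End.mul_apply, ih (by omega), map_smul, pow_succ' M.t, Module.End.mul_apply]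
    have := M.d_t ⟨i, by omega⟩ ((M.t ^ i) x)
    simp only [Fin.succ_mk, Fin.castSucc_mk] at this
    rw [this, pow_succ]
    simp

theorem b'_N (n : ℕ) (x : M.X (n + 1)) : M.b' n (M.N _ x) = M.N _ (M.d 0 (M.N _ x)) := by
  have h : M.N n (M.d 0 (M.N _ x)) = ∑ i : Fin (n + 1), (M.t ^ (i : ℕ)) (M.d 0 (M.N _ x)) := by
    rw [N, LinearMap.sum_apply, Finset.sum_range]
  rw [h, b', LinearMap.sum_apply]
  refine Finset.sum_congr rfl fun i _ => ?_
  rw [tpow_d_zero M n i (by omega), tpow_N]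
  rfl

theorem N_b (n : ℕ) (x : M.X (n + 1)) : M.N _ (M.b n x) = M.N _ (M.d 0 (M.N _ x)) := by
  have key : ∀ i : Fin (n + 2), M.N n ((-1 : k) ^ (i : ℕ) • M.d i x) =
      M.N n (M.d 0 ((M.t ^ (n + 2 - (i : ℕ))) x)) := by
    intro i
    have h := tpow_d_zero M n i i.2 ((M.t ^ (n + 2 - (i : ℕ))) x)
    rw [← Module.End.mul_apply (M.t ^ (i : ℕ)) (M.t ^ (n + 2 - (i : ℕ))), ← pow_add,
      show (i : ℕ) + (n + 2 - i) = n + 1 + 1 by omega, M.t_pow] at h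
    rw [← N_tpow M n i (M.d 0 _), h]
  have h3 : M.N (n + 1) x = ∑ i : Fin (n + 2), (M.t ^ (n + 2 - (i : ℕ))) x := by
    rw [← N_t, N, LinearMap.sum_apply, ← Finset.sum_range_reflect, Finset.sum_range]
    refine Finset.sum_congr rfl fun i _ => ?_
    rw [← Module.End.mul_apply, ← pow_succ]
    congr 2; omega
  rw [h3, b, LinearMap.sum_apply, map_sum, map_sum, map_sum]
  exact Finset.sum_congr rfl fun i _ => key i

theorem d_zero_extra (n : ℕ) (x : M.X n) : M.d 0 (M.extraDegeneracy n x) = x := by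
  have := M.d_s_succ (Fin.last n) x
  simp only [extraDegeneracy, LinearMap.smul_apply, LinearMap.comp_apply, map_smul, d_zero_t,
    neg_one_smul_smul]
  simpa using this

theorem d_succ_extra (n : ℕ) (i : Fin (n + 1)) (x : M.X (n + 1)) :
    M.d i.succ.castSucc (M.extraDegeneracy (n + 1) x) = M.extraDegeneracy n (M.d i.castSucc x) := by
  have h := M.d_s_of_lt i (Fin.last n) (Fin.le_last i) x
  have h2 := M.d_t i.castSucc (M.s (Fin.last (n + 1)) x)
  rw [Fin.succ_last] at h
  rw [h] at h2
  simp only [extraDegeneracy, LinearMap.smul_apply, LinearMap.comp_apply, map_smul]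
  rw [← Fin.succ_castSucc, h2, pow_succ]
  simp

theorem b'_extra_zero (x : M.X 0) : M.b' 0 (M.extraDegeneracy 0 x) = x := by
  simpa [b'] using M.d_zero_extra 0 x

theorem b'_extra (n : ℕ) (x : M.X (n + 1)) :
    M.b' (n + 1) (M.extraDegeneracy (n + 1) x) = x - M.extraDegeneracy n (M.b' n x) := by
  simp only [b', Fin.sum_univ_succ (n := n + 1), LinearMap.add_apply, LinearMap.smul_apply,
    LinearMap.sum_apply, d_succ_extra, map_sum, map_smul, Fin.val_succ, Fin.val_zero, pow_zero,
    one_smul, Fin.castSucc_zero, d_zero_extra, pow_succ, mul_neg, mul_one, neg_smul,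
    Finset.sum_neg_distrib, sub_eq_add_neg, LinearMap.neg_apply]

theorem b_B_zero (x : M.X 0) : M.b 0 (M.B 0 x) = 0 := by
  have h : M.t x = x := by simpa using M.t_pow x
  simp only [B, LinearMap.comp_apply, b_one_sub_t, b'_extra_zero]
  simp [t_N]

theorem b_B (n : ℕ) (x : M.X (n + 1)) : M.b (n + 1) (M.B (n + 1) x) = - M.B n (M.b n x) := by
  simp only [B, LinearMap.comp_apply, b_one_sub_t, b'_extra, N_b, b'_N]
  simp [t_N]

theorem B_B (n : ℕ) (x : M.X n) : M.B (n + 1) (M.B n x) = 0 := by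
  simp only [B, LinearMap.comp_apply]
  have : ∀ y, M.N (n + 1) ((1 - M.t) y) = 0 := by
    intro y; simp [N_t]
  rw [this, map_zero, map_zero]

theorem b_b (n : ℕ) (x : M.X (n + 2)) : M.b n (M.b (n + 1) x) = 0 := by
  simp only [b, LinearMap.sum_apply, LinearMap.smul_apply, map_sum, map_smul, Finset.smul_sum, smul_smul,
    ← pow_add]
  rw [Finset.sum_comm, ← Finset.sum_product']
  let S : Finset (Fin (n + 2) × Fin (n + 3)) := {ij | (ij.2 : ℕ) ≤ (ij.1 : ℕ)}
  rw [Finset.univ_product_univ, ← Finset.sum_add_sum_compl S, ← eq_neg_iff_add_eq_zero,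
    ← Finset.sum_neg_distrib]
  have mem : ∀ ij, ij ∈ S ↔ (ij.2 : ℕ) ≤ (ij.1 : ℕ) := fun ij => by simp [S]
  refine Finset.sum_bij' (fun ij _ => (⟨min ij.2 (n + 1), by omega⟩, ij.1.succ))
    (fun ij _ => (⟨(ij.2 : ℕ) - 1, by omega⟩, ij.1.castSucc)) ?_ ?_ ?_ ?_ ?_
  · rintro ⟨i, j⟩ hij
    simp only [Finset.mem_compl, mem, Fin.val_succ] at hij ⊢
    omega
  · rintro ⟨i, j⟩ hij
    simp only [Finset.mem_compl, mem, Fin.val_castSucc] at hij ⊢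
    omega
  · rintro ⟨i, j⟩ hij
    simp only [mem] at hij
    ext <;> simp <;> omega
  · rintro ⟨i, j⟩ hij
    simp only [Finset.mem_compl, mem] at hij
    ext <;> simp <;> omega
  · rintro ⟨i, j⟩ hij
    simp only [mem] at hij
    have h := M.d_d ⟨j, by omega⟩ i hij x
    have e1 : (⟨min (j : ℕ) (n + 1), by omega⟩ : Fin (n + 2)) = ⟨j, by omega⟩ := by
      ext; simp; omega
    simp only [Fin.castSucc_mk] at h
    rw [e1, ← neg_smul]
    simp only [Fin.val_succ]
    rw [h]
    congr 1
    ring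

end CyclicModule


/-- A mixed complex: a `ℤ`-graded `k`-module with a differential `b` of degree `-1` (the `d` of the
underlying chain complex) and a differential `B` of degree `1`, such that `b ^ 2 = 0`, `B ^ 2 = 0` and
`b B + B b = 0`. As for `d`, the component `B i j` is zero unless `j = i + 1`. -/
structure MixedComplex (k : Type u) [CommRing k] extends ChainComplex (ModuleCat.{w} k) ℤ where
  B : ∀ i j : ℤ, X i ⟶ X j
  shape_B : ∀ i j : ℤ, i + 1 ≠ j → B i j = 0
  B_comp_B : ∀ i j l : ℤ, B i j ≫ B j l = 0
  d_B_add_B_d : ∀ i : ℤ, d i (i - 1) ≫ B (i - 1) i + B i (i + 1) ≫ d (i + 1) i = 0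

namespace CyclicModule
variable {k : Type u} [CommRing k] (M : CyclicModule.{w} k)

/-- The underlying graded module of the mixed complex of a cyclic module: `M.X n` in degree `n ≥ 0`,
and zero in negative degrees. -/
def mixX : ℤ → ModuleCat.{w} k
  | Int.ofNat n => ModuleCat.of k (M.X n)
  | Int.negSucc _ => ModuleCat.of k PUnit

/-- The differential `b` in all integral degrees. -/
noncomputable def mixb : ∀ p : ℤ, M.mixX (p + 1) ⟶ M.mixX p
  | Int.ofNat n => ModuleCat.ofHom (M.b n)
  | Int.negSucc _ => 0

/-- The differential `B` in all integral degrees. -/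
noncomputable def mixB : ∀ p : ℤ, M.mixX p ⟶ M.mixX (p + 1)
  | Int.ofNat n => ModuleCat.ofHom (M.B n)
  | Int.negSucc _ => 0

theorem mixb_mixb : ∀ p : ℤ, M.mixb (p + 1) ≫ M.mixb p = 0
  | Int.ofNat n => by
    ext x
    exact M.b_b n x
  | Int.negSucc _ => by
    exact Limits.comp_zero

theorem mixB_mixB : ∀ p : ℤ, M.mixB p ≫ M.mixB (p + 1) = 0
  | Int.ofNat n => by
    ext x
    exact M.B_B n x
  | Int.negSucc _ => by
    exact Limits.zero_comp

theorem mix_anticomm : ∀ p : ℤ, M.mixb p ≫ M.mixB p + M.mixB (p + 1) ≫ M.mixb (p + 1) = 0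
  | Int.ofNat n => by
    ext x
    exact (congrArg (M.B n (M.b n x) + ·) (M.b_B n x)).trans (add_neg_cancel _)
  | Int.negSucc 0 => by
    ext x
    exact (congrArg (0 + ·) (M.b_B_zero x)).trans (add_zero _)
  | Int.negSucc (n + 1) => by
    have h : M.mixB (Int.negSucc (n + 1) + 1) = 0 := rfl
    have h2 : M.mixb (Int.negSucc (n + 1)) = 0 := rfl
    rw [h, h2, Limits.zero_comp, Limits.zero_comp, add_zero]

/-- The mixed complex `(M, b, B)` of a cyclic module `M`. -/
noncomputable def toMixedComplex : MixedComplex.{w} k where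
  toHomologicalComplex := ChainComplex.of M.mixX M.mixb M.mixb_mixb
  B := (CochainComplex.of M.mixX M.mixB M.mixB_mixB).d
  shape_B i j h := (CochainComplex.of M.mixX M.mixB M.mixB_mixB).shape i j h
  B_comp_B i j l := (CochainComplex.of M.mixX M.mixB M.mixB_mixB).d_comp_d i j l
  d_B_add_B_d i := by
    obtain ⟨p, rfl⟩ : ∃ p, i = p + 1 := ⟨i - 1, by ring⟩
    have e : p + 1 - 1 = p := by ring
    have h1 : ∀ q, (ChainComplex.of M.mixX M.mixb M.mixb_mixb).d (q + 1) q = M.mixb q :=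
      ChainComplex.of_d M.mixX M.mixb
    have h2 : ∀ q, (CochainComplex.of M.mixX M.mixB M.mixB_mixB).d q (q + 1) = M.mixB q :=
      CochainComplex.of_d M.mixX M.mixB
    rw [e, h1, h1, h2, h2]
    exact M.mix_anticomm p

end CyclicModule

namespace MixedComplex
variable {k : Type u} [CommRing k] (C : MixedComplex.{w} k)

/-- Degree `n` of the total complex: the direct sum of the `C (n - 2 i)` over `i ≥ 0`. -/
abbrev TotX (n : ℤ) : Type w := DirectSum ℕ fun i => C.X (n - 2 * (i : ℤ))

/-- The inclusion of the `i`-th summand. -/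
abbrev totι (n : ℤ) (i : ℕ) : C.X (n - 2 * (i : ℤ)) →ₗ[k] C.TotX n :=
  DirectSum.lof k ℕ (fun i => C.X (n - 2 * (i : ℤ))) i

/-- The total differential on the `i`-th summand, namely `b`, plus `B` into the summand `i - 1` if
`i > 0`. -/
noncomputable def totDComponent (n m : ℤ) : ∀ i : ℕ, C.X (n - 2 * (i : ℤ)) →ₗ[k] C.TotX m
  | 0 => C.totι m 0 ∘ₗ (C.d _ _).hom
  | i + 1 => C.totι m (i + 1) ∘ₗ (C.d _ _).hom + C.totι m i ∘ₗ (C.B _ _).hom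

/-- The total differential `(cₙ, cₙ₋₂, …) ↦ (b cₙ + B cₙ₋₂, b cₙ₋₂ + B cₙ₋₄, …)`. -/
noncomputable def totD (n m : ℤ) : C.TotX n →ₗ[k] C.TotX m :=
  DirectSum.toModule k ℕ _ (C.totDComponent n m)

theorem totD_ι (n m : ℤ) (i : ℕ) (x : C.X (n - 2 * (i : ℤ))) :
    C.totD n m (C.totι n i x) = C.totDComponent n m i x :=
  DirectSum.toModule_lof k (M := fun i : ℕ => C.X (n - 2 * (i : ℤ))) i x

theorem d_d_apply (p q r : ℤ) (x : C.X p) : (C.d q r).hom ((C.d p q).hom x) = 0 :=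
  LinearMap.congr_fun (congrArg ModuleCat.Hom.hom (C.d_comp_d p q r)) x

theorem B_B_apply (p q r : ℤ) (x : C.X p) : (C.B q r).hom ((C.B p q).hom x) = 0 :=
  LinearMap.congr_fun (congrArg ModuleCat.Hom.hom (C.B_comp_B p q r)) x

theorem d_B_apply (p q s r : ℤ) (h1 : q = p - 1) (h2 : s = p + 1) (h3 : r = p) (x : C.X p) :
    (C.B q r).hom ((C.d p q).hom x) + (C.d s r).hom ((C.B p s).hom x) = 0 := by
  subst h1 h2 h3
  exact LinearMap.congr_fun (congrArg ModuleCat.Hom.hom (C.d_B_add_B_d r)) x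

theorem totD_shape (n m : ℤ) (h : m + 1 ≠ n) : C.totD n m = 0 := by
  refine DirectSum.linearMap_ext k fun i => LinearMap.ext fun x => ?_
  refine (C.totD_ι n m i x).trans ?_
  have hd : C.d (n - 2 * i) (m - 2 * i) = 0 := C.shape _ _ (by
    change ¬ (_ + 1 = _); omega)
  rcases i with _ | i
  · simp only [totDComponent, hd]
    simp
  · have hB : C.B (n - 2 * (i + 1 : ℕ)) (m - 2 * i) = 0 := C.shape_B _ _ (by push_cast; omega)
    simp only [totDComponent, hd, hB]
    simp

theorem totD_totD (n m l : ℤ) (h1 : m + 1 = n) (h2 : l + 1 = m) : C.totD m l ∘ₗ C.totD n m = 0 := by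
  refine DirectSum.linearMap_ext k fun i => LinearMap.ext fun x => ?_
  change C.totD m l (C.totD n m (C.totι n i x)) = 0
  rw [totD_ι]
  rcases i with _ | _ | i
  · simp only [totDComponent, LinearMap.comp_apply, totD_ι, d_d_apply, map_zero]
  · simp only [totDComponent, LinearMap.comp_apply, LinearMap.add_apply, map_add, totD_ι,
      d_d_apply, map_zero, zero_add]
    rw [← map_add]
    rw [C.d_B_apply _ _ _ _ (by push_cast; omega) (by push_cast; omega) (by push_cast; omega),
      map_zero]
  · simp only [totDComponent, LinearMap.comp_apply, LinearMap.add_apply, map_add, totD_ι,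
      d_d_apply, B_B_apply, map_zero, zero_add, add_zero]
    rw [← map_add,
      C.d_B_apply _ _ _ _ (by push_cast; omega) (by push_cast; omega) (by push_cast; omega),
      map_zero]

/-- The total complex of the double complex of a mixed complex. -/
noncomputable def tot : ChainComplex (ModuleCat.{w} k) ℤ where
  X n := ModuleCat.of k (C.TotX n)
  d n m := ModuleCat.ofHom (C.totD n m)
  shape n m h := congrArg ModuleCat.ofHom (C.totD_shape n m h)
  d_comp_d' n m l h1 h2 := congrArg ModuleCat.ofHom (C.totD_totD n m l h1 h2)

end MixedComplex


section Multilinear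
variable {k : Type*} [CommRing k] {I J : Type*}
  {M : I → Type*} [∀ i, AddCommGroup (M i)] [∀ i, Module k (M i)]
  {N : J → Type*} [∀ j, AddCommGroup (N j)] [∀ j, Module k (N j)]

/-- The linear map of tensor products `⨂ f i ↦ ⨂ Φ f j`, for a map `Φ` of families such that each
input `f i` enters, linearly, in exactly one output `Φ f (q i)`. -/
noncomputable def tprodBlock [DecidableEq I] (q : I → J) (Φ : (∀ i, M i) → ∀ j, N j)
    (h_const : ∀ f i a j, j ≠ q i → Φ (Function.update f i a) j = Φ f j)
    (h_add : ∀ f i a b, Φ (Function.update f i (a + b)) (q i) =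
      Φ (Function.update f i a) (q i) + Φ (Function.update f i b) (q i))
    (h_smul : ∀ f i (r : k) a, Φ (Function.update f i (r • a)) (q i) =
      r • Φ (Function.update f i a) (q i)) :
    (PiTensorProduct k M) →ₗ[k] (PiTensorProduct k N) :=
  haveI := Classical.decEq J
  PiTensorProduct.lift <| MultilinearMap.mk' (fun f => PiTensorProduct.tprod k (Φ f))
    (by
      intro f i a b
      have e : ∀ a, Φ (Function.update f i a) =
          Function.update (Φ f) (q i) (Φ (Function.update f i a) (q i)) := by
        intro a; funext j
        by_cases hj : j = q i
        · subst hj; simp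
        · rw [Function.update_of_ne hj, h_const _ _ _ _ hj]
      rw [e (a + b), h_add, MultilinearMap.map_update_add, ← e, ← e])
    (by
      intro f i r a
      have e : ∀ a, Φ (Function.update f i a) =
          Function.update (Φ f) (q i) (Φ (Function.update f i a) (q i)) := by
        intro a; funext j
        by_cases hj : j = q i
        · subst hj; simp
        · rw [Function.update_of_ne hj, h_const _ _ _ _ hj]
      rw [e (r • a), h_smul, MultilinearMap.map_update_smul, ← e])

@[simp] theorem tprodBlock_tprod [DecidableEq I] (q : I → J) (Φ : (∀ i, M i) → ∀ j, N j) (h1 h2 h3) (f : ∀ i, M i) :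
    tprodBlock (k := k) q Φ h1 h2 h3 (PiTensorProduct.tprod k f) = PiTensorProduct.tprod k (Φ f) := by
  simp [tprodBlock]

end Multilinear

namespace CyclicTuple

/-- The position in the face number `i` which the entry number `p` contributes to. -/
def faceBlock {n : ℕ} (i p : Fin (n + 2)) : Fin (n + 1) :=
  if h : (i : ℕ) = n + 1 then (if h' : (p : ℕ) = n + 1 then 0 else ⟨p, by omega⟩)
  else if h' : (p : ℕ) ≤ i then ⟨p, by omega⟩ else ⟨p - 1, by omega⟩

/-- The position in the degeneracy number `i` which the entry number `p` contributes to. -/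
def degenBlock {n : ℕ} (i p : Fin (n + 1)) : Fin (n + 2) :=
  if (p : ℕ) ≤ i then p.castSucc else p.succ

end CyclicTuple

section Algebra
open scoped TensorProduct
variable (k : Type u) [CommRing k] (A : Type w) [Ring A] [Algebra k A]

/-- The face `a₀ ⊗ ⋯ ⊗ aₙ₊₁ ↦ a₀ ⊗ ⋯ ⊗ aᵢ aᵢ₊₁ ⊗ ⋯ ⊗ aₙ₊₁`, respectively
`aₙ₊₁ a₀ ⊗ a₁ ⊗ ⋯ ⊗ aₙ` for the last one. -/
noncomputable def algFace {n : ℕ} (i : Fin (n + 2)) :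
    (⨂[k] _ : Fin (n + 2), A) →ₗ[k] (⨂[k] _ : Fin (n + 1), A) :=
  tprodBlock (CyclicTuple.faceBlock i) (CyclicTuple.face (· * ·) i)
    (by
      intro f p a j hj
      simp only [CyclicTuple.face, CyclicTuple.faceBlock, Function.update_apply, Fin.ext_iff,
        Fin.val_last, Fin.val_castSucc, Fin.val_succ, ne_eq, Fin.val_zero, apply_dite Fin.val] at *
      grind)
    (by
      intro f p a b
      simp only [CyclicTuple.face, CyclicTuple.faceBlock, Function.update_apply, Fin.ext_iff,
        Fin.val_last, Fin.val_castSucc, Fin.val_succ, ne_eq, Fin.val_zero, apply_dite Fin.val] at *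
      split_ifs <;> first | omega | rfl | simp only [add_mul, mul_add])
    (by
      intro f p r a
      simp only [CyclicTuple.face, CyclicTuple.faceBlock, Function.update_apply, Fin.ext_iff,
        Fin.val_last, Fin.val_castSucc, Fin.val_succ, ne_eq, Fin.val_zero, apply_dite Fin.val] at *
      split_ifs <;> first | omega | rfl | simp only [smul_mul_assoc, mul_smul_comm])

/-- The degeneracy `a₀ ⊗ ⋯ ⊗ aₙ ↦ a₀ ⊗ ⋯ ⊗ aᵢ ⊗ 1 ⊗ aᵢ₊₁ ⊗ ⋯ ⊗ aₙ`. -/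
noncomputable def algDegen {n : ℕ} (i : Fin (n + 1)) :
    (⨂[k] _ : Fin (n + 1), A) →ₗ[k] (⨂[k] _ : Fin (n + 2), A) :=
  tprodBlock (CyclicTuple.degenBlock i) (CyclicTuple.degen (fun _ => 1) i)
    (by
      intro f p a j hj
      simp only [CyclicTuple.degen, CyclicTuple.degenBlock, Function.update_apply, Fin.ext_iff,
        Fin.val_last, Fin.val_castSucc, Fin.val_succ, ne_eq, Fin.val_zero, apply_ite Fin.val] at *
      grind)
    (by
      intro f p a b
      simp only [CyclicTuple.degen, CyclicTuple.degenBlock, Function.update_apply, Fin.ext_iff,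
        Fin.val_last, Fin.val_castSucc, Fin.val_succ, ne_eq, Fin.val_zero, apply_ite Fin.val] at *
      grind)
    (by
      intro f p r a
      simp only [CyclicTuple.degen, CyclicTuple.degenBlock, Function.update_apply, Fin.ext_iff,
        Fin.val_last, Fin.val_castSucc, Fin.val_succ, ne_eq, Fin.val_zero, apply_ite Fin.val] at *
      grind)

/-- The rotation `a₀ ⊗ ⋯ ⊗ aₙ ↦ aₙ ⊗ a₀ ⊗ ⋯ ⊗ aₙ₋₁` (without sign). -/
noncomputable def algRot {n : ℕ} :
    (⨂[k] _ : Fin (n + 1), A) →ₗ[k] (⨂[k] _ : Fin (n + 1), A) :=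
  tprodBlock (fun p => p + 1) CyclicTuple.rot
    (by
      intro f p a j hj
      have : j - 1 ≠ p := fun h => hj (by rw [← h, sub_add_cancel])
      simp [CyclicTuple.rot, this])
    (by intro f p a b; simp [CyclicTuple.rot])
    (by intro f p r a; simp [CyclicTuple.rot])

theorem algFace_tprod {n : ℕ} (i : Fin (n + 2)) (a : Fin (n + 2) → A) :
    algFace k A i (PiTensorProduct.tprod k a) =
      PiTensorProduct.tprod k (CyclicTuple.face (· * ·) i a) :=
  tprodBlock_tprod _ _ _ _ _ a

theorem algDegen_tprod {n : ℕ} (i : Fin (n + 1)) (a : Fin (n + 1) → A) :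
    algDegen k A i (PiTensorProduct.tprod k a) =
      PiTensorProduct.tprod k (CyclicTuple.degen (fun _ => (1 : A)) i a) :=
  tprodBlock_tprod _ _ _ _ _ a

theorem algRot_tprod {n : ℕ} (a : Fin (n + 1) → A) :
    algRot k A (PiTensorProduct.tprod k a) = PiTensorProduct.tprod k (CyclicTuple.rot a) :=
  tprodBlock_tprod _ _ _ _ _ a

theorem algRot_pow_tprod {n : ℕ} (m : ℕ) (a : Fin (n + 1) → A) :
    (algRot k A ^ m) (PiTensorProduct.tprod k a) =
      PiTensorProduct.tprod k (CyclicTuple.rot^[m] a) := by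
  induction m with
  | zero => simp
  | succ m ih => rw [pow_succ', Module.End.mul_apply, ih, algRot_tprod,
      Function.iterate_succ_apply']

theorem tensor_ext {n : ℕ} {V : Type*} [AddCommGroup V] [Module k V]
    {φ ψ : (⨂[k] _ : Fin (n + 1), A) →ₗ[k] V}
    (h : ∀ a, φ (PiTensorProduct.tprod k a) = ψ (PiTensorProduct.tprod k a))
    (x : ⨂[k] _ : Fin (n + 1), A) : φ x = ψ x :=
  LinearMap.congr_fun (PiTensorProduct.ext (MultilinearMap.ext h)) x

/-- The cyclic module of a `k`-algebra `A`, with the `(n + 1)`-fold tensor power of `A` in degree `n`. -/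
noncomputable def algCyclicModule : CyclicModule.{max u w} k where
  X n := ⨂[k] _ : Fin (n + 1), A
  d i := algFace k A i
  s i := algDegen k A i
  t {n} := (-1 : k) ^ n • algRot k A
  d_d i j h := tensor_ext k A (φ := algFace k A j ∘ₗ algFace k A i.castSucc)
    (ψ := algFace k A i ∘ₗ algFace k A j.succ) fun a => by
      simp only [LinearMap.comp_apply, algFace_tprod]
      rw [CyclicTuple.face_face _ _ (fun i => mul_assoc _ _ _) _ _ h]
  s_s i j h := tensor_ext k A (φ := algDegen k A j.succ ∘ₗ algDegen k A i)
    (ψ := algDegen k A i.castSucc ∘ₗ algDegen k A j) fun a => by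
      simp only [LinearMap.comp_apply, algDegen_tprod]
      rw [CyclicTuple.degen_degen (fun _ => (1 : A)) (fun _ => rfl) _ _ _ h]
  d_s_of_lt i j h := tensor_ext k A (φ := algFace k A i.castSucc.castSucc ∘ₗ algDegen k A j.succ)
    (ψ := algDegen k A j ∘ₗ algFace k A i.castSucc) fun a => by
      simp only [LinearMap.comp_apply, algFace_tprod, algDegen_tprod]
      rw [CyclicTuple.face_degen_lt _ _ _ (fun _ => rfl) _ _ h]
  d_s_castSucc i := tensor_ext k A (φ := algFace k A i.castSucc ∘ₗ algDegen k A i)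
    (ψ := LinearMap.id) fun a => by
      simp only [LinearMap.comp_apply, algFace_tprod, algDegen_tprod, LinearMap.id_apply]
      rw [CyclicTuple.face_degen_self _ _ _ (fun _ => mul_one _)]
  d_s_succ i := tensor_ext k A (φ := algFace k A i.succ ∘ₗ algDegen k A i)
    (ψ := LinearMap.id) fun a => by
      simp only [LinearMap.comp_apply, algFace_tprod, algDegen_tprod, LinearMap.id_apply]
      rw [CyclicTuple.face_succ_degen_self _ _ _ (fun _ => one_mul _)]
  d_s_of_gt i j h := tensor_ext k A (φ := algFace k A i.succ.succ ∘ₗ algDegen k A j.castSucc)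
    (ψ := algDegen k A j ∘ₗ algFace k A i.succ) fun a => by
      simp only [LinearMap.comp_apply, algFace_tprod, algDegen_tprod]
      rw [CyclicTuple.face_degen_gt _ _ _ (fun _ => rfl) _ _ h]
  d_t {n} i := tensor_ext k A (φ := algFace k A i.succ ∘ₗ ((-1 : k) ^ (n + 1) • algRot k A))
    (ψ := - (((-1 : k) ^ n • algRot k A) ∘ₗ algFace k A i.castSucc)) fun a => by
      simp only [LinearMap.comp_apply, LinearMap.neg_apply, LinearMap.smul_apply, map_smul,
        algFace_tprod, algRot_tprod, CyclicTuple.face_rot]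
      simp [pow_succ]
  d_zero_t {n} := tensor_ext k A (φ := algFace k A 0 ∘ₗ ((-1 : k) ^ (n + 1) • algRot k A))
    (ψ := (-1 : k) ^ (n + 1) • algFace k A (Fin.last (n + 1))) fun a => by
      simp only [LinearMap.comp_apply, LinearMap.smul_apply, map_smul,
        algFace_tprod, algRot_tprod, CyclicTuple.face_zero_rot]
  s_t {n} i := tensor_ext k A (φ := algDegen k A i.succ ∘ₗ ((-1 : k) ^ n • algRot k A))
    (ψ := - (((-1 : k) ^ (n + 1) • algRot k A) ∘ₗ algDegen k A i.castSucc)) fun a => by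
      simp only [LinearMap.comp_apply, LinearMap.neg_apply, LinearMap.smul_apply, map_smul,
        algDegen_tprod, algRot_tprod, CyclicTuple.degen_rot]
      simp [pow_succ]
  s_zero_t {n} := tensor_ext k A (φ := algDegen k A 0 ∘ₗ ((-1 : k) ^ n • algRot k A))
    (ψ := (-1 : k) ^ n • (((-1 : k) ^ (n + 1) • algRot k A) ∘ₗ ((-1 : k) ^ (n + 1) • algRot k A) ∘ₗ
      algDegen k A (Fin.last n))) fun a => by
      simp only [LinearMap.comp_apply, LinearMap.smul_apply, map_smul,
        algDegen_tprod, algRot_tprod, CyclicTuple.degen_zero_rot,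
        CyclicModule.neg_one_smul_smul]
  t_pow {n} := tensor_ext k A (φ := ((-1 : k) ^ n • algRot k A) ^ (n + 1))
    (ψ := LinearMap.id) fun a => by
      rw [smul_pow, LinearMap.smul_apply, algRot_pow_tprod, CyclicTuple.rot_iterate, ← pow_mul,
        (Nat.even_mul_succ_self n).neg_one_pow, one_smul, LinearMap.id_apply]

end Algebra


namespace AddCyclicNerve
universe v₁ u₁
variable {C : Type u₁} [Category.{v₁} C]

/-- A morphism transported along equalities of its source and target. -/
def castHom {a b a' b' : C} (ha : a' = a) (hb : b = b') (f : a ⟶ b) : a' ⟶ b' :=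
  eqToHom ha ≫ f ≫ eqToHom hb

theorem mk_castHom {a b a' b' : C} (ha : a' = a) (hb : b = b') (f : a ⟶ b) :
    Arrow.mk (castHom ha hb f) = Arrow.mk f := by
  subst ha hb; simp [castHom]

theorem congr_val {n : ℕ} (c : Fin n → C) {p q : Fin n} (h : (p : ℕ) = q) : c p = c q :=
  congrArg c (Fin.ext h)

/-- The objects `(C₀, …, Cₙ)` of a face: drop `Cᵢ₊₁` if `i ≤ n`; for the last face, the result is
`(Cₙ₊₁, C₁, …, Cₙ)`. -/
def faceObj {n : ℕ} (i : Fin (n + 2)) (c : Fin (n + 2) → C) : Fin (n + 1) → C := fun j =>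
  if i = Fin.last (n + 1) ∧ j = 0 then c (Fin.last (n + 1))
  else if (j : ℕ) ≤ i then c j.castSucc else c j.succ

theorem faceObj_eq {n : ℕ} {i : Fin (n + 2)} (c : Fin (n + 2) → C) {j : Fin (n + 1)}
    {p : Fin (n + 2)} (h : (p : ℕ) = if (i : ℕ) = n + 1 ∧ (j : ℕ) = 0 then n + 1
      else if (j : ℕ) ≤ i then (j : ℕ) else j + 1) : faceObj i c j = c p := by
  have h0 : (i = Fin.last (n + 1) ∧ j = 0) ↔ ((i : ℕ) = n + 1 ∧ (j : ℕ) = 0) := by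
    simp only [Fin.ext_iff, Fin.val_last, Fin.val_zero]
  simp only [faceObj, h0]
  split_ifs at h ⊢ <;> exact congr_val c h.symm

theorem faceObj_succ_eq {n : ℕ} {i : Fin (n + 2)} (c : Fin (n + 2) → C) {j : Fin (n + 1)}
    {p : Fin (n + 2)} (h : (p : ℕ) = if (j : ℕ) = n then (if (i : ℕ) = n + 1 then n + 1 else 0)
      else if (j : ℕ) + 1 ≤ i then (j : ℕ) + 1 else j + 2) : faceObj i c (j + 1) = c p := by
  apply faceObj_eq
  have := CyclicTuple.val_add_one j
  split_ifs at h this ⊢ <;> omega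

/-- The face of a cyclic word of composable morphisms `fₚ : Cₚ₊₁ ⟶ Cₚ` (indices modulo the length):
replace `fᵢ, fᵢ₊₁` by the composite `fᵢ ∘ fᵢ₊₁`; the last face replaces `f₀` by `fₙ₊₁ ∘ f₀` and drops
`fₙ₊₁`. -/
def faceHom {n : ℕ} (i : Fin (n + 2)) (c : Fin (n + 2) → C) (f : ∀ p, c (p + 1) ⟶ c p)
    (j : Fin (n + 1)) : faceObj i c (j + 1) ⟶ faceObj i c j :=
  if hi : (i : ℕ) = n + 1 then
    if hj : (j : ℕ) = 0 then
      castHom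
        (faceObj_succ_eq c (by
          rw [CyclicTuple.val_add_one]; simp only [Fin.val_zero]; split_ifs <;> omega))
        (faceObj_eq c (by simp only [Fin.val_last]; split_ifs <;> omega)).symm
        (f 0 ≫ castHom (congr_val c (by simp)) rfl (f (Fin.last (n + 1))))
    else
      castHom
        (faceObj_succ_eq c (by
          rw [CyclicTuple.val_add_one, Fin.val_castSucc]; split_ifs <;> omega))
        (faceObj_eq c (by simp only [Fin.val_castSucc]; split_ifs <;> omega)).symm (f j.castSucc)
  else if hj : (j : ℕ) < i then
    castHom
      (faceObj_succ_eq c (by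
        rw [CyclicTuple.val_add_one, Fin.val_castSucc]; split_ifs <;> omega))
      (faceObj_eq c (by simp only [Fin.val_castSucc]; split_ifs <;> omega)).symm (f j.castSucc)
  else if hj' : (j : ℕ) = i then
    castHom
      (faceObj_succ_eq c (by rw [CyclicTuple.val_add_one, Fin.val_succ]; split_ifs <;> omega))
      (faceObj_eq c (by simp only [Fin.val_castSucc]; split_ifs <;> omega)).symm
      (f j.succ ≫ castHom (congr_val c (by
        rw [CyclicTuple.val_add_one, Fin.val_succ, Fin.val_castSucc]; split_ifs <;> omega))
        rfl (f j.castSucc))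
  else
    castHom
      (faceObj_succ_eq c (by rw [CyclicTuple.val_add_one, Fin.val_succ]; split_ifs <;> omega))
      (faceObj_eq c (by simp only [Fin.val_succ]; split_ifs <;> omega)).symm (f j.succ)

/-- The objects of a degeneracy: the object `Cᵢ₊₁` is repeated. -/
def degenObj {n : ℕ} (i : Fin (n + 1)) (c : Fin (n + 1) → C) : Fin (n + 2) → C := fun j =>
  if h : (j : ℕ) ≤ i then c ⟨j, by omega⟩
  else if (j : ℕ) = i + 1 then c (i + 1) else c ⟨j - 1, by omega⟩

theorem degenObj_eq {n : ℕ} {i : Fin (n + 1)} (c : Fin (n + 1) → C) {j : Fin (n + 2)}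
    {p : Fin (n + 1)} (h : (p : ℕ) = if (j : ℕ) ≤ i then (j : ℕ)
      else if (j : ℕ) = i + 1 then (if (i : ℕ) = n then 0 else i + 1) else j - 1) :
    degenObj i c j = c p := by
  simp only [degenObj]
  split_ifs <;> refine congr_val c ?_ <;> simp only [CyclicTuple.val_add_one, h] <;>
    split_ifs <;> omega

/-- The degeneracy of a cyclic word of morphisms: insert the identity of `Cᵢ₊₁` after `fᵢ`. -/
def degenHom {n : ℕ} (i : Fin (n + 1)) (c : Fin (n + 1) → C) (f : ∀ p, c (p + 1) ⟶ c p)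
    (j : Fin (n + 2)) : degenObj i c (j + 1) ⟶ degenObj i c j :=
  if hj : (j : ℕ) ≤ i then
    castHom (degenObj_eq c (by simp only [CyclicTuple.val_add_one]; split_ifs <;> omega))
      (degenObj_eq c (by simp only; split_ifs <;> omega)).symm (f ⟨j, by omega⟩)
  else if hj' : (j : ℕ) = i + 1 then
    castHom (degenObj_eq c (by simp only [CyclicTuple.val_add_one]; split_ifs <;> omega))
      (degenObj_eq c (by simp only [CyclicTuple.val_add_one]; split_ifs <;> omega)).symm
      (𝟙 (c (i + 1)))
  else
    castHom (degenObj_eq c (by simp only [CyclicTuple.val_add_one]; split_ifs <;> omega))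
      (degenObj_eq c (by simp only; split_ifs <;> omega)).symm (f ⟨j - 1, by omega⟩)

/-- The objects of the rotation. -/
def rotObj {n : ℕ} (c : Fin (n + 1) → C) : Fin (n + 1) → C := fun j => c (j - 1)

/-- The rotation `f₀, …, fₙ ↦ fₙ, f₀, …, fₙ₋₁` of a cyclic word of morphisms. -/
def rotHom {n : ℕ} (c : Fin (n + 1) → C) (f : ∀ p, c (p + 1) ⟶ c p)
    (j : Fin (n + 1)) : rotObj c (j + 1) ⟶ rotObj c j :=
  castHom (congrArg c (by abel)) rfl (f (j - 1))

open Classical in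
/-- Auxiliary: composition of arrows, with a junk value if they are not composable. -/
noncomputable def arrowMul (f g : Arrow C) : Arrow C :=
  if h : g.right = f.left then Arrow.mk (g.hom ≫ eqToHom h ≫ f.hom) else f

theorem arrowMul_mk {a b a' b' : C} (f : a ⟶ b) (g : a' ⟶ b') (h : b' = a) :
    arrowMul (Arrow.mk f) (Arrow.mk g) = Arrow.mk (g ≫ castHom h rfl f) := by
  subst h
  simp [arrowMul, castHom]

theorem arrowMul_of_eq (f g : Arrow C) (h : g.right = f.left) :
    arrowMul f g = Arrow.mk (g.hom ≫ eqToHom h ≫ f.hom) := dif_pos h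

theorem arrowMul_assoc (f g h : Arrow C) (h1 : g.right = f.left) (h2 : h.right = g.left) :
    arrowMul (arrowMul f g) h = arrowMul f (arrowMul g h) := by
  rw [arrowMul_of_eq f g h1, arrowMul_of_eq g h h2, arrowMul_of_eq _ _ (by exact h2),
    arrowMul_of_eq _ _ (by exact h1)]
  simp

theorem arrow_faceHom {n : ℕ} (i : Fin (n + 2)) (c : Fin (n + 2) → C) (f : ∀ p, c (p + 1) ⟶ c p) :
    (fun j => Arrow.mk (faceHom i c f j)) =
      CyclicTuple.face arrowMul i (fun p => Arrow.mk (f p)) := by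
  funext j
  have e1 : i = Fin.last (n + 1) ↔ (i : ℕ) = n + 1 := by simp [Fin.ext_iff]
  have e2 : j = 0 ↔ (j : ℕ) = 0 := by
    simp only [Fin.ext_iff, Fin.val_zero]
  simp only [CyclicTuple.face, faceHom, e1, e2]
  by_cases hi : (i : ℕ) = n + 1
  · rw [dif_pos hi, if_pos hi]
    by_cases hj : (j : ℕ) = 0
    · rw [dif_pos hj, if_pos hj, mk_castHom]
      exact (arrowMul_mk _ _ (congr_val c (by simp; try omega))).symm
    · rw [dif_neg hj, if_neg hj, mk_castHom]
  · rw [dif_neg hi, if_neg hi]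
    by_cases hj : (j : ℕ) < i
    · rw [dif_pos hj, if_pos hj, mk_castHom]
    · rw [dif_neg hj, if_neg hj]
      by_cases hj' : (j : ℕ) = i
      · rw [dif_pos hj', if_pos hj', mk_castHom]
        exact (arrowMul_mk _ _ (congr_val c (by simp; try omega))).symm
      · rw [dif_neg hj', if_neg hj', mk_castHom]

theorem arrow_degenHom {n : ℕ} (i : Fin (n + 1)) (c : Fin (n + 1) → C) (f : ∀ p, c (p + 1) ⟶ c p) :
    (fun j => Arrow.mk (degenHom i c f j)) =
      CyclicTuple.degen (fun g => Arrow.mk (𝟙 g.left)) i (fun p => Arrow.mk (f p)) := by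
  funext j
  simp only [CyclicTuple.degen, degenHom]
  split_ifs with h1 h2
  · rw [mk_castHom]
  · rw [mk_castHom]; rfl
  · rw [mk_castHom]

theorem arrow_rotHom {n : ℕ} (c : Fin (n + 1) → C) (f : ∀ p, c (p + 1) ⟶ c p) :
    (fun j => Arrow.mk (rotHom c f j)) = CyclicTuple.rot (fun p => Arrow.mk (f p)) := by
  funext j
  exact mk_castHom _ _ _

variable (k : Type u) [CommRing k] [Preadditive C] [Linear k C]

theorem castHom_add {a b a' b' : C} (ha : a' = a) (hb : b = b') (f g : a ⟶ b) :
    castHom ha hb (f + g) = castHom ha hb f + castHom ha hb g := by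
  simp [castHom]

theorem castHom_smul {a b a' b' : C} (ha : a' = a) (hb : b = b') (r : k) (f : a ⟶ b) :
    castHom ha hb (r • f) = r • castHom ha hb f := by
  simp [castHom]

/-- The tensor product `Hom(C₁, C₀) ⊗ Hom(C₂, C₁) ⊗ ⋯ ⊗ Hom(C₀, Cₙ)`. The index `i + 1` is taken modulo
`n + 1`. -/
abbrev Summand {n : ℕ} (c : Fin (n + 1) → C) : Type (max u v₁) :=
  PiTensorProduct k fun i : Fin (n + 1) => (c (i + 1) ⟶ c i)

variable (C) in
/-- The direct sum of these tensor products over all tuples of objects. -/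
abbrev Obj (n : ℕ) : Type (max u u₁ v₁) :=
  DirectSum (Fin (n + 1) → C) fun c => Summand k c

theorem castHom_add_comp {a b c' d a' b' : C} (ha : a' = a) (hb : b = b') (hm : c' = d)
    (f : a ⟶ d) (g g' : c' ⟶ b) :
    castHom ha hb (f ≫ castHom hm.symm rfl (g + g')) =
      castHom ha hb (f ≫ castHom hm.symm rfl g) + castHom ha hb (f ≫ castHom hm.symm rfl g') := by
  simp [castHom]

theorem castHom_comp_add {a b c' d a' b' : C} (ha : a' = a) (hb : b = b') (hm : c' = d)
    (f f' : a ⟶ d) (g : c' ⟶ b) :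
    castHom ha hb ((f + f') ≫ castHom hm.symm rfl g) =
      castHom ha hb (f ≫ castHom hm.symm rfl g) + castHom ha hb (f' ≫ castHom hm.symm rfl g) := by
  simp [castHom]

theorem castHom_smul_comp {a b c' d a' b' : C} (ha : a' = a) (hb : b = b') (hm : c' = d) (r s : k)
    (f : a ⟶ d) (g : c' ⟶ b) :
    castHom ha hb ((r • f) ≫ castHom hm.symm rfl (s • g)) =
      (r * s) • castHom ha hb (f ≫ castHom hm.symm rfl g) := by
  simp [castHom, smul_smul, mul_comm]

theorem faceHom_cases {n : ℕ} (i : Fin (n + 2)) (c : Fin (n + 2) → C) (j : Fin (n + 1)) :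
    (∃ q : Fin (n + 2), (∀ p, CyclicTuple.faceBlock i p = j ↔ p = q) ∧
      ∃ (ha : faceObj i c (j + 1) = c (q + 1)) (hb : c q = faceObj i c j),
      ∀ f, faceHom i c f j = castHom ha hb (f q)) ∨
    (∃ q q' : Fin (n + 2), q ≠ q' ∧ (∀ p, CyclicTuple.faceBlock i p = j ↔ p = q ∨ p = q') ∧
      ∃ (ha : faceObj i c (j + 1) = c (q + 1)) (hb : c q' = faceObj i c j)
      (hm : c (q' + 1) = c q),
      ∀ f, faceHom i c f j = castHom ha hb (f q ≫ castHom hm.symm rfl (f q'))) := by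
  have blk : ∀ p : Fin (n + 2), (CyclicTuple.faceBlock i p : ℕ) =
      if (i : ℕ) = n + 1 then (if (p : ℕ) = n + 1 then 0 else (p : ℕ))
      else if (p : ℕ) ≤ i then (p : ℕ) else p - 1 := by
    intro p
    simp only [CyclicTuple.faceBlock]
    split_ifs <;> rfl
  simp only [Fin.ext_iff, blk, ne_eq]
  by_cases hi : (i : ℕ) = n + 1
  · by_cases hj : (j : ℕ) = 0
    · refine Or.inr ⟨0, Fin.last (n + 1), by simp, fun p => ?_,
        _, _, congr_val c (by simp), fun f => (dif_pos hi).trans (dif_pos hj)⟩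
      simp only [Fin.val_zero, Fin.val_last]
      split_ifs <;> omega
    · refine Or.inl ⟨j.castSucc, fun p => ?_, _, _, fun f => (dif_pos hi).trans (dif_neg hj)⟩
      simp only [Fin.val_castSucc]
      split_ifs <;> omega
  · by_cases hj : (j : ℕ) < i
    · refine Or.inl ⟨j.castSucc, fun p => ?_, _, _, fun f => (dif_neg hi).trans (dif_pos hj)⟩
      simp only [Fin.val_castSucc]
      split_ifs <;> omega
    · by_cases hj' : (j : ℕ) = i
      · refine Or.inr ⟨j.succ, j.castSucc, by simp, fun p => ?_,
          _, _, congr_val c (by rw [CyclicTuple.val_add_one]; simp; omega),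
          fun f => (dif_neg hi).trans ((dif_neg hj).trans (dif_pos hj'))⟩
        simp only [Fin.val_castSucc, Fin.val_succ]
        split_ifs <;> omega
      · refine Or.inl ⟨j.succ, fun p => ?_, _, _,
          fun f => (dif_neg hi).trans ((dif_neg hj).trans (dif_neg hj'))⟩
        simp only [Fin.val_succ]
        split_ifs <;> omega

/-- The face on one summand. -/
noncomputable def faceSummand {n : ℕ} (i : Fin (n + 2)) (c : Fin (n + 2) → C) :
    Summand k c →ₗ[k] Summand k (faceObj i c) :=
  tprodBlock (CyclicTuple.faceBlock i) (faceHom i c)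
    (by
      intro f p a j hj
      rcases faceHom_cases i c j with ⟨q, h, ha, hb, h'⟩ | ⟨q, q', hne, h, ha, hb, hm, h'⟩
      · rw [h', h', Function.update_of_ne]
        exact fun e => hj ((h p).2 e.symm).symm
      · rw [h', h', Function.update_of_ne, Function.update_of_ne]
        · exact fun e => hj ((h p).2 (Or.inr e.symm)).symm
        · exact fun e => hj ((h p).2 (Or.inl e.symm)).symm)
    (by
      intro f p a b
      rcases faceHom_cases i c (CyclicTuple.faceBlock i p) with
        ⟨q, h, ha, hb, h'⟩ | ⟨q, q', hne, h, ha, hb, hm, h'⟩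
      · obtain rfl := (h p).1 rfl
        simp only [h', Function.update_self, castHom_add]
      · rcases (h p).1 rfl with rfl | rfl
        · simp only [h', Function.update_self, Function.update_of_ne hne.symm]
          exact castHom_comp_add ha hb hm a b (f q')
        · simp only [h', Function.update_self, Function.update_of_ne hne]
          exact castHom_add_comp ha hb hm (f q) a b)
    (by
      intro f p r a
      rcases faceHom_cases i c (CyclicTuple.faceBlock i p) with
        ⟨q, h, ha, hb, h'⟩ | ⟨q, q', hne, h, ha, hb, hm, h'⟩
      · obtain rfl := (h p).1 rfl
        simp only [h', Function.update_self, castHom_smul]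
      · rcases (h p).1 rfl with rfl | rfl
        · simpa only [h', Function.update_self, Function.update_of_ne hne.symm, one_smul, mul_one]
            using castHom_smul_comp k ha hb hm r 1 a (f q')
        · simpa only [h', Function.update_self, Function.update_of_ne hne, one_smul, one_mul]
            using castHom_smul_comp k ha hb hm 1 r (f q) a)

theorem degenHom_cases {n : ℕ} (i : Fin (n + 1)) (c : Fin (n + 1) → C) (j : Fin (n + 2)) :
    (∃ q : Fin (n + 1), (∀ p, CyclicTuple.degenBlock i p = j ↔ p = q) ∧
      ∃ (ha : degenObj i c (j + 1) = c (q + 1)) (hb : c q = degenObj i c j),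
      ∀ f, degenHom i c f j = castHom ha hb (f q)) ∨
    ((∀ p, CyclicTuple.degenBlock i p ≠ j) ∧ ∀ f f', degenHom i c f j = degenHom i c f' j) := by
  have blk : ∀ p : Fin (n + 1), (CyclicTuple.degenBlock i p : ℕ) =
      if (p : ℕ) ≤ i then (p : ℕ) else p + 1 := by
    intro p
    simp only [CyclicTuple.degenBlock]
    split_ifs <;> rfl
  simp only [Fin.ext_iff, blk, ne_eq]
  by_cases hj : (j : ℕ) ≤ i
  · refine Or.inl ⟨⟨j, by omega⟩, fun p => ?_, _, _, fun f => dif_pos hj⟩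
    simp only
    split_ifs <;> omega
  · by_cases hj' : (j : ℕ) = i + 1
    · refine Or.inr ⟨fun p => ?_, fun f f' =>
        ((dif_neg hj).trans (dif_pos hj')).trans ((dif_neg hj).trans (dif_pos hj')).symm⟩
      split_ifs <;> omega
    · refine Or.inl ⟨⟨j - 1, by omega⟩, fun p => ?_, _, _,
        fun f => (dif_neg hj).trans (dif_neg hj')⟩
      simp only
      split_ifs <;> omega

/-- The degeneracy on one summand. -/
noncomputable def degenSummand {n : ℕ} (i : Fin (n + 1)) (c : Fin (n + 1) → C) :
    Summand k c →ₗ[k] Summand k (degenObj i c) :=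
  tprodBlock (CyclicTuple.degenBlock i) (degenHom i c)
    (by
      intro f p a j hj
      rcases degenHom_cases i c j with ⟨q, h, ha, hb, h'⟩ | ⟨h, h'⟩
      · rw [h', h', Function.update_of_ne]
        exact fun e => hj ((h p).2 e.symm).symm
      · exact h' _ _)
    (by
      intro f p a b
      rcases degenHom_cases i c (CyclicTuple.degenBlock i p) with ⟨q, h, ha, hb, h'⟩ | ⟨h, h'⟩
      · obtain rfl := (h p).1 rfl
        simp only [h', Function.update_self, castHom_add]
      · exact absurd rfl (h p))
    (by
      intro f p r a
      rcases degenHom_cases i c (CyclicTuple.degenBlock i p) with ⟨q, h, ha, hb, h'⟩ | ⟨h, h'⟩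
      · obtain rfl := (h p).1 rfl
        simp only [h', Function.update_self, castHom_smul]
      · exact absurd rfl (h p))

/-- The rotation on one summand. -/
noncomputable def rotSummand {n : ℕ} (c : Fin (n + 1) → C) :
    Summand k c →ₗ[k] Summand k (rotObj c) :=
  tprodBlock (fun p => p + 1) (rotHom c)
    (by
      intro f p a j hj
      have : j - 1 ≠ p := fun h => hj (by rw [← h, sub_add_cancel])
      simp only [rotHom, Function.update_of_ne this])
    (by
      intro f p a b
      have h : ∀ (j : Fin (n + 1)), j - 1 = p → rotHom c (Function.update f p (a + b)) j =
          rotHom c (Function.update f p a) j + rotHom c (Function.update f p b) j := by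
        rintro j rfl
        simp only [rotHom, Function.update_self]
        exact castHom_add _ _ a b
      exact h _ (add_sub_cancel_right p 1))
    (by
      intro f p r a
      have h : ∀ (j : Fin (n + 1)), j - 1 = p → rotHom c (Function.update f p (r • a)) j =
          r • rotHom c (Function.update f p a) j := by
        rintro j rfl
        simp only [rotHom, Function.update_self]
        exact castHom_smul k _ _ r a
      exact h _ (add_sub_cancel_right p 1))

open Classical in
/-- The element `f₀ ⊗ ⋯ ⊗ fₙ` of the summand of `(C₀, …, Cₙ)`. -/
noncomputable def gen {n : ℕ} (c : Fin (n + 1) → C) (f : ∀ p, c (p + 1) ⟶ c p) : Obj C k n :=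
  DirectSum.lof k (Fin (n + 1) → C) (fun c => Summand k c) c (PiTensorProduct.tprod k f)

open Classical in
/-- The face maps of the additive cyclic nerve. -/
noncomputable def face {n : ℕ} (i : Fin (n + 2)) : Obj C k (n + 1) →ₗ[k] Obj C k n :=
  DirectSum.toModule k _ _ fun c =>
    DirectSum.lof k (Fin (n + 1) → C) (fun c => Summand k c) (faceObj i c) ∘ₗ faceSummand k i c

open Classical in
/-- The degeneracy maps of the additive cyclic nerve. -/
noncomputable def degen {n : ℕ} (i : Fin (n + 1)) : Obj C k n →ₗ[k] Obj C k (n + 1) :=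
  DirectSum.toModule k _ _ fun c =>
    DirectSum.lof k (Fin (n + 2) → C) (fun c => Summand k c) (degenObj i c) ∘ₗ degenSummand k i c

open Classical in
/-- The rotation on the additive cyclic nerve (without sign). -/
noncomputable def rot {n : ℕ} : Obj C k n →ₗ[k] Obj C k n :=
  DirectSum.toModule k _ _ fun c =>
    DirectSum.lof k (Fin (n + 1) → C) (fun c => Summand k c) (rotObj c) ∘ₗ rotSummand k c

theorem face_gen {n : ℕ} (i : Fin (n + 2)) (c : Fin (n + 2) → C) (f : ∀ p, c (p + 1) ⟶ c p) :
    face k i (gen k c f) = gen k (faceObj i c) (faceHom i c f) := by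
  classical
  refine (DirectSum.toModule_lof k (M := fun c => Summand k c) c _).trans ?_
  rw [LinearMap.comp_apply, faceSummand, tprodBlock_tprod]
  rfl

theorem degen_gen {n : ℕ} (i : Fin (n + 1)) (c : Fin (n + 1) → C) (f : ∀ p, c (p + 1) ⟶ c p) :
    degen k i (gen k c f) = gen k (degenObj i c) (degenHom i c f) := by
  classical
  refine (DirectSum.toModule_lof k (M := fun c => Summand k c) c _).trans ?_
  rw [LinearMap.comp_apply, degenSummand, tprodBlock_tprod]
  rfl

theorem rot_gen {n : ℕ} (c : Fin (n + 1) → C) (f : ∀ p, c (p + 1) ⟶ c p) :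
    rot k (gen k c f) = gen k (rotObj c) (rotHom c f) := by
  classical
  refine (DirectSum.toModule_lof k (M := fun c => Summand k c) c _).trans ?_
  exact congrArg (DirectSum.lof k (Fin (n + 1) → C) (fun c => Summand k c) (rotObj c))
    (tprodBlock_tprod _ _ _ _ _ f)

theorem gen_congr {n : ℕ} {c c' : Fin (n + 1) → C} {f : ∀ p, c (p + 1) ⟶ c p}
    {f' : ∀ p, c' (p + 1) ⟶ c' p}
    (h : (fun p => Arrow.mk (f p)) = fun p => Arrow.mk (f' p)) : gen k c f = gen k c' f' := by
  have hc : c = c' := funext fun p => congrArg Comma.right (congrFun h p)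
  subst hc
  have hf : f = f' := funext fun p => Arrow.mk_injective _ _ (congrFun h p)
  rw [hf]

theorem obj_ext {n : ℕ} {V : Type*} [AddCommGroup V] [Module k V] {φ ψ : Obj C k n →ₗ[k] V}
    (h : ∀ c f, φ (gen k c f) = ψ (gen k c f)) (x : Obj C k n) : φ x = ψ x := by
  classical
  refine LinearMap.congr_fun (DirectSum.linearMap_ext k fun c => ?_) x
  exact PiTensorProduct.ext (MultilinearMap.ext (h c))

theorem rot_pow_gen {n : ℕ} (m : ℕ) (c : Fin (n + 1) → C) (f : ∀ p, c (p + 1) ⟶ c p) :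
    ∃ (c' : Fin (n + 1) → C) (f' : ∀ p, c' (p + 1) ⟶ c' p),
      (rot k ^ m) (gen k c f) = gen k c' f' ∧
      (fun p => Arrow.mk (f' p)) = CyclicTuple.rot^[m] fun p => Arrow.mk (f p) := by
  induction m with
  | zero => exact ⟨c, f, rfl, rfl⟩
  | succ m ih =>
    obtain ⟨c', f', h1, h2⟩ := ih
    refine ⟨rotObj c', rotHom c' f', ?_, ?_⟩
    · rw [pow_succ', Module.End.mul_apply, h1, rot_gen]
    · rw [arrow_rotHom, h2, Function.iterate_succ_apply']

theorem arrowMul_left (f g : Arrow C) (h : g.right = f.left) : (arrowMul f g).left = g.left := by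
  rw [arrowMul_of_eq f g h]; rfl

theorem arrowMul_id (f : Arrow C) : arrowMul f (Arrow.mk (𝟙 f.left)) = f := by
  rw [arrowMul_of_eq _ _ rfl]
  simp

theorem arrowMul_id_left (f g : Arrow C) (h : g.right = f.left) :
    arrowMul (Arrow.mk (𝟙 f.left)) g = g := by
  rw [arrowMul_of_eq (Arrow.mk (𝟙 f.left)) g h]
  have key : ∀ x (h : g.right = x), Arrow.mk (g.hom ≫ eqToHom h ≫ 𝟙 x) = g := by
    rintro _ rfl
    simp
  exact key _ h

end AddCyclicNerve

section
universe v₁ u₁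
open AddCyclicNerve
variable (k : Type u) [CommRing k] (C : Type u₁) [Category.{v₁} C] [Preadditive C] [Linear k C]

/-- The additive cyclic nerve of a `k`-linear category: in degree `n` it is the direct sum over all
`(n + 1)`-tuples of objects of `Hom(C₁, C₀) ⊗ Hom(C₂, C₁) ⊗ ⋯ ⊗ Hom(C₀, Cₙ)`. -/
noncomputable def addCyclicNerve : CyclicModule.{max u u₁ v₁} k where
  X n := AddCyclicNerve.Obj C k n
  d i := AddCyclicNerve.face k i
  s i := AddCyclicNerve.degen k i
  t {n} := (-1 : k) ^ n • AddCyclicNerve.rot k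
  d_d i j h := obj_ext k (φ := face k j ∘ₗ face k i.castSucc) (ψ := face k i ∘ₗ face k j.succ)
    fun c f => by
      simp only [LinearMap.comp_apply, face_gen]
      apply gen_congr
      simp only [arrow_faceHom]
      exact CyclicTuple.face_face _ _ (fun p => arrowMul_assoc _ _ _ rfl
        (by
          rw [show p + 2 = p + 1 + 1 by rw [add_assoc]; rfl]
          rfl)) _ _ h
  s_s i j h := obj_ext k (φ := degen k j.succ ∘ₗ degen k i) (ψ := degen k i.castSucc ∘ₗ degen k j)
    fun c f => by
      simp only [LinearMap.comp_apply, degen_gen]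
      apply gen_congr
      simp only [arrow_degenHom]
      exact CyclicTuple.degen_degen (fun g : Arrow C => Arrow.mk (𝟙 g.left)) (fun _ => rfl) _ _ _ h
  d_s_of_lt i j h := obj_ext k (φ := face k i.castSucc.castSucc ∘ₗ degen k j.succ)
    (ψ := degen k j ∘ₗ face k i.castSucc) fun c f => by
      simp only [LinearMap.comp_apply, degen_gen, face_gen]
      apply gen_congr
      simp only [arrow_degenHom, arrow_faceHom]
      exact CyclicTuple.face_degen_lt _ _ _ (fun p => by rw [arrowMul_left _ _ rfl]) _ _ h
  d_s_castSucc i := obj_ext k (φ := face k i.castSucc ∘ₗ degen k i) (ψ := LinearMap.id)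
    fun c f => by
      simp only [LinearMap.comp_apply, degen_gen, face_gen, LinearMap.id_apply]
      apply gen_congr
      simp only [arrow_degenHom, arrow_faceHom]
      exact CyclicTuple.face_degen_self _ _ _ (fun p => arrowMul_id _) _
  d_s_succ i := obj_ext k (φ := face k i.succ ∘ₗ degen k i) (ψ := LinearMap.id)
    fun c f => by
      simp only [LinearMap.comp_apply, degen_gen, face_gen, LinearMap.id_apply]
      apply gen_congr
      simp only [arrow_degenHom, arrow_faceHom]
      exact CyclicTuple.face_succ_degen_self _ _ _ (fun p => arrowMul_id_left _ _ rfl) _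
  d_s_of_gt i j h := obj_ext k (φ := face k i.succ.succ ∘ₗ degen k j.castSucc)
    (ψ := degen k j ∘ₗ face k i.succ) fun c f => by
      simp only [LinearMap.comp_apply, degen_gen, face_gen]
      apply gen_congr
      simp only [arrow_degenHom, arrow_faceHom]
      exact CyclicTuple.face_degen_gt _ _ _ (fun p => by rw [arrowMul_left _ _ rfl]) _ _ h
  d_t {n} i := obj_ext k (φ := face k i.succ ∘ₗ ((-1 : k) ^ (n + 1) • rot k))
    (ψ := - (((-1 : k) ^ n • rot k) ∘ₗ face k i.castSucc)) fun c f => by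
      have : face k i.succ (rot k (gen k c f)) = rot k (face k i.castSucc (gen k c f)) := by
        simp only [face_gen, rot_gen]
        apply gen_congr
        simp only [arrow_rotHom, arrow_faceHom]
        exact CyclicTuple.face_rot _ _ _
      simp only [LinearMap.comp_apply, LinearMap.neg_apply, LinearMap.smul_apply, map_smul, this]
      rw [pow_succ, mul_neg, mul_one]
      exact neg_smul ((-1 : k) ^ n) (rot k (face k i.castSucc (gen k c f)))
  d_zero_t {n} := obj_ext k (φ := face k 0 ∘ₗ ((-1 : k) ^ (n + 1) • rot k))
    (ψ := (-1 : k) ^ (n + 1) • face k (Fin.last (n + 1))) fun c f => by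
      have : face k 0 (rot k (gen k c f)) = face k (Fin.last (n + 1)) (gen k c f) := by
        simp only [face_gen, rot_gen]
        apply gen_congr
        simp only [arrow_rotHom, arrow_faceHom]
        exact CyclicTuple.face_zero_rot _ _
      simp only [LinearMap.comp_apply, LinearMap.smul_apply, map_smul, this]
  s_t {n} i := obj_ext k (φ := degen k i.succ ∘ₗ ((-1 : k) ^ n • rot k))
    (ψ := - (((-1 : k) ^ (n + 1) • rot k) ∘ₗ degen k i.castSucc)) fun c f => by
      have : degen k i.succ (rot k (gen k c f)) = rot k (degen k i.castSucc (gen k c f)) := by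
        simp only [degen_gen, rot_gen]
        apply gen_congr
        simp only [arrow_rotHom, arrow_degenHom]
        exact CyclicTuple.degen_rot _ _ _
      simp only [LinearMap.comp_apply, LinearMap.neg_apply, LinearMap.smul_apply, map_smul, this]
      rw [pow_succ, mul_neg, mul_one]
      exact ((congrArg Neg.neg (neg_smul _ _)).trans (neg_neg _)).symm
  s_zero_t {n} := obj_ext k (φ := degen k 0 ∘ₗ ((-1 : k) ^ n • rot k))
    (ψ := (-1 : k) ^ n • (((-1 : k) ^ (n + 1) • rot k) ∘ₗ ((-1 : k) ^ (n + 1) • rot k) ∘ₗ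
      degen k (Fin.last n))) fun c f => by
      have : degen k 0 (rot k (gen k c f)) = rot k (rot k (degen k (Fin.last n) (gen k c f))) := by
        simp only [degen_gen, rot_gen]
        apply gen_congr
        simp only [arrow_rotHom, arrow_degenHom]
        exact CyclicTuple.degen_zero_rot _ _
      simp only [LinearMap.comp_apply, LinearMap.smul_apply, map_smul, this,
        CyclicModule.neg_one_smul_smul]
  t_pow {n} := obj_ext k (φ := ((-1 : k) ^ n • rot k) ^ (n + 1)) (ψ := LinearMap.id) fun c f => by
      obtain ⟨c', f', h1, h2⟩ := rot_pow_gen k (n + 1) c f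
      rw [CyclicTuple.rot_iterate] at h2
      rw [smul_pow, LinearMap.smul_apply, h1, ← pow_mul,
        (Nat.even_mul_succ_self n).neg_one_pow, one_smul, LinearMap.id_apply]
      exact gen_congr k h2

end


/-- A coarse structure on a set. -/
structure CoarseStructure (X : Type*) where
  IsEntourage : SetRel X X → Prop
  diag : IsEntourage SetRel.id
  subset : ∀ {U V : SetRel X X}, U ⊆ V → IsEntourage V → IsEntourage U
  union : ∀ {U V : SetRel X X}, IsEntourage U → IsEntourage V → IsEntourage (U ∪ V)
  inv : ∀ {U : SetRel X X}, IsEntourage U → IsEntourage U.inv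
  comp : ∀ {U V : SetRel X X}, IsEntourage U → IsEntourage V → IsEntourage (U.comp V)

/-- The entourages of the coarse structure generated by a family of relations. -/
inductive CoarseStructure.Generated {X : Type*} (S : Set (SetRel X X)) : SetRel X X → Prop
  | basic {U} : U ∈ S → Generated S U
  | diag : Generated S SetRel.id
  | subset {U V} : U ⊆ V → Generated S V → Generated S U
  | union {U V} : Generated S U → Generated S V → Generated S (U ∪ V)
  | inv {U} : Generated S U → Generated S U.inv
  | comp {U V} : Generated S U → Generated S V → Generated S (U.comp V)

/-- The coarse structure generated by a family of relations. -/
def CoarseStructure.generate {X : Type*} (S : Set (SetRel X X)) : CoarseStructure X where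
  IsEntourage := Generated S
  diag := .diag
  subset := .subset
  union := .union
  inv := .inv
  comp := .comp


open scoped Pointwise in
/-- A `G`-bornological coarse space: a `G`-set with a bornology and a coarse structure such that
thickenings of bounded sets by entourages are bounded, the group acts by automorphisms, and the
`G`-invariant entourages are cofinal. The thickening `U[B] = {x | ∃ b ∈ B, (x, b) ∈ U}` is
`U.preimage B`. -/
structure GBornCoarse (G : Type v) [Group G] where
  carrier : Type v'
  [mulAction : MulAction G carrier]
  [bornology : Bornology carrier]
  coarse : CoarseStructure carrier
  isBounded_thickening : ∀ {U : SetRel carrier carrier} {B : Set carrier}, coarse.IsEntourage U →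
    Bornology.IsBounded B → Bornology.IsBounded (U.preimage B)
  isBounded_smul : ∀ (g : G) {B : Set carrier}, Bornology.IsBounded B → Bornology.IsBounded (g • B)
  isEntourage_smul : ∀ (g : G) {U : SetRel carrier carrier}, coarse.IsEntourage U →
    coarse.IsEntourage (g • U)
  exists_invariant : ∀ {U : SetRel carrier carrier}, coarse.IsEntourage U →
    ∃ V : SetRel carrier carrier, coarse.IsEntourage V ∧ U ⊆ V ∧ ∀ g : G, g • V = V

namespace GBornCoarse
attribute [instance] GBornCoarse.mulAction GBornCoarse.bornology

open scoped Pointwise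
variable (G : Type v) [Group G]

/-- The orbit `G (B × B)`. -/
def orbitEntourage (B : Set G) : SetRel G G := ⋃ g : G, g • (B ×ˢ B)

/-- The canonical coarse structure on a group, generated by the orbits `G (B × B)` of finite sets `B`. -/
def canCoarse : CoarseStructure G :=
  .generate {U | ∃ B : Set G, B.Finite ∧ U = orbitEntourage G B}

variable {G}
theorem mem_smul_prod {X : Type*} [MulAction G X] {g : G} {U : Set (X × X)} {x y : X} :
    (x, y) ∈ g • U ↔ (g⁻¹ • x, g⁻¹ • y) ∈ U := by
  rw [Set.mem_smul_set_iff_inv_smul_mem]; rfl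

theorem can_invariant {U : SetRel G G} (hU : (canCoarse G).IsEntourage U) :
    ∃ V : SetRel G G, (canCoarse G).IsEntourage V ∧ U ⊆ V ∧ ∀ g : G, g • V = V := by
  have inv_of : ∀ V : SetRel G G, (∀ (g : G) (x y : G), (x, y) ∈ V → (g • x, g • y) ∈ V) →
      ∀ g : G, g • V = V := by
    intro V hV g
    ext ⟨x, y⟩
    rw [mem_smul_prod]
    refine ⟨fun h => ?_, fun h => hV _ _ _ h⟩
    simpa using hV g _ _ h
  have of_inv : ∀ V : SetRel G G, (∀ g : G, g • V = V) →
      (∀ (g : G) (x y : G), (x, y) ∈ V → (g • x, g • y) ∈ V) := by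
    intro V hV g x y h
    rw [← hV g, mem_smul_prod]
    simpa using h
  induction hU with
  | basic h =>
    obtain ⟨B, hB, rfl⟩ := h
    refine ⟨_, .basic ⟨B, hB, rfl⟩, subset_rfl, inv_of _ fun g x y h => ?_⟩
    simp only [orbitEntourage, Set.mem_iUnion, mem_smul_prod] at h ⊢
    obtain ⟨g', h⟩ := h
    exact ⟨g * g', by simpa [mul_assoc] using h⟩
  | diag => exact ⟨_, .diag, subset_rfl, inv_of _ fun g x y h => congrArg (g • ·) h⟩
  | subset h _ ih =>
    obtain ⟨V, h1, h2, h3⟩ := ih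
    exact ⟨V, h1, h.trans h2, h3⟩
  | union _ _ ih1 ih2 =>
    obtain ⟨V, h1, h2, h3⟩ := ih1
    obtain ⟨V', h1', h2', h3'⟩ := ih2
    exact ⟨V ∪ V', .union h1 h1', Set.union_subset_union h2 h2', fun g => by
      rw [Set.smul_set_union, h3, h3']⟩
  | inv _ ih =>
    obtain ⟨V, h1, h2, h3⟩ := ih
    exact ⟨V.inv, .inv h1, fun _ h => h2 h, inv_of _ fun g x y h => of_inv V h3 g y x h⟩
  | comp _ _ ih1 ih2 =>
    obtain ⟨V, h1, h2, h3⟩ := ih1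
    obtain ⟨V', h1', h2', h3'⟩ := ih2
    refine ⟨V.comp V', .comp h1 h1', ?_, inv_of _ ?_⟩
    · rintro ⟨x, y⟩ ⟨z, h, h'⟩
      exact ⟨z, h2 h, h2' h'⟩
    · rintro g x y ⟨z, h, h'⟩
      exact ⟨g • z, of_inv V h3 g _ _ h, of_inv V' h3' g _ _ h'⟩

theorem can_finite {U : SetRel G G} (hU : (canCoarse G).IsEntourage U) :
    ∀ B : Set G, B.Finite → (U.preimage B).Finite ∧ (U.inv.preimage B).Finite := by
  induction hU with
  | basic h =>
    obtain ⟨B₀, hB₀, rfl⟩ := h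
    intro B hB
    have key : ∀ x b : G, (∃ g : G, g⁻¹ • x ∈ B₀ ∧ g⁻¹ • b ∈ B₀) → b ∈ B → x ∈ B * B₀⁻¹ * B₀ := by
      rintro x b ⟨g, hx, hb⟩ h
      refine ⟨b * (g⁻¹ • b)⁻¹, ⟨b, h, (g⁻¹ • b)⁻¹, by simpa using hb, rfl⟩, g⁻¹ • x, hx, ?_⟩
      simp [mul_assoc]
    have fin : (B * B₀⁻¹ * B₀).Finite := (hB.mul hB₀.inv).mul hB₀
    constructor
    · refine fin.subset ?_
      rintro x ⟨b, hb, h⟩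
      simp only [orbitEntourage, Set.mem_iUnion, mem_smul_prod] at h
      obtain ⟨g, h⟩ := h
      exact key x b ⟨g, h.1, h.2⟩ hb
    · refine fin.subset ?_
      rintro x ⟨b, hb, h⟩
      simp only [orbitEntourage, SetRel.mem_inv, Set.mem_iUnion, mem_smul_prod] at h
      obtain ⟨g, h⟩ := h
      exact key x b ⟨g, h.2, h.1⟩ hb
  | diag =>
    intro B hB
    constructor <;> refine hB.subset ?_
    · rintro x ⟨b, hb, h⟩; obtain rfl : x = b := h; exact hb
    · rintro x ⟨b, hb, h⟩; obtain rfl : b = x := h; exact hb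
  | subset h _ ih =>
    intro B hB
    refine ⟨(ih B hB).1.subset ?_, (ih B hB).2.subset ?_⟩
    · rintro x ⟨b, hb, h'⟩; exact ⟨b, hb, h h'⟩
    · rintro x ⟨b, hb, h'⟩; exact ⟨b, hb, h h'⟩
  | union _ _ ih1 ih2 =>
    intro B hB
    refine ⟨((ih1 B hB).1.union (ih2 B hB).1).subset ?_,
      ((ih1 B hB).2.union (ih2 B hB).2).subset ?_⟩
    · rintro x ⟨b, hb, h | h⟩
      · exact Or.inl ⟨b, hb, h⟩
      · exact Or.inr ⟨b, hb, h⟩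
    · rintro x ⟨b, hb, h | h⟩
      · exact Or.inl ⟨b, hb, h⟩
      · exact Or.inr ⟨b, hb, h⟩
  | inv _ ih => exact fun B hB => ⟨(ih B hB).2, (ih B hB).1⟩
  | comp _ _ ih1 ih2 =>
    intro B hB
    refine ⟨(ih1 _ (ih2 B hB).1).1.subset ?_, (ih2 _ (ih1 B hB).2).2.subset ?_⟩
    · rintro x ⟨b, hb, z, h, h'⟩
      exact ⟨z, ⟨b, hb, h'⟩, h⟩
    · rintro x ⟨b, hb, z, h, h'⟩
      exact ⟨z, ⟨b, hb, h⟩, h'⟩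

theorem isBounded_cofinite_iff {X : Type*} {s : Set X} :
    @Bornology.IsBounded X Bornology.cofinite s ↔ s.Finite := by
  change sᶜ ∈ Filter.cofinite ↔ _
  rw [Filter.mem_cofinite, compl_compl]

variable (G) in
/-- The group `G`, acting on itself by left multiplication, with the canonical coarse structure and
the minimal bornology (the bounded sets are the finite ones). -/
def canMin : GBornCoarse G :=
  letI : Bornology G := Bornology.cofinite
  { carrier := G
    coarse := canCoarse G
    isBounded_thickening := fun hU hB => by
      rw [isBounded_cofinite_iff] at hB ⊢
      exact (can_finite hU _ hB).1
    isBounded_smul := fun g B hB => by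
      rw [isBounded_cofinite_iff] at hB ⊢
      exact hB.smul_set
    isEntourage_smul := fun g U hU => by
      obtain ⟨V, h1, h2, h3⟩ := can_invariant hU
      refine .subset ?_ h1
      rw [← h3 g]
      exact Set.smul_set_mono h2
    exists_invariant := can_invariant }
end GBornCoarse


namespace GBornCoarse
open scoped Pointwise
variable {G : Type v} [Group G] (X : GBornCoarse.{v, v'} G)

/-- The poset of bounded sets of `X`. -/
abbrev BoundedSet : Type v' := {B : Set X.carrier // Bornology.IsBounded B}

/-- The functor `B ↦ g⁻¹ B`. For a functor `M` on bounded sets, `translate g ⋙ M` is the translate `gM`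
(the group acts trivially on the values of `M`). -/
def translate (g : G) : X.BoundedSet ⥤ X.BoundedSet :=
  Monotone.functor (f := fun B => ⟨g⁻¹ • B.1, X.isBounded_smul g⁻¹ B.2⟩)
    fun _ _ h => Set.smul_set_mono h

/-- The poset of `G`-invariant entourages of `X`. -/
def InvariantEntourage : Type v' :=
  {U : SetRel X.carrier X.carrier // X.coarse.IsEntourage U ∧ ∀ g : G, g • U = U}

variable {X}

namespace InvariantEntourage

instance : PartialOrder X.InvariantEntourage :=
  inferInstanceAs (PartialOrder {U : SetRel X.carrier X.carrier // _})

theorem smul_mem (U : X.InvariantEntourage) (g : G) {x y : X.carrier} :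
    (g • x, g • y) ∈ U.1 ↔ (x, y) ∈ U.1 := by
  conv_lhs => rw [← U.2.2 g]
  rw [mem_smul_prod]
  simp

theorem smul_eq_of (U : SetRel X.carrier X.carrier)
    (h : ∀ (g : G) (x y : X.carrier), (g • x, g • y) ∈ U ↔ (x, y) ∈ U) (g : G) : g • U = U := by
  ext ⟨x, y⟩
  rw [mem_smul_prod, h]

/-- The diagonal entourage. -/
def diag (X : GBornCoarse.{v, v'} G) : X.InvariantEntourage :=
  ⟨SetRel.id, X.coarse.diag, smul_eq_of _ fun g x y => by simp [SetRel.id]⟩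

/-- The composite of two invariant entourages. -/
def comp (U V : X.InvariantEntourage) : X.InvariantEntourage :=
  ⟨SetRel.comp U.1 V.1, X.coarse.comp U.2.1 V.2.1, smul_eq_of _ fun g x y => by
    constructor
    · rintro ⟨z, h, h'⟩
      exact ⟨g⁻¹ • z, (U.smul_mem g).1 (by simpa using h), (V.smul_mem g).1 (by simpa using h')⟩
    · rintro ⟨z, h, h'⟩
      exact ⟨g • z, (U.smul_mem g).2 h, (V.smul_mem g).2 h'⟩⟩

theorem comp_mono {U U' V V' : X.InvariantEntourage} (h : U ≤ U') (h' : V ≤ V') :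
    U.comp V ≤ U'.comp V' := fun _ ⟨z, a, b⟩ => ⟨z, h a, h' b⟩

theorem le_comp_diag (U : X.InvariantEntourage) : U ≤ U.comp (diag X) :=
  fun ⟨_, y⟩ h => ⟨y, h, rfl⟩

theorem le_diag_comp (U : X.InvariantEntourage) : U ≤ (diag X).comp U :=
  fun ⟨x, _⟩ h => ⟨x, rfl, h⟩

theorem comp_comp_le (U V W : X.InvariantEntourage) :
    U.comp (V.comp W) ≤ (U.comp V).comp W :=
  fun ⟨_, _⟩ ⟨a, h1, b, h2, h3⟩ => ⟨b, ⟨a, h1, h2⟩, h3⟩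

instance : Nonempty X.InvariantEntourage := ⟨diag X⟩

instance : IsDirectedOrder X.InvariantEntourage where
  directed U V := ⟨⟨U.1 ∪ V.1, X.coarse.union U.2.1 V.2.1, fun g => by
    rw [Set.smul_set_union, U.2.2, V.2.2]⟩, fun _ h => Or.inl h, fun _ h => Or.inr h⟩

/-- The thickening functor `B ↦ U[B]`. -/
def thicken (U : X.InvariantEntourage) : X.BoundedSet ⥤ X.BoundedSet :=
  Monotone.functor (f := fun B => ⟨U.1.preimage B.1, X.isBounded_thickening U.2.1 B.2⟩)
    fun _ _ h => SetRel.preimage_mono h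

theorem thicken_mono {U U' : X.InvariantEntourage} (h : U ≤ U') (B : X.BoundedSet) :
    U.thicken.obj B ≤ U'.thicken.obj B := fun _ ⟨b, hb, hx⟩ => ⟨b, hb, h hx⟩

theorem thicken_translate_le (U : X.InvariantEntourage) (g : G) (B : X.BoundedSet) :
    U.thicken.obj ((X.translate g).obj B) ≤ (X.translate g).obj (U.thicken.obj B) := by
  rintro x ⟨b, hb, hx⟩
  obtain ⟨b, hb, rfl⟩ := hb
  refine Set.mem_smul_set_iff_inv_smul_mem.2 ⟨b, hb, ?_⟩
  rw [← U.smul_mem g⁻¹]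
  simpa using hx

theorem le_thicken_diag (B : X.BoundedSet) : B ≤ (diag X).thicken.obj B :=
  fun x hx => ⟨x, hx, rfl⟩

theorem thicken_thicken_le (U V : X.InvariantEntourage) (B : X.BoundedSet) :
    V.thicken.obj (U.thicken.obj B) ≤ (V.comp U).thicken.obj B :=
  fun _ ⟨y, ⟨b, hb, hy⟩, hx⟩ => ⟨b, hb, y, hx, hy⟩

end InvariantEntourage

theorem translate_mul_le (g h : G) (B : X.BoundedSet) :
    (X.translate (g * h)).obj B ≤ (X.translate h).obj ((X.translate g).obj B) := by
  change (g * h)⁻¹ • B.1 ⊆ h⁻¹ • g⁻¹ • B.1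
  rw [mul_inv_rev, mul_smul]

end GBornCoarse

/-- A `G`-equivariant `X`-controlled finite-dimensional `k`-vector space `(M, ρ)`. The comparison map in
`ρ_mul` is the identification `(g h)⁻¹ B = h⁻¹ (g⁻¹ B)`. -/
structure ControlledObject (k : Type u) [Field k] {G : Type v} [Group G]
    (X : GBornCoarse.{v, v'} G) where
  M : X.BoundedSet ⥤ FGModuleCat.{u} k
  ρ : ∀ g : G, M ≅ X.translate g ⋙ M
  isZero_empty : Limits.IsZero (M.obj ⟨∅, Bornology.isBounded_empty⟩)
  isPushout : ∀ B B' : X.BoundedSet,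
    IsPushout
      (M.map (homOfLE (x := (⟨B.1 ∩ B'.1, B.2.subset Set.inter_subset_left⟩ : X.BoundedSet))
        (y := B) Set.inter_subset_left))
      (M.map (homOfLE (x := (⟨B.1 ∩ B'.1, B.2.subset Set.inter_subset_left⟩ : X.BoundedSet))
        (y := B') Set.inter_subset_right))
      (M.map (homOfLE (x := B) (y := (⟨B.1 ∪ B'.1, B.2.union B'.2⟩ : X.BoundedSet))
        Set.subset_union_left))
      (M.map (homOfLE (x := B') (y := (⟨B.1 ∪ B'.1, B.2.union B'.2⟩ : X.BoundedSet))
        Set.subset_union_right))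
  exists_finite : ∀ B : X.BoundedSet, ∃ (F : X.BoundedSet) (h : F ≤ B),
    F.1.Finite ∧ IsIso (M.map (homOfLE h))
  ρ_mul : ∀ (g h : G) (B : X.BoundedSet),
    (ρ (g * h)).hom.app B ≫ M.map (homOfLE (GBornCoarse.translate_mul_le g h B)) =
      (ρ g).hom.app B ≫ (ρ h).hom.app ((X.translate g).obj B)

namespace ControlledObject
variable {k : Type u} [Field k] {G : Type v} [Group G] {X : GBornCoarse.{v, v'} G}
open GBornCoarse

/-- The `G`-equivariant `U`-controlled morphisms: the natural transformations `φ : P ⟶ Q ∘ U[-]` with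
`ρ(g) ∘ φ = (g φ) ∘ ρ(g)`, where `U[g⁻¹ B] = g⁻¹ U[B]`. -/
def Mor (U : X.InvariantEntourage) (P Q : ControlledObject k X) :
    Submodule k (P.M ⟶ U.thicken ⋙ Q.M) where
  carrier := {φ | ∀ (g : G) (B : X.BoundedSet),
    φ.app B ≫ (Q.ρ g).hom.app (U.thicken.obj B) =
      (P.ρ g).hom.app B ≫ φ.app ((X.translate g).obj B) ≫
        Q.M.map (homOfLE (U.thicken_translate_le g B))}
  add_mem' {φ ψ} hφ hψ g B := by
    simp only [NatTrans.app_add, Preadditive.add_comp, Preadditive.comp_add, hφ g B, hψ g B]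
  zero_mem' g B := by simp
  smul_mem' a φ hφ g B := by
    simp only [NatTrans.app_smul, Linear.smul_comp, Linear.comp_smul, hφ g B]

theorem Mor.ext {U : X.InvariantEntourage} {P Q : ControlledObject k X} {φ ψ : Mor U P Q}
    (h : ∀ B, φ.1.app B = ψ.1.app B) : φ = ψ :=
  Subtype.ext (NatTrans.ext (funext h))

theorem map_comp_map (P : ControlledObject k X) {B₁ B₂ B₃ : X.BoundedSet} (h : B₁ ≤ B₂)
    (h' : B₂ ≤ B₃) {Z : FGModuleCat.{u} k} (f : P.M.obj B₃ ⟶ Z) :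
    P.M.map (homOfLE h) ≫ P.M.map (homOfLE h') ≫ f = P.M.map (homOfLE (h.trans h')) ≫ f := by
  rw [← Category.assoc, ← Functor.map_comp]; rfl

theorem map_comp_map' (P : ControlledObject k X) {B₁ B₂ B₃ : X.BoundedSet} (h : B₁ ≤ B₂)
    (h' : B₂ ≤ B₃) :
    P.M.map (homOfLE h) ≫ P.M.map (homOfLE h') = P.M.map (homOfLE (h.trans h')) := by
  rw [← Functor.map_comp]; rfl

theorem map_rho (P : ControlledObject k X) {B₁ B₂ : X.BoundedSet} (h : B₁ ≤ B₂) (g : G) :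
    P.M.map (homOfLE h) ≫ (P.ρ g).hom.app B₂ =
      (P.ρ g).hom.app B₁ ≫ P.M.map (homOfLE ((X.translate g).map (homOfLE h)).le) :=
  (P.ρ g).hom.naturality (homOfLE h)

theorem map_app {U : X.InvariantEntourage} {P Q : ControlledObject k X} (φ : Mor U P Q)
    {B₁ B₂ : X.BoundedSet} (h : B₁ ≤ B₂) :
    P.M.map (homOfLE h) ≫ φ.1.app B₂ =
      φ.1.app B₁ ≫ Q.M.map (homOfLE (U.thicken.map (homOfLE h)).le) :=
  φ.1.naturality (homOfLE h)

theorem map_app_assoc {U : X.InvariantEntourage} {P Q : ControlledObject k X} (φ : Mor U P Q)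
    {B₁ B₂ : X.BoundedSet} (h : B₁ ≤ B₂) {Z : FGModuleCat.{u} k}
    (f : Q.M.obj (U.thicken.obj B₂) ⟶ Z) :
    P.M.map (homOfLE h) ≫ φ.1.app B₂ ≫ f =
      φ.1.app B₁ ≫ Q.M.map (homOfLE (U.thicken.map (homOfLE h)).le) ≫ f := by
  rw [← Category.assoc, map_app, Category.assoc]

/-- Regard a `U`-controlled morphism as a `V`-controlled one, for `U ⊆ V`. -/
def enlarge (P Q : ControlledObject k X) (U V : X.InvariantEntourage) (h : U ≤ V) :
    Mor U P Q →ₗ[k] Mor V P Q where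
  toFun φ :=
    ⟨{ app := fun B => φ.1.app B ≫ Q.M.map (homOfLE (InvariantEntourage.thicken_mono h B))
       naturality := fun B₁ B₂ f => by
        change P.M.map (homOfLE f.le) ≫ _ =
          _ ≫ Q.M.map (homOfLE (V.thicken.map (homOfLE f.le)).le)
        rw [map_app_assoc, map_comp_map', Category.assoc, map_comp_map'] },
      fun g B => by
        simp only [Category.assoc]
        rw [map_rho, map_comp_map', ← Category.assoc, φ.2 g B]
        simp only [Category.assoc]
        rw [map_comp_map'] ⟩
  map_add' φ ψ := Mor.ext fun B => by
    simp [Preadditive.add_comp]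
  map_smul' a φ := Mor.ext fun B => by
    simp [Linear.smul_comp]

/-- Composition of a `U`-controlled morphism with a `V`-controlled one. -/
def compMor (P Q R : ControlledObject k X) (U V : X.InvariantEntourage) :
    Mor V Q R →ₗ[k] Mor U P Q →ₗ[k] Mor (V.comp U) P R :=
  LinearMap.mk₂ k
    (fun ψ φ =>
      ⟨{ app := fun B => φ.1.app B ≫ ψ.1.app (U.thicken.obj B) ≫
          R.M.map (homOfLE (InvariantEntourage.thicken_thicken_le U V B))
         naturality := fun B₁ B₂ f => by
          change P.M.map (homOfLE f.le) ≫ _ =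
            _ ≫ R.M.map (homOfLE ((V.comp U).thicken.map (homOfLE f.le)).le)
          rw [map_app_assoc, map_app_assoc, map_comp_map']
          simp only [Category.assoc]
          rw [map_comp_map'] },
        fun g B => by
          simp only [Category.assoc]
          rw [map_rho, ← Category.assoc (ψ.1.app _), ψ.2 g (U.thicken.obj B)]
          simp only [Category.assoc]
          rw [map_comp_map', ← Category.assoc (φ.1.app B), φ.2 g B]
          simp only [Category.assoc]
          rw [map_app_assoc, map_comp_map', map_comp_map'] ⟩)
    (fun _ _ _ => Mor.ext fun B => by simp [Preadditive.add_comp, Preadditive.comp_add])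
    (fun _ _ _ => Mor.ext fun B => by simp [Linear.smul_comp, Linear.comp_smul])
    (fun _ _ _ => Mor.ext fun B => by simp [Preadditive.add_comp, Preadditive.comp_add])
    (fun _ _ _ => Mor.ext fun B => by simp [Linear.smul_comp, Linear.comp_smul])

theorem enlarge_app {P Q : ControlledObject k X} {U V : X.InvariantEntourage} (h : U ≤ V)
    (φ : Mor U P Q) (B : X.BoundedSet) : (enlarge P Q U V h φ).1.app B =
      φ.1.app B ≫ Q.M.map (homOfLE (InvariantEntourage.thicken_mono h B)) := rfl

theorem compMor_app {P Q R : ControlledObject k X} {U V : X.InvariantEntourage}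
    (φ : Mor U P Q) (ψ : Mor V Q R) (B : X.BoundedSet) : (compMor P Q R U V ψ φ).1.app B =
      φ.1.app B ≫ ψ.1.app (U.thicken.obj B) ≫
        R.M.map (homOfLE (InvariantEntourage.thicken_thicken_le U V B)) := rfl

/-- The identity, as a morphism controlled by the diagonal. -/
def idMor (P : ControlledObject k X) : Mor (InvariantEntourage.diag X) P P :=
  ⟨{ app := fun B => P.M.map (homOfLE (InvariantEntourage.le_thicken_diag B))
     naturality := fun B₁ B₂ f => by
      change P.M.map (homOfLE f.le) ≫ _ =
        _ ≫ P.M.map (homOfLE ((InvariantEntourage.diag X).thicken.map (homOfLE f.le)).le)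
      rw [map_comp_map', map_comp_map'] },
    fun g B => by
      rw [map_rho, map_comp_map']⟩

theorem idMor_app (P : ControlledObject k X) (B : X.BoundedSet) :
    (idMor P).1.app B = P.M.map (homOfLE (InvariantEntourage.le_thicken_diag B)) := rfl

open Classical in
/-- Controlled morphisms: the colimit of the `U`-controlled ones over all invariant entourages. -/
abbrev Hom (P Q : ControlledObject k X) : Type (max u v') :=
  Module.DirectLimit (fun U : X.InvariantEntourage => Mor U P Q) (enlarge P Q)

open Classical in
/-- The controlled morphism given by a `U`-controlled one. -/
noncomputable def toHom {P Q : ControlledObject k X} (U : X.InvariantEntourage) : Mor U P Q →ₗ[k] Hom P Q :=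
  Module.DirectLimit.of k X.InvariantEntourage (fun U => Mor U P Q) (enlarge P Q) U

theorem toHom_enlarge {P Q : ControlledObject k X} {U V : X.InvariantEntourage} (h : U ≤ V)
    (φ : Mor U P Q) : toHom V (enlarge P Q U V h φ) = toHom U φ := by
  classical exact Module.DirectLimit.of_f

theorem exists_toHom {P Q : ControlledObject k X} (f : Hom P Q) : ∃ U φ, toHom U φ = f := by
  classical exact Module.DirectLimit.exists_of f

theorem toHom_eq {P Q : ControlledObject k X} {U V : X.InvariantEntourage} (h : U ≤ V)
    (φ : Mor U P Q) (ψ : Mor V P Q) (e : ∀ B, φ.1.app B ≫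
      Q.M.map (homOfLE (InvariantEntourage.thicken_mono h B)) = ψ.1.app B) :
    toHom U φ = toHom V ψ := by
  rw [← toHom_enlarge h]; congr 1; exact Mor.ext e

open Classical in
/-- Composition of controlled morphisms. -/
noncomputable def compHom (P Q R : ControlledObject k X) :
    Hom P Q →ₗ[k] Hom Q R →ₗ[k] Hom P R :=
  Module.DirectLimit.lift _ _ _ _
    (fun U => LinearMap.flip (Module.DirectLimit.lift _ _ _ _
      (fun V => (compMor P Q R U V).compr₂ (toHom (V.comp U)))
      (fun V V' h ψ => LinearMap.ext fun φ => by
        symm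
        refine toHom_eq (InvariantEntourage.comp_mono h le_rfl) _ _ fun B => ?_
        simp only [compMor_app, enlarge_app, Category.assoc]
        rw [map_comp_map', map_comp_map'])))
    (fun U U' h φ => Module.DirectLimit.hom_ext fun V => LinearMap.ext fun ψ => by
      simp only [LinearMap.comp_apply, LinearMap.flip_apply, Module.DirectLimit.lift_of]
      symm
      refine toHom_eq (InvariantEntourage.comp_mono le_rfl h) _ _ fun B => ?_
      simp only [compMor_app, enlarge_app, Category.assoc]
      rw [map_app_assoc, map_comp_map', map_comp_map'])

theorem compHom_toHom {P Q R : ControlledObject k X} {U V : X.InvariantEntourage}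
    (φ : Mor U P Q) (ψ : Mor V Q R) :
    compHom P Q R (toHom U φ) (toHom V ψ) = toHom (V.comp U) (compMor P Q R U V ψ φ) := by
  classical
  simp only [compHom, toHom, Module.DirectLimit.lift_of, LinearMap.flip_apply,
    LinearMap.compr₂_apply]

/-- The category of `G`-equivariant `X`-controlled finite-dimensional `k`-vector spaces. -/
noncomputable instance : Category.{max u v'} (ControlledObject k X) where
  Hom := Hom
  id P := toHom _ (idMor P)
  comp f g := compHom _ _ _ f g
  id_comp {P Q} f := by
    obtain ⟨U, φ, rfl⟩ := exists_toHom f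
    rw [compHom_toHom]
    symm
    refine toHom_eq (U.le_comp_diag) _ _ fun B => ?_
    rw [compMor_app, idMor_app, map_app_assoc, map_comp_map']
  comp_id {P Q} f := by
    obtain ⟨U, φ, rfl⟩ := exists_toHom f
    rw [compHom_toHom]
    symm
    refine toHom_eq (U.le_diag_comp) _ _ fun B => ?_
    rw [compMor_app, idMor_app, map_comp_map']
  assoc {P Q R S} f g h := by
    obtain ⟨U, φ, rfl⟩ := exists_toHom f
    obtain ⟨V, ψ, rfl⟩ := exists_toHom g
    obtain ⟨W, χ, rfl⟩ := exists_toHom h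
    rw [compHom_toHom, compHom_toHom, compHom_toHom, compHom_toHom]
    refine toHom_eq (InvariantEntourage.comp_comp_le W V U) _ _ fun B => ?_
    simp only [compMor_app, Category.assoc]
    rw [map_app_assoc, map_comp_map', map_comp_map', map_comp_map']

noncomputable instance : Preadditive (ControlledObject k X) where
  homGroup P Q := inferInstanceAs (AddCommGroup (Hom P Q))
  add_comp P Q R f f' g := (compHom P Q R).map_add₂ f f' g
  comp_add P Q R f g g' := (compHom P Q R f).map_add g g'

noncomputable instance : Linear k (ControlledObject k X) where
  homModule P Q := inferInstanceAs (Module k (Hom P Q))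
  smul_comp P Q R a f g := (compHom P Q R).map_smul₂ a f g
  comp_smul P Q R f a g := (compHom P Q R f).map_smul a g

end ControlledObject


section Homologies

/-- The category of chain complexes of `k`-modules, indexed by `ℤ`, localized at the
quasi-isomorphisms (the homotopy category of the corresponding `∞`-categorical localization, in
which two chain complexes are equivalent if and only if they are isomorphic here). -/
abbrev LocalizedComplexes (k : Type u) [CommRing k] :=
  (HomologicalComplex.quasiIso (ModuleCat.{w} k) (ComplexShape.down ℤ)).Localization

/-- The localization functor. -/
abbrev localizeComplex (k : Type u) [CommRing k] :
    ChainComplex (ModuleCat.{w} k) ℤ ⥤ LocalizedComplexes.{w} k :=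
  (HomologicalComplex.quasiIso (ModuleCat.{w} k) (ComplexShape.down ℤ)).Q

namespace MixedComplex
variable {k : Type u} [CommRing k]

/-- The underlying chain complex `(C, b)` of a mixed complex, up to quasi-isomorphism. It computes
Hochschild homology. -/
def hochschild (C : MixedComplex.{w} k) : LocalizedComplexes.{w} k :=
  (localizeComplex k).obj C.toHomologicalComplex

/-- The total complex of a mixed complex, up to quasi-isomorphism. It computes cyclic homology. -/
noncomputable def cyclic (C : MixedComplex.{w} k) : LocalizedComplexes.{w} k :=
  (localizeComplex k).obj C.tot

end MixedComplex

/-- The mixed complex of a small `k`-linear category. -/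
noncomputable def mixOfCategory (k : Type u) [CommRing k] (C : Type w) [Category.{v} C]
    [Preadditive C] [Linear k C] : MixedComplex.{max u w v} k :=
  (addCyclicNerve k C).toMixedComplex

/-- The mixed complex of a `k`-algebra. -/
noncomputable def mixOfAlgebra (k : Type u) [CommRing k] (A : Type w) [Ring A] [Algebra k A] :
    MixedComplex.{max u w} k :=
  (algCyclicModule k A).toMixedComplex

/-- Equivariant coarse Hochschild homology of a `G`-bornological coarse space `X`. -/
noncomputable def coarseHochschild (k : Type u) [Field k] {G : Type v} [Group G]
    (X : GBornCoarse.{v, v'} G) : LocalizedComplexes.{max (u + 1) v v'} k :=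
  (mixOfCategory k (ControlledObject k X)).hochschild

/-- Equivariant coarse cyclic homology of a `G`-bornological coarse space `X`. -/
noncomputable def coarseCyclic (k : Type u) [Field k] {G : Type v} [Group G]
    (X : GBornCoarse.{v, v'} G) : LocalizedComplexes.{max (u + 1) v v'} k :=
  (mixOfCategory k (ControlledObject k X)).cyclic

/-- The canonical inclusion of chain complexes into a larger universe. -/
noncomputable abbrev uliftComplex (k : Type u) [CommRing k] :
    ChainComplex (ModuleCat.{w} k) ℤ ⥤ ChainComplex (ModuleCat.{max w v} k) ℤ :=
  (ModuleCat.uliftFunctor.{v, w} k).mapHomologicalComplex (ComplexShape.down ℤ)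

/-- The Hochschild complex of a `k`-algebra `A`, regarded as a complex in a possibly larger
universe, up to quasi-isomorphism. -/
noncomputable def algebraHochschild (k : Type u) [CommRing k] (A : Type w) [Ring A] [Algebra k A] :
    LocalizedComplexes.{max u w v} k :=
  (localizeComplex k).obj ((uliftComplex.{max u w, u, v} k).obj
    (mixOfAlgebra k A).toHomologicalComplex)

/-- The cyclic complex of a `k`-algebra `A`, regarded as a complex in a possibly larger
universe, up to quasi-isomorphism. -/
noncomputable def algebraCyclic (k : Type u) [CommRing k] (A : Type w) [Ring A] [Algebra k A] :
    LocalizedComplexes.{max u w v} k :=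
  (localizeComplex k).obj ((uliftComplex.{max u w, u, v} k).obj (mixOfAlgebra k A).tot)

end Homologies

-- The theorem is Morita invariance of Hochschild and cyclic homology, realised by an explicit chain
-- homotopy. Let E be the object `base k G`, whose value E(B) is the space of functions on G
-- supported on B.
--
-- By equivariance an endomorphism of E is determined by the image of the indicator function of 1,
-- which is a finitely supported function on G (`evHom_injective`), and the right translations
-- realise all of these; hence End(E) is k[G] (`endAlgEquiv`). For an arbitrary object (M, ρ) the
-- push-out axiom makes M(B) the direct sum of the M({x}) with x in B (`hom_ext`, `map_desc`), and ρ
-- identifies every M({x}) with M({1}). A basis of M({1}) therefore gives finitely many morphisms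
-- p_l : M → E and e_l : E → M with ∑ e_l p_l = id (`exists_generation`).
--
-- The words in endomorphisms of E form an injective image of Z(k[G]) in the cyclic nerve. To see
-- that this inclusion is a quasi-isomorphism, let S_i insert after f_i the identity of C_{i+1},
-- factored as ∑ e_l p_l, so that the object number i + 1 becomes E. The S_i behave like
-- degeneracies, except that τ_i = d_{i+1} S_i is not the identity but puts E in the place of the
-- object number i + 1. As a result H = ∑ (-1)^i S_i τ_{i-1} ⋯ τ_0 satisfies bH + Hb = 1 - Θ with Θ
-- = τ_n ⋯ τ_0 in degree n (`Splitting.b_H`). The operator Θ takes its values in the words on E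
-- (`Θ_mem`) and fixes them, because E is presented trivially over itself (`Θ_gen_self`). So Θ is a
-- retraction onto Z(k[G]) that is homotopic to the identity.
--
-- For cyclic homology, the inclusion commutes with B as well, and a morphism of mixed complexes
-- whose cone is acyclic for b has an acyclic cone on total complexes: the top components of a cycle
-- can be removed one at a time (`MixedComplex.Hom.isAcyclic_tot`).
--
-- The nerve and the tensor powers of k[G] live in different universes. Acyclicity of the cone is
-- therefore formulated with elements, and becomes a quasi-isomorphism once the smaller complex has
-- been lifted.

universe w'

/-! ### Quasi-isomorphisms between complexes in different universes -/

namespace LinearChain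
variable {k : Type u} [CommRing k]

/-- A family of linear maps, between complexes in possibly different universes, that commutes with the
differentials. -/
structure Hom (K : ChainComplex (ModuleCat.{w} k) ℤ) (L : ChainComplex (ModuleCat.{w'} k) ℤ) where
  f : ∀ p, K.X p →ₗ[k] L.X p
  comm : ∀ p q (x : K.X p), f q ((K.d p q).hom x) = (L.d p q).hom (f p x)

/-- Acyclicity of the mapping cone, in terms of elements. -/
def Hom.IsAcyclic {K : ChainComplex (ModuleCat.{w} k) ℤ} {L : ChainComplex (ModuleCat.{w'} k) ℤ}
    (F : Hom K L) : Prop :=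
  ∀ (m n l : ℤ), m + 1 = n → n + 1 = l → ∀ (x : K.X m) (y : L.X n),
    (∀ j, (K.d m j).hom x = 0) → (L.d n m).hom y = F.f m x →
    ∃ (x' : K.X n) (y' : L.X l), (K.d n m).hom x' = x ∧ y = F.f n x' + (L.d l n).hom y'

/-- The fibre product of A and M over N serves as A'; its projection to A is onto because the image
of f lies in that of g. This turns elementwise liftings into the refinements by epimorphisms that
the criteria for homology maps in an abelian category ask for. -/
theorem exists_refinement {A N : ModuleCat.{w} k} {M : Type w} [AddCommGroup M] [Module k M]
    (f : A ⟶ N) (g : M →ₗ[k] N) (h : ∀ a, ∃ m, g m = f.hom a) :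
    ∃ (A' : ModuleCat.{w} k) (π : A' ⟶ A) (_ : Epi π) (x : A' →ₗ[k] M),
      ∀ a, f.hom (π.hom a) = g (x a) := by
  let S : Submodule k (A × M) := LinearMap.eqLocus (f.hom ∘ₗ LinearMap.fst k A M)
    (g ∘ₗ LinearMap.snd k A M)
  refine ⟨ModuleCat.of k S, ModuleCat.ofHom (LinearMap.fst k A M ∘ₗ S.subtype), ?_,
    LinearMap.snd k A M ∘ₗ S.subtype, fun a => a.2⟩
  rw [ModuleCat.epi_iff_surjective]
  intro a
  obtain ⟨m, hm⟩ := h a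
  exact ⟨⟨(a, m), hm.symm⟩, rfl⟩

/-- Injectivity on homology is the first half of the conclusion: a cycle x whose image is the
boundary of y is itself a boundary. Surjectivity is the case x = 0: a cycle y differs by a boundary
from the image of a cycle. -/
theorem quasiIso_of_acyclic {K L : ChainComplex (ModuleCat.{w} k) ℤ} (φ : K ⟶ L)
    (h : ∀ (m n l : ℤ), m + 1 = n → n + 1 = l → ∀ (x : K.X m) (y : L.X n),
      (∀ j, (K.d m j).hom x = 0) → (L.d n m).hom y = (φ.f m).hom x →
      ∃ (x' : K.X n) (y' : L.X l), (K.d n m).hom x' = x ∧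
        y = (φ.f n).hom x' + (L.d l n).hom y') : QuasiIso φ := by
  refine ⟨fun j => ?_⟩
  rw [quasiIsoAt_iff_isIso_homologyMap]
  have hp : (ComplexShape.down ℤ).prev j = j + 1 := (ComplexShape.down ℤ).prev_eq' (by simp)
  have hn : (ComplexShape.down ℤ).next j = j - 1 := (ComplexShape.down ℤ).next_eq' (by simp)
  have : Mono (HomologicalComplex.homologyMap φ j) := by
    rw [HomologicalComplex.mono_homologyMap_iff_up_to_refinements φ _ _ _ hp hn]
    intro A x hx y hy
    obtain ⟨A', π, hπ, x', hx'⟩ := exists_refinement x (K.d (j + 1) j).hom fun a => by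
      obtain ⟨x', -, h', -⟩ := h j (j + 1) (j + 2) rfl (by ring) (x.hom a) (y.hom a)
        (fun l => by
          by_cases hl : l = j - 1
          · subst hl
            exact LinearMap.congr_fun (congrArg ModuleCat.Hom.hom hx) a
          · rw [K.shape _ _ (by simp; omega)]; rfl)
        (LinearMap.congr_fun (congrArg ModuleCat.Hom.hom hy) a).symm
      exact ⟨x', h'⟩
    exact ⟨A', π, hπ, ModuleCat.ofHom x', by ext a; exact hx' a⟩
  have : Epi (HomologicalComplex.homologyMap φ j) := by
    rw [HomologicalComplex.epi_homologyMap_iff_up_to_refinements φ _ _ _ hp hn]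
    intro A y hy
    let Z : Submodule k (K.X j) := LinearMap.ker (K.d j (j - 1)).hom
    obtain ⟨A', π, hπ, z, hz⟩ := exists_refinement y
      (((φ.f j).hom ∘ₗ Z.subtype).coprod (L.d (j + 1) j).hom) fun a => by
      -- With x = 0 the hypothesis on y says that y is a cycle, and the x' obtained is a cycle too.
      obtain ⟨x', y', h', h''⟩ := h (j - 1) j (j + 1) (by ring) rfl 0 (y.hom a)
        (fun l => map_zero _)
        ((LinearMap.congr_fun (congrArg ModuleCat.Hom.hom hy) a).trans (map_zero _).symm)
      exact ⟨(⟨x', h'⟩, y'), h''.symm⟩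
    refine ⟨A', π, hπ, ModuleCat.ofHom (Z.subtype ∘ₗ LinearMap.fst k _ _ ∘ₗ z), ?_,
      ModuleCat.ofHom (LinearMap.snd k _ _ ∘ₗ z), ?_⟩
    · ext a
      exact (z a).1.2
    · ext a
      exact hz a
  exact isIso_of_mono_of_epi _

/-- The morphism of complexes, after lifting the universe of the source. -/
noncomputable def Hom.lift {K : ChainComplex (ModuleCat.{w} k) ℤ}
    {L : ChainComplex (ModuleCat.{max w v} k) ℤ} (F : Hom K L) :
    (uliftComplex.{w, u, v} k).obj K ⟶ L where
  f p := ModuleCat.ofHom (F.f p ∘ₗ ULift.moduleEquiv.toLinearMap)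
  comm' p q _ := by
    ext x
    exact (F.comm p q x.down).symm

theorem Hom.IsAcyclic.quasiIso {K : ChainComplex (ModuleCat.{w} k) ℤ}
    {L : ChainComplex (ModuleCat.{max w v} k) ℤ} {F : Hom K L} (h : F.IsAcyclic) :
    QuasiIso F.lift := by
  refine quasiIso_of_acyclic _ fun m n l hm hl x y hx hy => ?_
  obtain ⟨x', y', h1, h2⟩ := h m n l hm hl x.down y
    (fun j => congrArg ULift.down (hx j)) hy
  exact ⟨ULift.up x', y', congrArg ULift.up h1, h2⟩

theorem Hom.IsAcyclic.nonempty_iso {K : ChainComplex (ModuleCat.{w} k) ℤ}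
    {L : ChainComplex (ModuleCat.{max w v} k) ℤ} {F : Hom K L} (h : F.IsAcyclic) :
    Nonempty ((localizeComplex k).obj L ≅
      (localizeComplex k).obj ((uliftComplex.{w, u, v} k).obj K)) := by
  have : IsIso ((localizeComplex k).map F.lift) :=
    MorphismProperty.Q_inverts _ _ ((HomologicalComplex.mem_quasiIso_iff _).2 h.quasiIso)
  exact ⟨(asIso ((localizeComplex k).map F.lift)).symm⟩

end LinearChain

/-! ### Morphisms of mixed complexes and their total complexes -/

namespace MixedComplex
variable {k : Type u} [CommRing k] (C : MixedComplex.{w} k) (D : MixedComplex.{w'} k)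

/-- The total differential is defined on summands. Read off by coordinates, the i-th one receives b
from the i-th summand and B from the next, so identities in the total complex can be checked one
coordinate at a time. -/
theorem totD_apply (n m : ℤ) (z : C.TotX n) (i : ℕ) :
    C.totD n m z i = (C.d (n - 2 * (i : ℤ)) (m - 2 * (i : ℤ))).hom (z i) +
      (C.B (n - 2 * ((i + 1 : ℕ) : ℤ)) (m - 2 * (i : ℤ))).hom (z (i + 1)) := by
  induction z using DirectSum.induction_on with
  | zero => simp
  | add x y hx hy =>
    rw [map_add, DirectSum.add_apply, hx, hy, DirectSum.add_apply, DirectSum.add_apply, map_add, map_add]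
    abel
  | of j x =>
    have h := C.totD_ι n m j x
    change C.totD n m (DirectSum.of _ j x) = _ at h
    rw [h]
    rcases j with _ | j
    · simp only [totDComponent, LinearMap.comp_apply, totι, DirectSum.lof_eq_of]
      rw [DirectSum.of_eq_of_ne (i := 0) (j := i + 1) _ (by simp)]
      rcases eq_or_ne i 0 with rfl | h
      · rw [DirectSum.of_eq_same, DirectSum.of_eq_same, map_zero, add_zero]
      · rw [DirectSum.of_eq_of_ne _ _ _ h, DirectSum.of_eq_of_ne _ _ _ h, map_zero, map_zero,
          add_zero]
    · simp only [totDComponent, LinearMap.comp_apply, LinearMap.add_apply, DirectSum.add_apply,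
        totι, DirectSum.lof_eq_of]
      congr 1
      · rcases eq_or_ne i (j + 1) with rfl | h
        · rw [DirectSum.of_eq_same, DirectSum.of_eq_same]
        · rw [DirectSum.of_eq_of_ne _ _ _ h, DirectSum.of_eq_of_ne _ _ _ h, map_zero]
      · rcases eq_or_ne i j with rfl | h
        · rw [DirectSum.of_eq_same, DirectSum.of_eq_same]
        · rw [DirectSum.of_eq_of_ne _ _ _ h, DirectSum.of_eq_of_ne _ _ _ (by simpa using h),
            map_zero]

/-- A morphism of mixed complexes in possibly different universes. -/
structure Hom extends LinearChain.Hom C.toHomologicalComplex D.toHomologicalComplex where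
  comm_B : ∀ p q (x : C.X p), f q ((C.B p q).hom x) = (D.B p q).hom (f p x)

variable {C D}

/-- The components of the induced morphism of total complexes. -/
noncomputable def Hom.totF (F : Hom C D) (n : ℤ) : C.TotX n →ₗ[k] D.TotX n :=
  DirectSum.lmap fun i : ℕ => F.f (n - 2 * (i : ℤ))

theorem Hom.totF_apply (F : Hom C D) (n : ℤ) (z : C.TotX n) (i : ℕ) :
    F.totF n z i = F.f _ (z i) := rfl

theorem Hom.totF_totD (F : Hom C D) (n m : ℤ) (z : C.TotX n) :
    F.totF m (C.totD n m z) = D.totD n m (F.totF n z) := by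
  refine DFinsupp.ext fun i => ?_
  change F.totF m (C.totD n m z) i = D.totD n m (F.totF n z) i
  rw [totF_apply, totD_apply, totD_apply, map_add, F.comm, F.comm_B]
  rfl

/-- The induced morphism of total complexes. -/
noncomputable def Hom.tot (F : Hom C D) : LinearChain.Hom C.tot D.tot where
  f := F.totF
  comm := F.totF_totD

/-- The total complex is a direct sum, not a product; this is what lets the induction in
`Hom.isAcyclic_tot` start. -/
theorem exists_forall_ge_eq_zero (n : ℤ) (z : C.TotX n) : ∃ N : ℕ, ∀ i, N ≤ i → z i = 0 := by
  classical
  obtain ⟨N, hN⟩ := (DFinsupp.support z).bddAbove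
  refine ⟨N + 1, fun i hi => ?_⟩
  by_contra h
  have := hN (Finset.mem_coe.2 (DFinsupp.mem_support_iff.2 h))
  omega

/-- The top components of a cone cycle (x, y) see only b, since B maps into a component from the one
above, which is zero. They form a cone cycle for b, hence a boundary; subtracting a total boundary
with these top components leaves a cone cycle with one component fewer, because the total
differential never raises the index. -/
theorem Hom.isAcyclic_tot {F : Hom C D} (h : F.IsAcyclic) : F.tot.IsAcyclic := by
  intro m n l hm hl (x : C.TotX m) (y : D.TotX n) hx hy
  have hx' : C.totD m (m - 1) x = 0 := hx (m - 1)
  clear hx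
  change D.totD n m y = F.totF m x at hy
  change ∃ (x' : C.TotX n) (y' : D.TotX l), C.totD n m x' = x ∧ y = F.totF n x' + D.totD l n y'
  obtain ⟨N₁, h1⟩ := exists_forall_ge_eq_zero m x
  obtain ⟨N₂, h2⟩ := exists_forall_ge_eq_zero n y
  obtain ⟨N, hN⟩ : ∃ N, ∀ i, N ≤ i → x i = 0 ∧ y i = 0 :=
    ⟨max N₁ N₂, fun i hi => ⟨h1 i (by omega), h2 i (by omega)⟩⟩
  clear h1 h2
  induction N generalizing x y with
  | zero =>
    refine ⟨0, 0, ?_, ?_⟩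
    · rw [map_zero]
      exact (DFinsupp.ext fun i => (hN i (Nat.zero_le _)).1).symm
    · rw [map_zero, map_zero, add_zero]
      exact DFinsupp.ext fun i => (hN i (Nat.zero_le _)).2
  | succ N ih =>
    -- The components number N of x and y: those number N + 1 vanish, so the coordinate N of the
    -- total differential reduces to b.
    obtain ⟨a, b, ha, hb⟩ := h (m - 2 * (N : ℤ)) (n - 2 * (N : ℤ)) (l - 2 * (N : ℤ)) (by omega)
      (by omega) (x N) (y N) (fun j => by
        by_cases hj : j = m - 1 - 2 * (N : ℤ)
        · subst hj
          have := C.totD_apply m (m - 1) x N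
          rw [(hN (N + 1) le_rfl).1, map_zero, add_zero, hx'] at this
          exact this.symm
        · rw [C.shape _ _ (by simp; omega)]; rfl) (by
          have := D.totD_apply n m y N
          rw [(hN (N + 1) le_rfl).2, map_zero, add_zero, hy] at this
          exact this.symm)
    -- The cone boundary of (a, b), placed in the summand N, is subtracted from (x, y); being a
    -- cycle is preserved as d² = 0 and F commutes with d.
    obtain ⟨x', y', h1, h2⟩ := ih (x - C.totD n m (C.totι n N a))
      (y - F.totF n (C.totι n N a) - D.totD l n (D.totι l N b))
      (by
        rw [map_sub, hx', ← LinearMap.comp_apply, C.totD_totD n m (m - 1) hm (by ring)]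
        simp)
      (by
        have e : D.totD n m (F.totF n (C.totι n N a)) = F.totF m (C.totD n m (C.totι n N a)) :=
          (F.totF_totD n m _).symm
        rw [map_sub, map_sub, map_sub, hy, e,
          ← LinearMap.comp_apply (D.totD n m) (D.totD l n), D.totD_totD l n m hl hm]
        simp)
      (by
        intro i hi
        have e1 : C.totι n N a (i + 1) = 0 := DirectSum.of_eq_of_ne _ _ _ (by omega)
        have e2 : D.totι l N b (i + 1) = 0 := DirectSum.of_eq_of_ne _ _ _ (by omega)
        have e3 : F.totF n (C.totι n N a) i = F.f _ (C.totι n N a i) := rfl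
        rw [DirectSum.sub_apply, DirectSum.sub_apply, DirectSum.sub_apply, totD_apply, totD_apply,
          e1, e2, map_zero, map_zero, add_zero, add_zero, e3]
        -- In the coordinate N the correction cancels by the choice of a and b; above N every term
        -- is zero.
        rcases hi.eq_or_lt with rfl | hi
        · have e4 : C.totι n N a N = a := DirectSum.of_eq_same _ _
          have e5 : D.totι l N b N = b := DirectSum.of_eq_same _ _
          rw [e4, e5, ha, hb]
          simp
        · have e4 : C.totι n N a i = 0 := DirectSum.of_eq_of_ne _ _ _ (by omega)
          have e5 : D.totι l N b i = 0 := DirectSum.of_eq_of_ne _ _ _ (by omega)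
          rw [e4, e5, (hN i hi).1, (hN i hi).2]
          simp)
    refine ⟨x' + C.totι n N a, y' + D.totι l N b, ?_, ?_⟩
    · rw [map_add, h1]; abel
    · rw [map_add, map_add, ← sub_eq_zero]
      rw [← sub_eq_zero] at h2
      rw [← h2]; abel

end MixedComplex

/-! ### Morphisms of cyclic modules and the induced morphisms of mixed complexes -/

namespace CyclicModule
variable {k : Type u} [CommRing k] (M : CyclicModule.{w} k) (M' : CyclicModule.{w'} k)

/-- A morphism of cyclic modules in possibly different universes. -/
structure Hom where
  f : ∀ n, M.X n →ₗ[k] M'.X n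
  comm_d : ∀ n (i : Fin (n + 2)) (x : M.X (n + 1)), f n (M.d i x) = M'.d i (f (n + 1) x)
  comm_s : ∀ n (i : Fin (n + 1)) (x : M.X n), f (n + 1) (M.s i x) = M'.s i (f n x)
  comm_t : ∀ n (x : M.X n), f n (M.t x) = M'.t (f n x)

variable {M M'} (F : Hom M M')

theorem Hom.comm_b (n : ℕ) (x : M.X (n + 1)) : F.f n (M.b n x) = M'.b n (F.f (n + 1) x) := by
  simp [b, LinearMap.sum_apply, F.comm_d]

theorem Hom.comm_B (n : ℕ) (x : M.X n) : F.f (n + 1) (M.B n x) = M'.B n (F.f n x) := by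
  have hN : F.f n (M.N n x) = M'.N n (F.f n x) := by
    simp only [N, LinearMap.sum_apply, map_sum]
    refine Finset.sum_congr rfl fun i hi => ?_
    clear hi
    induction i with
    | zero => simp
    | succ i ih => rw [pow_succ', pow_succ', Module.End.mul_apply, Module.End.mul_apply, F.comm_t, ih]
  simp only [B, LinearMap.comp_apply, extraDegeneracy, LinearMap.smul_apply, LinearMap.sub_apply,
    Module.End.one_apply, map_sub, map_smul, F.comm_t, F.comm_s, hN]

/-- The components of the induced morphism of mixed complexes. -/
noncomputable def Hom.mixF : ∀ p : ℤ, M.mixX p →ₗ[k] M'.mixX p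
  | Int.ofNat n => F.f n
  | Int.negSucc _ => 0

theorem Hom.mixF_mixb : ∀ (p : ℤ) (x : M.mixX (p + 1)),
    F.mixF p ((M.mixb p).hom x) = (M'.mixb p).hom (F.mixF (p + 1) x)
  | Int.ofNat n, x => F.comm_b n x
  | Int.negSucc _, _ => rfl

theorem Hom.mixF_mixB : ∀ (p : ℤ) (x : M.mixX p),
    F.mixF (p + 1) ((M.mixB p).hom x) = (M'.mixB p).hom (F.mixF p x)
  | Int.ofNat n, x => F.comm_B n x
  | Int.negSucc _, _ => map_zero _

theorem toMixedComplex_d (p : ℤ) : M.toMixedComplex.d (p + 1) p = M.mixb p :=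
  ChainComplex.of_d M.mixX M.mixb p

theorem toMixedComplex_B (p : ℤ) : M.toMixedComplex.B p (p + 1) = M.mixB p :=
  CochainComplex.of_d M.mixX M.mixB p

/-- The induced morphism of mixed complexes. -/
noncomputable def Hom.toMixedComplex : MixedComplex.Hom M.toMixedComplex M'.toMixedComplex where
  f := F.mixF
  comm p q x := by
    by_cases h : q + 1 = p
    · subst h
      rw [toMixedComplex_d, toMixedComplex_d]
      exact F.mixF_mixb q x
    · rw [HomologicalComplex.shape _ _ _ h, HomologicalComplex.shape _ _ _ h]
      exact map_zero _
  comm_B p q x := by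
    by_cases h : p + 1 = q
    · subst h
      rw [toMixedComplex_B, toMixedComplex_B]
      exact F.mixF_mixB p x
    · rw [MixedComplex.shape_B _ _ _ h, MixedComplex.shape_B _ _ _ h]
      exact map_zero _

/-- For a cone cycle (x, y), `inj` writes x as b x₀; then y - F x₀ is a cycle, to which `surj`
applies, and x₀ is corrected by the resulting cycle. Degree zero needs its own condition since there
every element is a cycle. -/
theorem Hom.isAcyclic_toMixedComplex
    (inj : ∀ n (x : M.X n) (y : M'.X (n + 1)), F.f n x = M'.b n y → ∃ x', x = M.b n x')
    (surj_zero : ∀ y : M'.X 0, ∃ (x' : M.X 0) (y' : M'.X 1), y = F.f 0 x' + M'.b 0 y')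
    (surj : ∀ n (y : M'.X (n + 1)), M'.b n y = 0 → ∃ (x' : M.X (n + 1)) (y' : M'.X (n + 2)),
      M.b n x' = 0 ∧ y = F.f (n + 1) x' + M'.b (n + 1) y') :
    F.toMixedComplex.IsAcyclic := by
  rintro m _ _ rfl rfl x y - hy
  rw [toMixedComplex_d] at hy
  rw [toMixedComplex_d, toMixedComplex_d]
  match m with
  | Int.ofNat m =>
    have key : ∀ (x : M.X m) (y : M'.X (m + 1)), M'.b m y = F.f m x →
        ∃ (x' : M.X (m + 1)) (y' : M'.X (m + 2)), M.b m x' = x ∧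
          y = F.f (m + 1) x' + M'.b (m + 1) y' := by
      intro x y hy
      obtain ⟨x₀, rfl⟩ := inj m x y hy.symm
      obtain ⟨x₁, y', h1, h2⟩ := surj m (y - F.f (m + 1) x₀)
        (by rw [map_sub, hy, F.comm_b, sub_self])
      refine ⟨x₀ + x₁, y', by rw [map_add, h1, add_zero], ?_⟩
      rw [map_add, add_assoc, ← h2]; abel
    exact key x y hy
  -- Here x lies in the zero module in degree -1 and y in degree 0, so the cone condition on y is
  -- void.
  | Int.negSucc 0 =>
    obtain ⟨x', y', h⟩ := surj_zero y
    exact ⟨x', y', rfl, h⟩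
  | Int.negSucc (m + 1) => exact ⟨0, 0, rfl, rfl⟩

end CyclicModule

/-! ### The homotopy attached to operators that are almost degeneracies -/

namespace CyclicModule
variable {k : Type u} [CommRing k] (M : CyclicModule.{w} k)

/-- The face maps, indexed by `ℕ`. -/
def D {n : ℕ} (j : ℕ) : M.X (n + 1) →ₗ[k] M.X n := if h : j < n + 2 then M.d ⟨j, h⟩ else 0

theorem D_of_lt {n j : ℕ} (h : j < n + 2) : M.D (n := n) j = M.d ⟨j, h⟩ := dif_pos h

theorem D_D {n i j : ℕ} (h : i ≤ j) (hj : j < n + 2) (x : M.X (n + 2)) :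
    M.D j (M.D i x) = M.D i (M.D (j + 1) x) := by
  rw [D_of_lt _ hj, D_of_lt _ (show i < n + 3 by omega), D_of_lt _ (show i < n + 2 by omega),
    D_of_lt _ (show j + 1 < n + 3 by omega)]
  exact M.d_d ⟨i, by omega⟩ ⟨j, hj⟩ h x

theorem b_apply (n : ℕ) (x : M.X (n + 1)) :
    M.b n x = ∑ j ∈ Finset.range (n + 2), (-1 : k) ^ j • M.D j x := by
  rw [b, LinearMap.sum_apply, Finset.sum_range]
  exact Finset.sum_congr rfl fun i _ => by rw [D_of_lt _ i.2]; rfl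

/-- Operators that satisfy the identities of degeneracies, except for `d (i + 1) (S i x) = x`. -/
structure Splitting where
  S : ∀ {n : ℕ}, ℕ → M.X n →ₗ[k] M.X (n + 1)
  D_S_lt : ∀ {n i j : ℕ}, j ≤ i → i ≤ n → ∀ x : M.X (n + 1), M.D j (S (i + 1) x) = S i (M.D j x)
  D_S_self : ∀ {n i : ℕ}, i ≤ n → ∀ x : M.X n, M.D i (S i x) = x
  D_S_gt : ∀ {n i j : ℕ}, i < j → j ≤ n + 1 →
    ∀ x : M.X (n + 1), M.D (j + 1) (S i x) = S i (M.D j x)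

namespace Splitting
variable {M} (σ : M.Splitting)

/-- The operator `d (i + 1) S i`. -/
def τ {n : ℕ} (i : ℕ) : M.X n →ₗ[k] M.X n := M.D (i + 1) ∘ₗ σ.S i

theorem D_τ_lt {n i j : ℕ} (h : j ≤ i) (hi : i ≤ n) (x : M.X (n + 1)) :
    M.D j (σ.τ (i + 1) x) = σ.τ i (M.D j x) := by
  simp only [τ, LinearMap.comp_apply]
  rw [← M.D_D (by omega) (by omega), σ.D_S_lt h hi]

/-- By the simplicial identity d_i d_{i+1} = d_i d_i, this reduces to d_i S_i = 1. In the nerve, the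
face d_i drops the only object that τ_i changes. -/
theorem D_τ_self {n i : ℕ} (hi : i ≤ n) (x : M.X (n + 1)) : M.D i (σ.τ i x) = M.D i x := by
  simp only [τ, LinearMap.comp_apply]
  rw [← M.D_D le_rfl (by omega), σ.D_S_self (by omega)]

theorem D_τ_gt {n i j : ℕ} (h : i < j) (hj : j ≤ n + 1) (x : M.X (n + 1)) :
    M.D j (σ.τ i x) = σ.τ i (M.D j x) := by
  simp only [τ, LinearMap.comp_apply]
  rw [M.D_D (by omega) (by omega), σ.D_S_gt h hj]

/-- The composite `τ (i - 1) ⋯ τ 0`. -/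
def Θ {n : ℕ} : ℕ → (M.X n →ₗ[k] M.X n)
  | 0 => LinearMap.id
  | i + 1 => σ.τ i ∘ₗ Θ i

theorem Θ_succ {n : ℕ} (i : ℕ) (x : M.X n) : σ.Θ (i + 1) x = σ.τ i (σ.Θ i x) := rfl

theorem D_Θ_of_le {n i j : ℕ} (h : i ≤ j) (hj : j ≤ n + 1) (x : M.X (n + 1)) :
    M.D j (σ.Θ i x) = σ.Θ i (M.D j x) := by
  induction i with
  | zero => rfl
  | succ i ih => rw [Θ_succ, σ.D_τ_gt (by omega) hj, ih (by omega), Θ_succ]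

/-- On its way through τ_i ⋯ τ_0 the face d_j lowers the indices above j by one, absorbs τ_j, and
commutes with the remaining factors; so one factor is lost. -/
theorem D_Θ_of_lt {n i j : ℕ} (h : j ≤ i) (hi : i ≤ n) (x : M.X (n + 1)) :
    M.D j (σ.Θ (i + 1) x) = σ.Θ i (M.D j x) := by
  induction i with
  | zero =>
    obtain rfl : j = 0 := by omega
    exact σ.D_τ_self (Nat.zero_le _) x
  | succ i ih =>
    rw [Θ_succ]
    rcases h.eq_or_lt with rfl | h
    · rw [σ.D_τ_self hi, σ.D_Θ_of_le le_rfl (by omega)]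
    · rw [σ.D_τ_lt (by omega) (by omega), ih (by omega) (by omega), Θ_succ]

/-- The chain homotopy `∑ (-1) ^ i S i Θ i`. -/
noncomputable def H (n : ℕ) : M.X n →ₗ[k] M.X (n + 1) :=
  ∑ i ∈ Finset.range (n + 1), (-1 : k) ^ i • (σ.S i ∘ₗ σ.Θ i)

theorem H_apply (n : ℕ) (x : M.X n) :
    σ.H n x = ∑ i ∈ Finset.range (n + 1), (-1 : k) ^ i • σ.S i (σ.Θ i x) := by
  simp [H, LinearMap.sum_apply]

theorem D_S_succ (n i : ℕ) (x : M.X n) : M.D (i + 1) (σ.S i (σ.Θ i x)) = σ.Θ (i + 1) x := rfl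

theorem b_H_zero (x : M.X 0) : M.b 0 (σ.H 0 x) = x - σ.Θ 1 x := by
  simp [H_apply, b_apply, Finset.sum_range_succ, D_S_succ, σ.D_S_self, ← sub_eq_add_neg]
  rfl

/-- In the double sum of the terms (-1)^(i+j) d_j S_i Θ_i, the terms j = i and j = i + 1 give Θ_i -
Θ_{i+1}, which telescopes to 1 - Θ. The other terms can be commuted past the face and cancel against
H b exactly as for ordinary degeneracies. -/
theorem b_H (n : ℕ) (x : M.X (n + 1)) :
    M.b (n + 1) (σ.H (n + 1) x) = x - σ.Θ (n + 2) x - σ.H n (M.b n x) := by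
  have hlt : ∀ i j, j ≤ i → i ≤ n → M.D j (σ.S (i + 1) (σ.Θ (i + 1) x)) =
      σ.S i (σ.Θ i (M.D j x)) := fun i j h hi => by rw [σ.D_S_lt h hi, σ.D_Θ_of_lt h hi]
  have hgt : ∀ i j, i < j → j ≤ n + 1 → M.D (j + 1) (σ.S i (σ.Θ i x)) =
      σ.S i (σ.Θ i (M.D j x)) := fun i j h hj => by rw [σ.D_S_gt h hj, σ.D_Θ_of_le h.le hj]
  have hself : ∀ i, i ≤ n + 1 → M.D i (σ.S i (σ.Θ i x)) = σ.Θ i x := fun i hi =>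
    σ.D_S_self hi _
  have tele : ∑ i ∈ Finset.range (n + 2), (σ.Θ i x - σ.Θ (i + 1) x) = x - σ.Θ (n + 2) x :=
    Finset.sum_range_sub' (fun i => σ.Θ i x) (n + 2)
  rw [← tele]
  simp only [H_apply, b_apply, map_sum, map_smul, Finset.smul_sum, smul_smul, ← pow_add]
  -- For fixed i the faces fall into j < i, the two diagonal ones, and j ≥ i + 2.
  have split : ∀ i ∈ Finset.range (n + 2),
      ∑ j ∈ Finset.range (n + 3), (-1 : k) ^ (i + j) • M.D j (σ.S i (σ.Θ i x)) =
      (σ.Θ i x - σ.Θ (i + 1) x) +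
      ((∑ j ∈ Finset.range i, (-1 : k) ^ (i + j) • M.D j (σ.S i (σ.Θ i x))) +
        ∑ j ∈ Finset.Ico (i + 2) (n + 3), (-1 : k) ^ (i + j) • M.D j (σ.S i (σ.Θ i x))) := by
    intro i hi
    rw [Finset.mem_range] at hi
    rw [← Finset.sum_range_add_sum_Ico _ (show i + 2 ≤ n + 3 by omega), Finset.sum_range_succ,
      Finset.sum_range_succ, hself i (by omega), D_S_succ, ← two_mul,
      show i + (i + 1) = 2 * i + 1 by ring, pow_succ, pow_mul]
    simp only [even_two, Even.neg_pow, one_pow, one_smul, mul_neg, mul_one, neg_smul]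
    abel
  refine (Finset.sum_congr rfl split).trans ?_
  rw [Finset.sum_add_distrib, sub_eq_add_neg]
  congr 1
  -- No face lies below i = 0 and none from i + 2 on for i = n + 1. Dropping these empty ranges and
  -- shifting i in the first sum puts both sums over the n + 1 indices that occur in H b.
  rw [Finset.sum_add_distrib, Finset.sum_range_succ', Finset.range_zero, Finset.sum_empty,
    add_zero, Finset.sum_range_succ _ (n + 1), Finset.Ico_self, Finset.sum_empty, add_zero,
    ← Finset.sum_add_distrib, Finset.sum_comm (s := Finset.range (n + 2)),
    ← Finset.sum_neg_distrib]
  refine Finset.sum_congr rfl fun i hi => ?_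
  rw [Finset.mem_range] at hi
  rw [← Finset.sum_range_add_sum_Ico _ (show i + 1 ≤ n + 2 by omega), neg_add,
    ← Finset.sum_neg_distrib, ← Finset.sum_neg_distrib,
    ← Finset.sum_Ico_add' _ (i + 1) (n + 2) 1]
  congr 1
  · refine Finset.sum_congr rfl fun j hj => ?_
    rw [Finset.mem_range] at hj
    rw [hlt i j (by omega) (by omega), show i + 1 + j = j + i + 1 by ring, pow_succ, mul_neg_one, neg_smul]
  · refine Finset.sum_congr rfl fun j hj => ?_
    rw [Finset.mem_Ico] at hj
    rw [hgt i j (by omega) (by omega), show i + (j + 1) = j + i + 1 by ring, pow_succ, mul_neg_one, neg_smul]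

/-- Since 1 - Θ has the form bH + Hb and b² = 0, it commutes with b. Degree zero is separate because
the term Hb is absent there. -/
theorem b_Θ (n : ℕ) (x : M.X (n + 1)) : M.b n (σ.Θ (n + 2) x) = σ.Θ (n + 1) (M.b n x) := by
  have h1 := congrArg (M.b n) (σ.b_H n x)
  rw [M.b_b, map_sub, map_sub] at h1
  rcases n with _ | n
  · rw [σ.b_H_zero] at h1
    rw [← sub_eq_zero, ← neg_eq_zero, h1]; abel
  · rw [σ.b_H, M.b_b, map_zero, sub_zero] at h1
    rw [← sub_eq_zero, ← neg_eq_zero, h1]; abel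

/-- An injective morphism of cyclic modules onto a part which `Θ` retracts to is a quasi-isomorphism. -/
theorem isAcyclic {L : CyclicModule.{w'} k} (F : Hom L M) (inj : ∀ n, Function.Injective (F.f n))
    (hΘ : ∀ n (x : L.X n), σ.Θ (n + 1) (F.f n x) = F.f n x)
    (range : ∀ n (y : M.X n), ∃ x, F.f n x = σ.Θ (n + 1) y) : F.toMixedComplex.IsAcyclic := by
  refine F.isAcyclic_toMixedComplex (fun n x y h => ?_) (fun y => ?_) fun n y h => ?_
  -- Θ commutes with b and fixes the image of F, so if y bounds F x then so does Θ y, which lies in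
  -- that image.
  · obtain ⟨x', hx'⟩ := range (n + 1) y
    refine ⟨x', inj n ?_⟩
    rw [F.comm_b, hx', b_Θ, ← h, hΘ]
  · obtain ⟨x', hx'⟩ := range 0 y
    exact ⟨x', σ.H 0 y, by rw [hx', b_H_zero]; abel⟩
  · obtain ⟨x', hx'⟩ := range (n + 1) y
    refine ⟨x', σ.H (n + 1) y, inj n ?_, ?_⟩
    · rw [F.comm_b, hx', b_Θ, h, map_zero, map_zero]
    · rw [hx', b_H, h, map_zero]; abel

end Splitting
end CyclicModule

/-! ### Replacing two neighbouring entries of a cyclic word -/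

namespace CyclicTuple
variable {T : Type*}

/-- Apply `pre` to the entry `i` and `post` to the entry `i + 1` of a word. -/
def repl (pre post : T → T) {n : ℕ} (i : Fin (n + 1)) (x : Fin (n + 2) → T) : Fin (n + 2) → T :=
  fun j => if (j : ℕ) = i then pre (x j) else if (j : ℕ) = i + 1 then post (x j) else x j

/-- Auxiliary version of `repl` for entries indexed by `ℕ`. -/
def replN (pre post : T → T) (i : ℕ) (X : ℕ → T) : ℕ → T :=
  fun j => if j = i then pre (X j) else if j = i + 1 then post (X j) else X j

theorem repl_rep (pre post : T → T) {n : ℕ} (i : Fin (n + 1)) (X : ℕ → T) :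
    repl pre post i (fun j : Fin (n + 2) => X j) = fun j : Fin (n + 2) => replN pre post i X j :=
  rfl

/-- The face merges an altered entry with another one only for j = i, and then the altered entry is
the right factor, carrying `pre`. Hence compatibility of `pre` with multiplication from the left is
all that is needed. -/
theorem face_repl_lt (mul : T → T → T) (pre post : T → T) {n : ℕ} (x : Fin (n + 3) → T)
    (h : ∀ i, mul (x i) (pre (x (i + 1))) = pre (mul (x i) (x (i + 1))))
    (i j : Fin (n + 1)) (hij : j ≤ i) :
    face mul j.castSucc.castSucc (repl pre post i.succ x) =
      repl pre post i (face mul j.castSucc.castSucc x) := by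
  obtain ⟨X, rfl⟩ := exists_rep x
  have a1 : ∀ p, p ≤ n + 1 → mul (X p) (pre (X (p + 1))) = pre (mul (X p) (X (p + 1))) := by
    intro p hp
    have := h ⟨p, by omega⟩
    simpa [Fin.val_add, Nat.mod_eq_of_lt (show p + 1 < n + 3 by omega)] using this
  simp only [face_rep, repl_rep]
  funext l
  obtain ⟨i, hi⟩ := i
  obtain ⟨j, hj⟩ := j
  obtain ⟨l, hl⟩ := l
  simp only [Fin.castSucc_mk, Fin.succ_mk, Fin.mk_le_mk, replN, faceN] at *
  clear h
  grind

/-- Only the last face can meet an altered entry here, for i = 0: it multiplies the last entry onto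
the front of the entry 0, which carries `pre`. -/
theorem face_repl_gt (mul : T → T → T) (pre post : T → T) {n : ℕ} (x : Fin (n + 3) → T)
    (h : ∀ i, mul (x i) (pre (x (i + 1))) = pre (mul (x i) (x (i + 1))))
    (i : Fin (n + 1)) (j : Fin (n + 2)) (hij : (i : ℕ) < j) :
    face mul j.succ (repl pre post i.castSucc x) = repl pre post i (face mul j.succ x) := by
  obtain ⟨X, rfl⟩ := exists_rep x
  have a2 : mul (X (n + 2)) (pre (X 0)) = pre (mul (X (n + 2)) (X 0)) := by
    have := h ⟨n + 2, by omega⟩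
    simpa [Fin.val_add] using this
  simp only [face_rep, repl_rep]
  funext l
  obtain ⟨i, hi⟩ := i
  obtain ⟨j, hj⟩ := j
  obtain ⟨l, hl⟩ := l
  simp only [Fin.castSucc_mk, Fin.succ_mk, replN, faceN] at *
  clear h
  grind

theorem face_repl_self (mul : T → T → T) (pre post : T → T) {n : ℕ} (x : Fin (n + 2) → T)
    (i : Fin (n + 1)) :
    face mul i.castSucc (repl pre post i x) =
      Function.update (face mul i.castSucc x) i (mul (pre (x i.castSucc)) (post (x i.succ))) := by
  funext j
  simp only [face, repl, Function.update_apply, Fin.ext_iff, Fin.val_castSucc, Fin.val_last,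
    Fin.val_succ]
  grind

end CyclicTuple

/-! ### The splitting of the cyclic nerve given by a generating object -/

namespace AddCyclicNerve
universe v₁ u₁
variable {C : Type u₁} [Category.{v₁} C] [Preadditive C]

/-- A presentation of every object of a preadditive category as a retract of a finite sum of copies
of an object `E`, trivial for `E` itself. -/
structure Generation (E : C) where
  N : C → ℕ
  e : ∀ P, ℕ → (E ⟶ P)
  p : ∀ P, ℕ → (P ⟶ E)
  sum_eq : ∀ P, ∑ l ∈ Finset.range (N P), p P l ≫ e P l = 𝟙 P
  N_self : N E = 1
  e_self : e E 0 = 𝟙 E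
  p_self : p E 0 = 𝟙 E

namespace Generation
variable {E : C} (γ : Generation E)

/-- Precomposition of an arrow with `e`. -/
def pre (l : ℕ) (f : Arrow C) : Arrow C := Arrow.mk (γ.e f.left l ≫ f.hom)

/-- Postcomposition of an arrow with `p`. -/
def post (l : ℕ) (f : Arrow C) : Arrow C := Arrow.mk (f.hom ≫ γ.p f.right l)

theorem arrowMul_pre (l : ℕ) (f g : Arrow C) (h : g.right = f.left) :
    arrowMul f (γ.pre l g) = γ.pre l (arrowMul f g) := by
  rw [arrowMul_of_eq f g h, arrowMul_of_eq f (γ.pre l g) h]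
  simp [pre]

theorem arrowMul_pre_post (l : ℕ) {a b a' b' : C} (f : a ⟶ b) (g : a' ⟶ b') (h : b' = a) :
    arrowMul (γ.pre l (Arrow.mk f)) (γ.post l (Arrow.mk g)) =
      Arrow.mk (g ≫ (γ.p b' l ≫ γ.e b' l) ≫ castHom h rfl f) := by
  subst h
  rw [arrowMul_of_eq (γ.pre l (Arrow.mk f)) (γ.post l (Arrow.mk g)) rfl]
  simp [pre, post, castHom]

/-- The objects of a replacement. -/
def replObj {C : Type*} (E : C) {n : ℕ} (i : Fin (n + 1)) (c : Fin (n + 2) → C) : Fin (n + 2) → C := fun j =>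
  if (j : ℕ) = i + 1 then E else c j

theorem replObj_of_eq {C : Type*} (E : C) {n : ℕ} (i : Fin (n + 1)) (c : Fin (n + 2) → C) {j : Fin (n + 2)}
    (h : (j : ℕ) = i + 1) : replObj E i c j = E := if_pos h

theorem replObj_of_ne {C : Type*} (E : C) {n : ℕ} (i : Fin (n + 1)) (c : Fin (n + 2) → C) {j : Fin (n + 2)}
    (h : (j : ℕ) ≠ i + 1) : replObj E i c j = c j := if_neg h

/-- The comparison from the replaced objects. -/
def inHom (l : ℕ) {n : ℕ} (i : Fin (n + 1)) (c : Fin (n + 2) → C) (j : Fin (n + 2)) :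
    replObj E i c j ⟶ c j :=
  if h : (j : ℕ) = i + 1 then eqToHom (replObj_of_eq E i c h) ≫ γ.e (c j) l
  else eqToHom (replObj_of_ne E i c h)

/-- The comparison to the replaced objects. -/
def outHom (l : ℕ) {n : ℕ} (i : Fin (n + 1)) (c : Fin (n + 2) → C) (j : Fin (n + 2)) :
    c j ⟶ replObj E i c j :=
  if h : (j : ℕ) = i + 1 then γ.p (c j) l ≫ eqToHom (replObj_of_eq E i c h).symm
  else eqToHom (replObj_of_ne E i c h).symm

/-- The morphisms of a replacement. -/
def replHom (l : ℕ) {n : ℕ} (i : Fin (n + 1)) (c : Fin (n + 2) → C) (f : ∀ j, c (j + 1) ⟶ c j)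
    (j : Fin (n + 2)) : replObj E i c (j + 1) ⟶ replObj E i c j :=
  γ.inHom l i c (j + 1) ≫ f j ≫ γ.outHom l i c j

/-- Words of morphisms are compared through their words of arrows, in which the dependence on the
objects disappears and the combinatorial lemmas on replacements apply. -/
theorem arrow_replHom (l : ℕ) {n : ℕ} (i : Fin (n + 1)) (c : Fin (n + 2) → C)
    (f : ∀ j, c (j + 1) ⟶ c j) : (fun j => Arrow.mk (γ.replHom l i c f j)) =
      CyclicTuple.repl (γ.pre l) (γ.post l) i (fun j => Arrow.mk (f j)) := by
  have mk_eq : ∀ {a b a' b' : C} (ha : a' = a) (hb : b = b') (f : a ⟶ b),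
      Arrow.mk (eqToHom ha ≫ f ≫ eqToHom hb) = Arrow.mk f := fun ha hb f => mk_castHom ha hb f
  have mk_pre : ∀ {a b b' x y : C} (g : x ⟶ a) (hx : y = x) (hb : b = b') (f : a ⟶ b),
      Arrow.mk ((eqToHom hx ≫ g) ≫ f ≫ eqToHom hb) = Arrow.mk (g ≫ f) := by
    rintro a b _ x _ g rfl rfl f; simp
  have mk_post : ∀ {a b a' x y : C} (g : b ⟶ x) (hx : x = y) (ha : a' = a) (f : a ⟶ b),
      Arrow.mk (eqToHom ha ≫ f ≫ g ≫ eqToHom hx) = Arrow.mk (f ≫ g) := by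
    rintro a b _ x _ g rfl rfl f; simp
  funext j
  have hj := CyclicTuple.val_add_one j
  simp only [CyclicTuple.repl, replHom, inHom, outHom]
  by_cases h1 : (j : ℕ) = i
  · rw [if_pos h1, dif_pos (by rw [hj, if_neg (by omega), h1]), dif_neg (by omega)]
    exact mk_pre _ _ _ _
  -- The index j + 1 is cyclic, but its wrapped value 0 never equals i + 1, so the source of the
  -- entry j is replaced for j = i only.
  · rw [if_neg h1, dif_neg (c := ((j + 1 : Fin (n + 2)) : ℕ) = i + 1)
      (by intro h; rw [hj] at h; split_ifs at h <;> omega)]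
    by_cases h2 : (j : ℕ) = i + 1
    · rw [if_pos h2, dif_pos h2]
      exact mk_post _ _ _ _
    · rw [if_neg h2, dif_neg h2]
      exact mk_eq _ _ _

variable (k : Type u) [CommRing k] [Linear k C]

open Classical in
/-- Replace the object number `i + 1` of a cyclic word by `E`. -/
noncomputable def repl {n : ℕ} (i : Fin (n + 1)) : Obj C k (n + 1) →ₗ[k] Obj C k (n + 1) :=
  DirectSum.toModule k _ _ fun c =>
    ∑ l ∈ Finset.range (γ.N (c i.succ)),
      DirectSum.lof k (Fin (n + 2) → C) (fun c => Summand k c) (replObj E i c) ∘ₗ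
        PiTensorProduct.map fun j => Linear.leftComp k _ (γ.inHom l i c (j + 1)) ∘ₗ
          Linear.rightComp k _ (γ.outHom l i c j)

theorem repl_gen {n : ℕ} (i : Fin (n + 1)) (c : Fin (n + 2) → C) (f : ∀ j, c (j + 1) ⟶ c j) :
    γ.repl k i (gen k c f) = ∑ l ∈ Finset.range (γ.N (c i.succ)),
      gen k (replObj E i c) (γ.replHom l i c f) := by
  classical
  refine (DirectSum.toModule_lof k (M := fun c => Summand k c) c _).trans ?_
  rw [LinearMap.sum_apply]
  refine Finset.sum_congr rfl fun l _ => ?_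
  rw [LinearMap.comp_apply, PiTensorProduct.map_tprod]
  rfl

theorem face_repl_lt {n : ℕ} (i j : Fin (n + 1)) (hij : j ≤ i) (x : Obj C k (n + 2)) :
    face k j.castSucc.castSucc (γ.repl k i.succ x) =
      γ.repl k i (face k j.castSucc.castSucc x) := by
  refine obj_ext k (φ := face k j.castSucc.castSucc ∘ₗ γ.repl k i.succ)
    (ψ := γ.repl k i ∘ₗ face k j.castSucc.castSucc) (fun c f => ?_) x
  simp only [LinearMap.comp_apply, repl_gen, face_gen, map_sum]
  -- The number of summands depends on the object that is replaced, so both sides must replace the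
  -- same one: the face drops the object j + 1 ≤ i + 1 and lowers the number i + 2 by one.
  have e : faceObj j.castSucc.castSucc c i.succ = c i.succ.succ := faceObj_eq c (by
    simp only [Fin.val_succ, Fin.val_castSucc]; rw [if_neg (by omega), if_neg (by omega)])
  rw [e]
  refine Finset.sum_congr rfl fun l _ => gen_congr k ?_
  rw [arrow_faceHom, arrow_replHom, arrow_replHom, arrow_faceHom]
  exact CyclicTuple.face_repl_lt _ _ _ _ (fun p => γ.arrowMul_pre l _ _ rfl) i j hij

theorem face_repl_gt {n : ℕ} (i : Fin (n + 1)) (j : Fin (n + 2)) (hij : (i : ℕ) < j)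
    (x : Obj C k (n + 2)) :
    face k j.succ (γ.repl k i.castSucc x) = γ.repl k i (face k j.succ x) := by
  refine obj_ext k (φ := face k j.succ ∘ₗ γ.repl k i.castSucc)
    (ψ := γ.repl k i ∘ₗ face k j.succ) (fun c f => ?_) x
  simp only [LinearMap.comp_apply, repl_gen, face_gen, map_sum]
  -- This face leaves the object number i + 1 in place: it drops a later one, or, as the last face,
  -- the object 0.
  have e : faceObj j.succ c i.succ = c i.castSucc.succ := faceObj_eq c (by
    simp only [Fin.val_succ, Fin.val_castSucc]; rw [if_neg (by omega), if_pos (by omega)])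
  rw [e]
  refine Finset.sum_congr rfl fun l _ => gen_congr k ?_
  rw [arrow_faceHom, arrow_replHom, arrow_replHom, arrow_faceHom]
  exact CyclicTuple.face_repl_gt _ _ _ _ (fun p => γ.arrowMul_pre l _ _ rfl) i j hij

theorem gen_sum_update {n : ℕ} (c : Fin (n + 1) → C) (f : ∀ j, c (j + 1) ⟶ c j) (i : Fin (n + 1))
    (s : Finset ℕ) (g : ℕ → (c (i + 1) ⟶ c i)) :
    ∑ l ∈ s, gen k c (Function.update f i (g l)) =
      gen k c (Function.update f i (∑ l ∈ s, g l)) := by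
  classical
  simp only [gen, ← map_sum]
  congr 1
  exact ((PiTensorProduct.tprod k).map_update_sum s i g f).symm

/-- The face composes across the replaced object, so the merged entry becomes f_i ∘ (e_l p_l) ∘
f_{i+1}. The words for different l agree elsewhere; by multilinearity the sum over l moves into this
entry, where ∑ e_l p_l = 1. -/
theorem face_repl_self {n : ℕ} (i : Fin (n + 1)) (x : Obj C k (n + 1)) :
    face k i.castSucc (γ.repl k i x) = face k i.castSucc x := by
  refine obj_ext k (φ := face k i.castSucc ∘ₗ γ.repl k i) (ψ := face k i.castSucc)
    (fun c f => ?_) x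
  simp only [LinearMap.comp_apply, repl_gen, face_gen, map_sum]
  have hs : c (i.castSucc + 1) = c i.succ := congr_val c (by
    rw [CyclicTuple.val_add_one]; simp; omega)
  have ha : faceObj i.castSucc c (i + 1) = c (i.succ + 1) := faceObj_succ_eq c (by
    rw [CyclicTuple.val_add_one]; simp only [Fin.val_succ, Fin.val_castSucc]; split_ifs <;> omega)
  have hb : c i.castSucc = faceObj i.castSucc c i := (faceObj_eq c (by
    simp only [Fin.val_castSucc]; split_ifs <;> omega)).symm
  let g : ℕ → (faceObj i.castSucc c (i + 1) ⟶ faceObj i.castSucc c i) := fun l =>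
    castHom ha hb (f i.succ ≫ (γ.p (c i.succ) l ≫ γ.e (c i.succ) l) ≫
      castHom hs.symm rfl (f i.castSucc))
  have key : ∀ l, gen k (faceObj i.castSucc (replObj E i c))
      (faceHom i.castSucc (replObj E i c) (γ.replHom l i c f)) =
      gen k (faceObj i.castSucc c) (Function.update (faceHom i.castSucc c f) i (g l)) := by
    intro l
    refine gen_congr k ?_
    -- Away from the entry i, the face of the replaced word coincides with the face of the original
    -- one.
    rw [arrow_faceHom, arrow_replHom, CyclicTuple.face_repl_self, γ.arrowMul_pre_post l _ _ hs.symm,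
      ← arrow_faceHom]
    funext j
    rcases eq_or_ne j i with rfl | h
    · rw [Function.update_self, Function.update_self, mk_castHom]
    · rw [Function.update_of_ne h, Function.update_of_ne h]
  rw [Finset.sum_congr rfl fun l _ => key l, gen_sum_update]
  congr 1
  rw [Function.update_eq_self_iff]
  have h1 : ∑ l ∈ Finset.range (γ.N (c i.succ)), g l = castHom ha hb (f i.succ ≫
      castHom hs.symm rfl (f i.castSucc)) := by
    have := γ.sum_eq (c i.succ)
    simp only [g, castHom, ← Preadditive.comp_sum, ← Preadditive.sum_comp, this, Category.id_comp]
  rw [h1]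
  simp only [faceHom]
  rw [dif_neg (by simp only [Fin.val_castSucc]; omega), dif_neg (by simp), dif_pos (by simp)]

/-- This is where the normalisation of a presentation on E itself enters: one summand, with e and p
the identity. -/
theorem repl_gen_self {n : ℕ} (i : Fin (n + 1)) (c : Fin (n + 2) → C) (hc : c i.succ = E)
    (f : ∀ j, c (j + 1) ⟶ c j) : γ.repl k i (gen k c f) = gen k c f := by
  rw [repl_gen, hc, γ.N_self, Finset.sum_range_one]
  refine gen_congr k ?_
  rw [arrow_replHom]
  have hE : ∀ {P : C} (h : P = E), γ.e P 0 = eqToHom h.symm ∧ γ.p P 0 = eqToHom h := by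
    rintro _ rfl
    exact ⟨γ.e_self, γ.p_self⟩
  have mk_pre : ∀ {a b x : C} (hx : x = a) (f : a ⟶ b), Arrow.mk (eqToHom hx ≫ f) = Arrow.mk f := by
    rintro a b _ rfl f; simp
  have mk_post : ∀ {a b x : C} (hx : b = x) (f : a ⟶ b), Arrow.mk (f ≫ eqToHom hx) = Arrow.mk f := by
    rintro a b _ rfl f; simp
  funext j
  simp only [CyclicTuple.repl]
  split_ifs with h1 h2
  · have h : c (j + 1) = E := (congr_val c (by
      rw [CyclicTuple.val_add_one, if_neg (by omega), Fin.val_succ, h1])).trans hc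
    simp only [pre, Arrow.mk_left, Arrow.mk_hom]
    rw [(hE h).1]
    exact mk_pre _ _
  · have h : c j = E := (congr_val c (by rw [Fin.val_succ, h2])).trans hc
    simp only [post, Arrow.mk_right, Arrow.mk_hom]
    rw [(hE h).2]
    exact mk_post _ _
  · rfl

/-- The splitting operators on the cyclic nerve that factor the identity of the object number `i + 1`
through `E`. -/
noncomputable def splitting : (addCyclicNerve k C).Splitting where
  S {n} i := if h : i < n + 1 then γ.repl k ⟨i, h⟩ ∘ₗ degen k ⟨i, h⟩ else 0
  D_S_lt {n i j} hj hi x := by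
    rw [dif_pos (by omega), dif_pos (by omega), CyclicModule.D_of_lt _ (show j < n + 1 + 2 by omega),
      CyclicModule.D_of_lt _ (show j < n + 2 by omega)]
    have h1 := γ.face_repl_lt k ⟨i, by omega⟩ ⟨j, by omega⟩ hj (degen k (Fin.succ ⟨i, by omega⟩) x)
    have h2 := (addCyclicNerve k C).d_s_of_lt ⟨j, by omega⟩ ⟨i, by omega⟩ hj x
    exact h1.trans (congrArg (γ.repl k ⟨i, by omega⟩) h2)
  D_S_self {n i} hi x := by
    rw [dif_pos (by omega), CyclicModule.D_of_lt _ (show i < n + 2 by omega)]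
    exact (γ.face_repl_self k ⟨i, by omega⟩ _).trans
      ((addCyclicNerve k C).d_s_castSucc ⟨i, by omega⟩ x)
  D_S_gt {n i j} hj hi x := by
    rw [dif_pos (by omega), dif_pos (by omega), CyclicModule.D_of_lt _ (show j + 1 < n + 1 + 2 by omega),
      CyclicModule.D_of_lt _ (show j < n + 2 by omega)]
    have h1 := γ.face_repl_gt k ⟨i, by omega⟩ ⟨j, by omega⟩ hj (degen k (Fin.castSucc ⟨i, by omega⟩) x)
    -- In `d_s_of_gt` the face index is written as a double successor; the face number j + 1 is the
    -- case j - 1, which is admissible because i < j.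
    have h2 := (addCyclicNerve k C).d_s_of_gt ⟨j - 1, by omega⟩ ⟨i, by omega⟩
      (show i ≤ j - 1 by omega) x
    have e1 : Fin.succ (⟨j - 1, by omega⟩ : Fin (n + 1)) = ⟨j, by omega⟩ := Fin.ext (by simp; omega)
    rw [e1] at h2
    exact h1.trans (congrArg (γ.repl k ⟨i, by omega⟩) h2)

/-- The span of the cyclic words whose objects number `1, …, m` are `E`, where the object number
`n + 1` is the object number `0`. -/
def wordsFrom (n m : ℕ) : Submodule k (Obj C k n) :=
  Submodule.span k {x | ∃ c f, x = gen k c f ∧ ∀ j : Fin (n + 1), (j : ℕ) < m → c (j + 1) = E}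

/-- Replace the object number `m + 1` by `E`. -/
noncomputable def step {n : ℕ} (m : ℕ) (h : m < n + 1) : Obj C k n →ₗ[k] Obj C k n :=
  face k ⟨m + 1, by omega⟩ ∘ₗ γ.repl k ⟨m, h⟩ ∘ₗ degen k ⟨m, h⟩

theorem τ_eq {n m : ℕ} (h : m < n + 1) (x : Obj C k n) :
    (γ.splitting k).τ m x = γ.step k m h x := by
  simp only [CyclicModule.Splitting.τ, splitting]
  rw [dif_pos h, CyclicModule.D_of_lt _ (show m + 1 < n + 2 by omega)]
  rfl

theorem Θ_succ_eq {n m : ℕ} (h : m < n + 1) (x : Obj C k n) :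
    (γ.splitting k).Θ (m + 1) x = γ.step k m h ((γ.splitting k).Θ m x) :=
  γ.τ_eq k h _

/-- The degeneracy doubles the object number m + 1, the replacement turns the first copy into E, and
the face number m + 1 drops the second. In effect one object becomes E and the others stay. -/
theorem step_mem (n m : ℕ) (h : m < n + 1) (x : Obj C k n) (hx : x ∈ wordsFrom (E := E) k n m) :
    γ.step k m h x ∈ wordsFrom (E := E) k n (m + 1) := by
  induction hx using Submodule.span_induction with
  | zero => rw [map_zero]; exact Submodule.zero_mem _
  | add x y _ _ hx hy => rw [map_add]; exact Submodule.add_mem _ hx hy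
  | smul a x _ hx => rw [map_smul]; exact Submodule.smul_mem _ a hx
  | mem x hx =>
    obtain ⟨c, f, rfl, hc⟩ := hx
    simp only [step, LinearMap.comp_apply]
    rw [degen_gen, repl_gen, map_sum]
    refine Submodule.sum_mem _ fun l _ => Submodule.subset_span ⟨_, _, face_gen k _ _ _, ?_⟩
    intro j hj
    by_cases h : (j : ℕ) = m
    · have hn : m + 1 < n + 2 := by omega
      -- For m = n this is the last face, which moves the object n + 1, now E, to the position 0; so
      -- the object 0 is the last one to be replaced.
      rw [faceObj_succ_eq (p := ⟨m + 1, hn⟩) _ (by simp only; split_ifs <;> omega)]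
      exact if_pos rfl
    · have h1 : j.succ.val = (j : ℕ) + 1 := rfl
      rw [faceObj_succ_eq (p := j.succ) _ (by rw [h1]; simp only; split_ifs <;> omega),
        replObj_of_ne _ _ _ (by rw [h1]; simp only; omega), degenObj_eq (p := j + 1) _ (by
          rw [CyclicTuple.val_add_one, h1]; simp only; split_ifs <;> omega)]
      exact hc j (by omega)

/-- There is no condition for m = 0, where the words span everything; each further factor τ_m
replaces one more object by E. -/
theorem Θ_mem (n m : ℕ) (hm : m ≤ n + 1) (x : Obj C k n) :
    (γ.splitting k).Θ m x ∈ wordsFrom (E := E) k n m := by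
  induction m with
  | zero =>
    classical
    change x ∈ _
    induction x using DirectSum.induction_on with
    | zero => exact Submodule.zero_mem _
    | add x y hx hy => exact Submodule.add_mem _ hx hy
    | of c x =>
      induction x using PiTensorProduct.induction_on with
      | smul_tprod r f =>
        rw [← DirectSum.lof_eq_of k, map_smul]
        exact Submodule.smul_mem _ r (Submodule.subset_span ⟨c, f, rfl, fun j hj => by omega⟩)
      | add x y hx hy => rw [map_add]; exact Submodule.add_mem _ hx hy
  | succ m ih =>
    rw [γ.Θ_succ_eq k (by omega)]
    exact γ.step_mem k n m (by omega) _ (ih (by omega))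

/-- On a word with all objects E the replacement does nothing, and what remains is d_{m+1} s_m = 1.
-/
theorem step_gen_self {n m : ℕ} (h : m < n + 1) (f : ∀ _ : Fin (n + 1), E ⟶ E) :
    γ.step k m h (gen k (fun _ => E) f) = gen k (fun _ => E) f := by
  simp only [step, LinearMap.comp_apply]
  rw [degen_gen, repl_gen_self, ← degen_gen]
  · exact (addCyclicNerve k C).d_s_succ ⟨m, h⟩ _
  · simp only [degenObj]
    split_ifs <;> rfl

theorem Θ_gen_self (n m : ℕ) (hm : m ≤ n + 1) (f : ∀ _ : Fin (n + 1), E ⟶ E) :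
    (γ.splitting k).Θ m (gen k (fun _ => E) f) = gen k (fun _ => E) f := by
  induction m with
  | zero => rfl
  | succ m ih =>
    rw [γ.Θ_succ_eq k (by omega), ih (by omega), step_gen_self]

end Generation

/-! ### Morita invariance for the endomorphism algebra of a generator -/

section Endomorphisms
open scoped TensorProduct
variable (k : Type u) [CommRing k] [Linear k C] {A : Type w} [Ring A] [Algebra k A] {E : C}
  (φ : A ≃ₐ[k] End E)

/-- An isomorphism onto the endomorphism algebra, as a linear equivalence to a space of morphisms. -/
def endEquiv : A ≃ₗ[k] (E ⟶ E) := φ.toLinearEquiv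

/-- A product in `End E` applies its right factor first, which is also the order in which the nerve
composes f_i with f_{i+1}; so A itself, not its opposite, appears. -/
theorem endEquiv_mul (a b : A) : endEquiv k φ (a * b) = endEquiv k φ b ≫ endEquiv k φ a :=
  map_mul φ a b

theorem endEquiv_one : endEquiv k φ 1 = 𝟙 E := map_one φ

open Classical in
/-- The inclusion of the tensor powers of the endomorphism algebra of an object into the cyclic
nerve. -/
noncomputable def endIncl (n : ℕ) : (⨂[k] _ : Fin (n + 1), A) →ₗ[k] Obj C k n :=
  DirectSum.lof k (Fin (n + 1) → C) (fun c => Summand k c) (fun _ => E) ∘ₗ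
    (PiTensorProduct.congr (R := k) (s := fun _ : Fin (n + 1) => A)
      (t := fun _ : Fin (n + 1) => (E ⟶ E)) fun _ => endEquiv k φ).toLinearMap

theorem endIncl_tprod (n : ℕ) (a : Fin (n + 1) → A) :
    endIncl k φ n (PiTensorProduct.tprod k a) = gen k (fun _ => E) fun p => endEquiv k φ (a p) := by
  simp only [endIncl, gen, LinearMap.comp_apply, LinearEquiv.coe_coe, PiTensorProduct.congr_tprod]

theorem endIncl_injective (n : ℕ) : Function.Injective (endIncl k φ n) := by
  classical
  exact (DirectSum.of_injective _).comp (LinearEquiv.injective _)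

theorem face_comp {T T' : Type*} (mul : T → T → T) (mul' : T' → T' → T') (ψ : T → T')
    (h : ∀ a b, mul' (ψ a) (ψ b) = ψ (mul a b)) {n : ℕ} (i : Fin (n + 2)) (x : Fin (n + 2) → T) :
    CyclicTuple.face mul' i (fun p => ψ (x p)) = fun p => ψ (CyclicTuple.face mul i x p) := by
  funext j
  simp only [CyclicTuple.face, h]
  split_ifs <;> rfl

/-- The inclusion of the cyclic module of the endomorphism algebra of an object. -/
noncomputable def endInclHom : CyclicModule.Hom (algCyclicModule k A) (addCyclicNerve k C) where
  f n := endIncl k φ n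
  comm_d n i x := tensor_ext k A (φ := endIncl k φ n ∘ₗ algFace k A i)
    (ψ := face k i ∘ₗ endIncl k φ (n + 1)) (fun a => by
      simp only [LinearMap.comp_apply, algFace_tprod, endIncl_tprod, face_gen]
      refine gen_congr k ?_
      rw [arrow_faceHom]
      refine (face_comp _ _ (fun a => Arrow.mk (endEquiv k φ a)) (fun a b => ?_) i a).symm
      rw [arrowMul_of_eq _ _ rfl, endEquiv_mul]
      simp) x
  comm_s n i x := tensor_ext k A (φ := endIncl k φ (n + 1) ∘ₗ algDegen k A i)
    (ψ := degen k i ∘ₗ endIncl k φ n) (fun a => by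
      simp only [LinearMap.comp_apply, algDegen_tprod, endIncl_tprod, degen_gen]
      refine gen_congr k ?_
      rw [arrow_degenHom]
      funext j
      simp only [CyclicTuple.degen]
      split_ifs
      · rfl
      · rw [endEquiv_one]; rfl
      · rfl) x
  comm_t n x := tensor_ext k A (φ := endIncl k φ n ∘ₗ ((-1 : k) ^ n • algRot k A))
    (ψ := ((-1 : k) ^ n • rot k) ∘ₗ endIncl k φ n) (fun a => by
      simp only [LinearMap.comp_apply, LinearMap.smul_apply, map_smul, algRot_tprod, endIncl_tprod,
        rot_gen]
      congr 1
      refine gen_congr k ?_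
      rw [arrow_rotHom]
      rfl) x

theorem exists_endIncl_eq (n : ℕ) (x : Obj C k n)
    (hx : x ∈ Generation.wordsFrom (E := E) k n (n + 1)) : ∃ y, endIncl k φ n y = x := by
  change x ∈ LinearMap.range (endIncl k φ n)
  refine Submodule.span_le.2 ?_ hx
  rintro _ ⟨c, f, rfl, hc⟩
  -- Every cyclic index has the form (j - 1) + 1, so the condition for m = n + 1 covers all objects,
  -- the object 0 included.
  obtain rfl : c = fun _ => E := by
    funext j
    have := hc (j - 1) (j - 1).2
    rwa [sub_add_cancel] at this
  refine ⟨PiTensorProduct.tprod k fun p => (endEquiv k φ).symm (f p), ?_⟩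
  rw [endIncl_tprod]
  simp

/-- Morita invariance: a linear category is, for the purpose of Hochschild and cyclic homology, equivalent
to the endomorphism algebra of an object that generates it. -/
theorem Generation.isAcyclic_endInclHom (γ : Generation E) :
    (endInclHom k φ).toMixedComplex.IsAcyclic :=
  (γ.splitting k).isAcyclic (endInclHom k φ) (endIncl_injective k φ)
    (fun n x => tensor_ext k A (φ := (γ.splitting k).Θ (n + 1) ∘ₗ endIncl k φ n)
      (ψ := endIncl k φ n) (fun a => by
        have h := γ.Θ_gen_self k n (n + 1) le_rfl fun p => endEquiv k φ (a p)
        rw [← endIncl_tprod] at h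
        exact h) x)
    fun n y => exists_endIncl_eq k φ n _ (γ.Θ_mem k n (n + 1) le_rfl y)

end Endomorphisms
end AddCyclicNerve

/-! ### Universe of finite-dimensional spaces, and push-outs from splittings -/

theorem Module.Finite.small_of_field (k : Type u) [Field k] (V : Type w) [AddCommGroup V] [Module k V]
    [Module.Finite k V] : Small.{u} V :=
  -- Coordinates identify V with k^n, which lives in the universe of k. This allows function spaces
  -- on G as values of a functor to `FGModuleCat.{u} k`.
  small_map (Module.finBasis k V).equivFun.toEquiv

/-- The maps r and r' split an element of P into a part from X and a part from Y, so a cocone (a, b)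
can only be induced by r ≫ a + r' ≫ b. On Y this gives b because s splits off the part coming from
I, where a and b agree. -/
theorem CategoryTheory.IsPushout.of_splitting {C : Type*} [Category* C] [Preadditive C]
    {I X Y P : C} {i : I ⟶ X} {j : I ⟶ Y} {f : X ⟶ P} {g : Y ⟶ P} (sq : i ≫ f = j ≫ g)
    (r : P ⟶ X) (r' : P ⟶ Y) (s : Y ⟶ I) (h1 : r ≫ f + r' ≫ g = 𝟙 P) (h2 : f ≫ r = 𝟙 X)
    (h3 : f ≫ r' = 0) (h4 : g ≫ r = s ≫ i) (h5 : g ≫ r' + s ≫ j = 𝟙 Y) :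
    IsPushout i j f g :=
  ⟨⟨sq⟩, ⟨Limits.PushoutCocone.IsColimit.mk _ (fun c => r ≫ c.inl + r' ≫ c.inr)
    (fun c => by rw [Preadditive.comp_add, reassoc_of% h2, reassoc_of% h3]; simp)
    (fun c => by
      rw [Preadditive.comp_add, reassoc_of% h4, c.condition, ← Category.assoc s,
        ← Category.assoc g, ← Preadditive.add_comp, add_comm, h5, Category.id_comp])
    (fun c m hm hm' => by
      rw [← hm, ← hm', ← Category.assoc, ← Category.assoc, ← Preadditive.add_comp, h1,
        Category.id_comp])⟩⟩

/-! ### Bounded sets of the canonical space of a group -/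

namespace GBornCoarse
variable {G : Type v} [Group G]

/-- A bounded set of `canMin G`, as a set of elements of `G`. -/
def toSet (B : (canMin G).BoundedSet) : Set G := B.1

theorem finite_toSet (B : (canMin G).BoundedSet) : (toSet B).Finite := isBounded_cofinite_iff.1 B.2

/-- A finite set of elements of `G`, as a bounded set of `canMin G`. -/
def ofFinite (B : Set G) (h : B.Finite) : (canMin G).BoundedSet := ⟨B, isBounded_cofinite_iff.2 h⟩

theorem mem_of_le {B B' : (canMin G).BoundedSet} (h : B ≤ B') (x : G) (hx : x ∈ toSet B) :
    x ∈ toSet B' := h hx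

theorem mem_translate {g x : G} {B : (canMin G).BoundedSet} :
    x ∈ toSet (((canMin G).translate g).obj B) ↔ g * x ∈ toSet B := by
  refine (Set.mem_smul_set_iff_inv_smul_mem (a := g⁻¹) (A := toSet B) (x := x)).trans ?_
  rw [inv_inv]; rfl

theorem inv_mul_mem_translate (g : G) (B : (canMin G).BoundedSet) (x : G) (hx : x ∈ toSet B) :
    g⁻¹ * x ∈ toSet (((canMin G).translate g).obj B) :=
  mem_translate.2 (by rwa [mul_inv_cancel_left])

theorem mem_thicken {U : (canMin G).InvariantEntourage} {x : G} {B : (canMin G).BoundedSet} :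
    x ∈ toSet (U.thicken.obj B) ↔ ∃ b ∈ toSet B, (x, b) ∈ (U.1 : Set (G × G)) := Iff.rfl

end GBornCoarse

/-! ### The free object on one generator -/

namespace ControlledObject
open GBornCoarse
section
variable (k : Type u) [Field k] {G : Type v} [Group G]

instance finite_supported (B : (canMin G).BoundedSet) :
    Module.Finite k (Finsupp.supported k k (toSet B)) :=
  have := (finite_toSet B).to_subtype
  Module.Finite.equiv (Finsupp.supportedEquivFinsupp (M := k) (R := k) (toSet B)).symm

instance small_supported (B : (canMin G).BoundedSet) :
    Small.{u} (Finsupp.supported k k (toSet B)) := Module.Finite.small_of_field k _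

/-- The functions on `G` supported on `B`, in the universe of `k`. -/
def SuppFun (B : (canMin G).BoundedSet) : Type u := Shrink.{u} (Finsupp.supported k k (toSet B))

noncomputable instance (B : (canMin G).BoundedSet) : AddCommGroup (SuppFun k B) :=
  inferInstanceAs (AddCommGroup (Shrink.{u} (Finsupp.supported k k (toSet B))))

noncomputable instance (B : (canMin G).BoundedSet) : Module k (SuppFun k B) :=
  inferInstanceAs (Module k (Shrink.{u} (Finsupp.supported k k (toSet B))))

/-- Supported functions, in two universes. -/
noncomputable def suppEquiv (B : (canMin G).BoundedSet) :
    SuppFun k B ≃ₗ[k] Finsupp.supported k k (toSet B) :=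
  Shrink.linearEquiv k (Finsupp.supported k k (toSet B))

instance (B : (canMin G).BoundedSet) : Module.Finite k (SuppFun k B) :=
  Module.Finite.equiv (suppEquiv k B).symm

variable {k}

/-- The embedding of `SuppFun k B` into the functions on `G`. -/
noncomputable def emb (B : (canMin G).BoundedSet) : SuppFun k B →ₗ[k] G →₀ k :=
  (Finsupp.supported k k (toSet B)).subtype ∘ₗ (suppEquiv k B).toLinearMap

theorem emb_injective (B : (canMin G).BoundedSet) : Function.Injective (emb (k := k) B) :=
  Subtype.val_injective.comp (LinearEquiv.injective _)

theorem emb_mem (B : (canMin G).BoundedSet) (m : SuppFun k B) :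
    emb B m ∈ Finsupp.supported k k (toSet B) := Subtype.mem _

theorem exists_emb (B : (canMin G).BoundedSet) {f : G →₀ k}
    (h : f ∈ Finsupp.supported k k (toSet B)) : ∃ m, emb B m = f :=
  ⟨(suppEquiv k B).symm ⟨f, h⟩, by simp [emb]⟩

/-- A linear map into the functions on `G` with values supported on `B`. -/
noncomputable def embLift {V : Type*} [AddCommGroup V] [Module k V] (B : (canMin G).BoundedSet)
    (T : V →ₗ[k] G →₀ k) (h : ∀ v, T v ∈ Finsupp.supported k k (toSet B)) : V →ₗ[k] SuppFun k B :=
  (suppEquiv k B).symm.toLinearMap ∘ₗ T.codRestrict _ h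

@[simp] theorem emb_embLift {V : Type*} [AddCommGroup V] [Module k V] (B : (canMin G).BoundedSet)
    (T : V →ₗ[k] G →₀ k) (h : ∀ v, T v ∈ Finsupp.supported k k (toSet B)) (v : V) :
    emb B (embLift B T h v) = T v := by
  simp [emb, embLift]

variable (k) in
/-- The translation by `σ` of functions on `G`. -/
noncomputable abbrev push (σ : G → G) : (G →₀ k) →ₗ[k] G →₀ k := Finsupp.lmapDomain k k σ

theorem push_mem {σ : G → G} {B B' : Set G} (h : ∀ x ∈ B, σ x ∈ B') {f : G →₀ k}
    (hf : f ∈ Finsupp.supported k k B) : push k σ f ∈ Finsupp.supported k k B' := by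
  have := Finsupp.lmapDomain_supported k k σ B
  refine Finsupp.supported_mono (Set.image_subset_iff.2 h) ?_
  rw [← this]
  exact Submodule.mem_map_of_mem hf

/-- The morphism of supported functions induced by a map of sets. -/
noncomputable def pushHom (σ : G → G) (B B' : (canMin G).BoundedSet)
    (h : ∀ x ∈ toSet B, σ x ∈ toSet B') :
    FGModuleCat.of k (SuppFun k B) ⟶ FGModuleCat.of k (SuppFun k B') :=
  FGModuleCat.ofHom (embLift B' (push k σ ∘ₗ emb B) fun m => push_mem h (emb_mem B m))

theorem emb_pushHom (σ : G → G) (B B' : (canMin G).BoundedSet)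
    (h : ∀ x ∈ toSet B, σ x ∈ toSet B') (m : SuppFun k B) :
    emb B' ((pushHom (k := k) σ B B' h).hom.hom m) = push k σ (emb B m) := emb_embLift _ _ _ _

theorem supp_hom_ext {V : FGModuleCat.{u} k} (B : (canMin G).BoundedSet)
    {f g : V ⟶ FGModuleCat.of k (SuppFun k B)}
    (h : ∀ v, emb B (f.hom.hom v) = emb B (g.hom.hom v)) : f = g :=
  FGModuleCat.hom_ext (LinearMap.ext fun v => emb_injective B (h v))

theorem push_push (σ τ : G → G) (f : G →₀ k) : push k σ (push k τ f) = push k (σ ∘ τ) f :=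
  (Finsupp.mapDomain_comp).symm

theorem push_id (f : G →₀ k) : push k id f = f := Finsupp.mapDomain_id

theorem pushHom_comp (σ τ : G → G) (B B' B'' : (canMin G).BoundedSet) (h h') :
    pushHom (k := k) σ B B' h ≫ pushHom τ B' B'' h' =
      pushHom (τ ∘ σ) B B'' fun x hx => h' _ (h x hx) :=
  supp_hom_ext B'' fun v => by
    rw [emb_pushHom, ← push_push]
    exact (emb_pushHom τ B' B'' h' _).trans (congrArg (push k τ) (emb_pushHom σ B B' h v))

theorem pushHom_congr {σ τ : G → G} (e : σ = τ) (B B' : (canMin G).BoundedSet) (h h') :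
    pushHom (k := k) σ B B' h = pushHom τ B B' h' := by subst e; rfl

theorem pushHom_id (B : (canMin G).BoundedSet) :
    pushHom (k := k) id B B (fun _ h => h) = 𝟙 _ :=
  supp_hom_ext B fun v => by rw [emb_pushHom, push_id]; rfl

variable (k) (G) in
/-- The functor of supported functions. -/
noncomputable def suppFunctor : (canMin G).BoundedSet ⥤ FGModuleCat.{u} k where
  obj B := FGModuleCat.of k (SuppFun k B)
  map {B B'} f := pushHom id B B' (mem_of_le f.le)
  map_id B := pushHom_id B
  map_comp {B B' B''} f g := (pushHom_comp id id B B' B'' (mem_of_le f.le) (mem_of_le g.le)).symm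

/-- The action of a group element on supported functions. -/
noncomputable def translateIso (g : G) (B : (canMin G).BoundedSet) :
    FGModuleCat.of k (SuppFun k B) ≅ FGModuleCat.of k (SuppFun k (((canMin G).translate g).obj B)) :=
  have h' : ∀ x ∈ toSet (((canMin G).translate g).obj B), g * x ∈ toSet B := fun _ hx =>
    mem_translate.1 hx
  { hom := pushHom (g⁻¹ * ·) B (((canMin G).translate g).obj B) (inv_mul_mem_translate g B)
    inv := pushHom (g * ·) (((canMin G).translate g).obj B) B h'
    hom_inv_id := by
      rw [pushHom_comp, ← pushHom_id]
      exact pushHom_congr (by funext x; simp) _ _ _ _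
    inv_hom_id := by
      rw [pushHom_comp, ← pushHom_id]
      exact pushHom_congr (by funext x; simp) _ _ _ _ }

variable (k) (G) in
/-- The action of the group on supported functions. -/
noncomputable def suppIso (g : G) : suppFunctor k G ≅ (canMin G).translate g ⋙ suppFunctor k G :=
  NatIso.ofComponents (translateIso g) fun {B B'} f => by
    exact (pushHom_comp id (g⁻¹ * ·) B B' _ (mem_of_le f.le) (inv_mul_mem_translate g B')).trans
      (pushHom_comp (g⁻¹ * ·) id B _ _ (inv_mul_mem_translate g B)
        (mem_of_le (((canMin G).translate g).map f).le)).symm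

theorem suppFunctor_isZero : Limits.IsZero
    ((suppFunctor k G).obj ⟨∅, Bornology.isBounded_empty⟩) := by
  rw [Limits.IsZero.iff_id_eq_zero]
  refine supp_hom_ext _ fun v => ?_
  have h : ∀ v, emb (k := k) (G := G) ⟨∅, Bornology.isBounded_empty⟩ v = 0 := fun v => by
    have := emb_mem _ v
    rwa [show toSet _ = (∅ : Set G) from rfl, Finsupp.supported_empty, Submodule.mem_bot] at this
  exact (h _).trans (h _).symm

/-- The function on `G` underlying the values of a morphism to supported functions. -/
noncomputable def embHom {V : FGModuleCat.{u} k} {B : (canMin G).BoundedSet}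
    (φ : V ⟶ (suppFunctor k G).obj B) : V →ₗ[k] G →₀ k := emb B ∘ₗ φ.hom.hom

/-- All spaces of supported functions sit in the single space of finitely supported functions on G,
where inclusions of bounded sets become invisible (`embHom_comp_map`). Identities between morphisms
are checked there. -/
theorem embHom_ext {V : FGModuleCat.{u} k} {B : (canMin G).BoundedSet}
    {φ ψ : V ⟶ (suppFunctor k G).obj B} (h : embHom φ = embHom ψ) : φ = ψ :=
  supp_hom_ext B fun v => LinearMap.congr_fun h v

theorem embHom_id (B : (canMin G).BoundedSet) :
    embHom (𝟙 ((suppFunctor k G).obj B)) = emb (k := k) B := rfl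

theorem embHom_zero {V : FGModuleCat.{u} k} {B : (canMin G).BoundedSet} :
    embHom (0 : V ⟶ (suppFunctor k G).obj B) = 0 := LinearMap.ext fun _ => map_zero (emb B)

theorem embHom_add {V : FGModuleCat.{u} k} {B : (canMin G).BoundedSet}
    (φ ψ : V ⟶ (suppFunctor k G).obj B) : embHom (φ + ψ) = embHom φ + embHom ψ :=
  LinearMap.ext fun _ => map_add (emb B) _ _

theorem embHom_comp {V W : FGModuleCat.{u} k} {B : (canMin G).BoundedSet} (φ : V ⟶ W)
    (ψ : W ⟶ (suppFunctor k G).obj B) : embHom (φ ≫ ψ) = embHom ψ ∘ₗ φ.hom.hom := rfl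

theorem embHom_pushHom (σ : G → G) (B B' : (canMin G).BoundedSet) (h) :
    embHom (B := B') (pushHom (k := k) σ B B' h) = push k σ ∘ₗ emb B :=
  LinearMap.ext fun m => emb_pushHom σ B B' h m

theorem embHom_map {B B' : (canMin G).BoundedSet} (h : B ≤ B') :
    embHom ((suppFunctor k G).map (homOfLE h)) = emb B :=
  (embHom_pushHom id B B' (mem_of_le h)).trans (LinearMap.ext fun _ => push_id _)

theorem embHom_comp_map {V : FGModuleCat.{u} k} {B B' : (canMin G).BoundedSet} (h : B ≤ B')
    (φ : V ⟶ (suppFunctor k G).obj B) : embHom (φ ≫ (suppFunctor k G).map (homOfLE h)) = embHom φ := by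
  rw [embHom_comp, embHom_map]; rfl

open Classical in
/-- The restriction to `S` of functions on `G`. -/
noncomputable def restr (S : Set G) : (G →₀ k) →ₗ[k] G →₀ k :=
  (Finsupp.supported k k S).subtype ∘ₗ Finsupp.restrictDom k k S

theorem restr_apply (S : Set G) (f : G →₀ k) (x : G) [Decidable (x ∈ S)] :
    restr S f x = if x ∈ S then f x else 0 := by
  classical
  simp [restr, Finsupp.filter_apply]

theorem restr_mem {S B B' : Set G} (h : ∀ x ∈ B, x ∈ S → x ∈ B') {f : G →₀ k}
    (hf : f ∈ Finsupp.supported k k B) : restr S f ∈ Finsupp.supported k k B' := by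
  classical
  rw [Finsupp.mem_supported'] at hf ⊢
  intro x hx
  rw [restr_apply]
  split_ifs with hS
  · exact hf x fun hB => hx (h x hB hS)
  · rfl

theorem restr_add_restr_compl (S : Set G) (f : G →₀ k) : restr S f + restr Sᶜ f = f := by
  classical
  ext x
  rw [Finsupp.add_apply, restr_apply, restr_apply]
  by_cases hx : x ∈ S <;> simp [hx]

theorem restr_compl_of_mem {S : Set G} {f : G →₀ k} (hf : f ∈ Finsupp.supported k k S) :
    restr Sᶜ f = 0 := by
  classical
  ext x
  rw [restr_apply, Finsupp.zero_apply]
  split_ifs with h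
  · exact (Finsupp.mem_supported' _ _).1 hf x h
  · rfl

theorem restr_of_mem {S : Set G} {f : G →₀ k} (hf : f ∈ Finsupp.supported k k S) :
    restr S f = f := by
  rw [← add_zero (restr S f), ← restr_compl_of_mem hf, restr_add_restr_compl]

/-- The morphism of supported functions induced by restriction to `S`. -/
noncomputable def restrHom (S : Set G) (B B' : (canMin G).BoundedSet)
    (h : ∀ x ∈ toSet B, x ∈ S → x ∈ toSet B') :
    (suppFunctor k G).obj B ⟶ (suppFunctor k G).obj B' :=
  FGModuleCat.ofHom (embLift B' (restr S ∘ₗ emb B) fun m => restr_mem h (emb_mem B m))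

theorem embHom_restrHom (S : Set G) (B B' : (canMin G).BoundedSet)
    (h : ∀ x ∈ toSet B, x ∈ S → x ∈ toSet B') :
    embHom (restrHom S B B' h) = restr (k := k) S ∘ₗ emb B :=
  LinearMap.ext fun _ => emb_embLift _ _ _ _

theorem embHom_comp_restrHom {V : FGModuleCat.{u} k} (S : Set G) (B B' : (canMin G).BoundedSet)
    (h : ∀ x ∈ toSet B, x ∈ S → x ∈ toSet B') (φ : V ⟶ (suppFunctor k G).obj B) :
    embHom (φ ≫ restrHom S B B' h) = restr (k := k) S ∘ₗ embHom φ := by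
  rw [embHom_comp, embHom_restrHom]; rfl

/-- A function on B ∪ B' is the sum of its restrictions to B and to the complement of B, the latter
supported on B'. A function on B' splits likewise into its restriction to B ∩ B' and the rest, so
`IsPushout.of_splitting` applies. -/
theorem suppFunctor_isPushout (B B' I J : (canMin G).BoundedSet) (h1 : I ≤ B) (h2 : I ≤ B')
    (h3 : B ≤ J) (h4 : B' ≤ J) (hI : toSet I = toSet B ∩ toSet B') (hJ : toSet J = toSet B ∪ toSet B') :
    IsPushout ((suppFunctor k G).map (homOfLE h1)) ((suppFunctor k G).map (homOfLE h2))
      ((suppFunctor k G).map (homOfLE h3)) ((suppFunctor k G).map (homOfLE h4)) := by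
  classical
  have sq : (suppFunctor k G).map (homOfLE h1) ≫ (suppFunctor k G).map (homOfLE h3) =
      (suppFunctor k G).map (homOfLE h2) ≫ (suppFunctor k G).map (homOfLE h4) := by
    rw [← Functor.map_comp, ← Functor.map_comp]; rfl
  let r := restrHom (k := k) (toSet B) J B fun x _ h => h
  let r' := restrHom (k := k) (toSet B)ᶜ J B' fun x h h' => by
    rw [hJ] at h; exact h.resolve_left h'
  let s := restrHom (k := k) (toSet B) B' I fun x h h' => by rw [hI]; exact ⟨h', h⟩
  refine IsPushout.of_splitting sq r r' s (embHom_ext ?_) (embHom_ext ?_) (embHom_ext ?_)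
    (embHom_ext ?_) (embHom_ext ?_) <;>
    simp only [embHom_add, embHom_comp_map, embHom_id, embHom_zero, embHom_comp_restrHom,
      embHom_restrHom, embHom_map, r, r', s]
  · exact LinearMap.ext fun m => restr_add_restr_compl _ _
  · exact LinearMap.ext fun m => restr_of_mem (emb_mem B m)
  · exact LinearMap.ext fun m => restr_compl_of_mem (emb_mem B m)
  · rfl
  · exact LinearMap.ext fun m => (add_comm _ _).trans (restr_add_restr_compl _ _)

theorem emb_suppIso (g : G) (B : (canMin G).BoundedSet) (m : SuppFun k B) :
    emb _ (((suppIso k G g).hom.app B).hom.hom m) = push k (g⁻¹ * ·) (emb B m) :=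
  emb_pushHom (g⁻¹ * ·) B (((canMin G).translate g).obj B) (inv_mul_mem_translate g B) m

theorem suppIso_mul (g h : G) (B : (canMin G).BoundedSet) (m : SuppFun k B) :
    emb _ (((suppIso k G (g * h)).hom.app B).hom.hom m) =
      emb _ (((suppIso k G h).hom.app (((canMin G).translate g).obj B)).hom.hom
        (((suppIso k G g).hom.app B).hom.hom m)) := by
  rw [emb_suppIso]
  symm
  refine (emb_suppIso h (((canMin G).translate g).obj B) _).trans ?_
  refine (congrArg (push k (h⁻¹ * ·)) (emb_suppIso g B m)).trans ?_
  rw [push_push]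
  congr 2
  funext x
  simp [mul_assoc]

variable (k G) in
/-- The free object on one generator: the supported functions on `G`. -/
noncomputable def base : ControlledObject k (canMin G) where
  M := suppFunctor k G
  ρ := suppIso k G
  isZero_empty := suppFunctor_isZero
  isPushout B B' := suppFunctor_isPushout B B' _ _ _ _ _ _ rfl rfl
  -- Bounded sets are finite for the minimal bornology, so B itself is a choice of F.
  exists_finite B := ⟨B, le_rfl, finite_toSet B, by
    rw [show homOfLE (le_refl B) = 𝟙 B from rfl, CategoryTheory.Functor.map_id]; infer_instance⟩
  ρ_mul g h B := embHom_ext (by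
    rw [embHom_comp_map]
    exact LinearMap.ext fun m => suppIso_mul g h B m)
end
end ControlledObject

/-! ### Points and right-translation entourages -/

namespace GBornCoarse
variable {G : Type v} [Group G]

/-- A singleton, as a bounded set of `canMin G`. -/
def pt (x : G) : (canMin G).BoundedSet := ofFinite {x} (Set.finite_singleton x)

theorem mem_pt {x y : G} : y ∈ toSet (pt x) ↔ y = x := Iff.rfl

theorem pt_le {x : G} {B : (canMin G).BoundedSet} (h : x ∈ toSet B) : pt x ≤ B := by
  rintro y rfl; exact h

theorem self_mem_pt (x : G) : x ∈ toSet (pt x) := mem_pt.2 rfl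

theorem translate_pt_le {g x : G} {B : (canMin G).BoundedSet} (h : g⁻¹ * x ∈ toSet B) :
    ((canMin G).translate g).obj (pt x) ≤ B := by
  have key : ∀ y : G, y ∈ toSet (((canMin G).translate g).obj (pt x)) → y ∈ toSet B := by
    intro y hy
    rwa [← mem_pt.1 (mem_translate.1 hy), inv_mul_cancel_left] at h
  exact key

/-- The entourage `{(y s⁻¹, y)}`. -/
def rightEntourage (s : G) : (canMin G).InvariantEntourage :=
  ⟨({p | p.1 = p.2 * s⁻¹} : Set (G × G)), by
    refine .subset (V := orbitEntourage G {1, s⁻¹}) ?_ (.basic ⟨_, by simp, rfl⟩)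
    rintro ⟨x, y⟩ h
    simp only [orbitEntourage, Set.mem_iUnion]
    have h' : x = y * s⁻¹ := h
    -- The pair (y s⁻¹, y) is the translate by y of (s⁻¹, 1).
    refine ⟨y, mem_smul_prod.2 ⟨?_, ?_⟩⟩ <;> simp [h'],
   InvariantEntourage.smul_eq_of _ fun g =>
    have key : ∀ x y : G, g * x = g * y * s⁻¹ ↔ x = y * s⁻¹ := fun x y => by
      rw [mul_assoc, mul_right_inj]
    key⟩

theorem mem_thicken_right (s : G) (B : (canMin G).BoundedSet) (x : G) (hx : x ∈ toSet B) :
    x * s⁻¹ ∈ toSet ((rightEntourage s).thicken.obj B) := mem_thicken.2 ⟨x, hx, rfl⟩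

end GBornCoarse

/-! ### Endomorphisms of the free object: the group algebra -/

namespace ControlledObject
open GBornCoarse
variable {k : Type u} [Field k] {G : Type v} [Group G]

/-- The indicator function of an element of `B`. -/
noncomputable def δ (B : (canMin G).BoundedSet) (x : G) (h : x ∈ toSet B) : SuppFun k B :=
  (exists_emb (k := k) B (Finsupp.single_mem_supported k 1 h)).choose

theorem emb_δ (B : (canMin G).BoundedSet) (x : G) (h : x ∈ toSet B) :
    emb B (δ (k := k) B x h) = Finsupp.single x 1 :=
  (exists_emb (k := k) B (Finsupp.single_mem_supported k 1 h)).choose_spec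

/-- The coordinates of a supported function. -/
noncomputable def coordEquiv (B : (canMin G).BoundedSet) : SuppFun k B ≃ₗ[k] toSet B →₀ k :=
  suppEquiv k B ≪≫ₗ Finsupp.supportedEquivFinsupp (M := k) (R := k) (toSet B)

theorem coordEquiv_symm_single (B : (canMin G).BoundedSet) (x : toSet B) :
    (coordEquiv B).symm (Finsupp.single x 1) = δ (k := k) B x x.2 := by
  refine emb_injective B ?_
  rw [emb_δ]
  simp [coordEquiv, emb]

theorem suppFun_ext {V : Type*} [AddCommGroup V] [Module k V] (B : (canMin G).BoundedSet)
    {f g : SuppFun k B →ₗ[k] V} (h : ∀ x (hx : x ∈ toSet B), f (δ B x hx) = g (δ B x hx)) : f = g := by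
  have key : f ∘ₗ (coordEquiv B).symm.toLinearMap = g ∘ₗ (coordEquiv B).symm.toLinearMap := by
    refine Finsupp.lhom_ext' fun x => LinearMap.ext_ring ?_
    simpa [coordEquiv_symm_single] using h x x.2
  refine LinearMap.ext fun m => ?_
  simpa using LinearMap.congr_fun key (coordEquiv B m)

theorem exists_suppFun_lift {V : Type*} [AddCommGroup V] [Module k V] (B : (canMin G).BoundedSet)
    (w : ∀ x, x ∈ toSet B → V) : ∃ f : SuppFun k B →ₗ[k] V, ∀ x hx, f (δ B x hx) = w x hx := by
  refine ⟨Finsupp.linearCombination k (fun x : toSet B => w x x.2) ∘ₗ (coordEquiv B).toLinearMap,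
    fun x hx => ?_⟩
  rw [LinearMap.comp_apply, ← coordEquiv_symm_single B ⟨x, hx⟩]
  simp

theorem base_hom_ext {V : FGModuleCat.{u} k} (B : (canMin G).BoundedSet) {f g : (base k G).M.obj B ⟶ V}
    (h : ∀ x (hx : x ∈ toSet B), f.hom.hom (δ B x hx) = g.hom.hom (δ B x hx)) : f = g :=
  FGModuleCat.hom_ext (suppFun_ext B h)

theorem base_map_δ {B B' : (canMin G).BoundedSet} (h : B ≤ B') (x : G) (hx : x ∈ toSet B) :
    ((base k G).M.map (homOfLE h)).hom.hom (δ B x hx) = δ B' x (mem_of_le h x hx) :=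
  emb_injective B' (by
    rw [emb_δ]
    exact (LinearMap.congr_fun (embHom_map h) _).trans (emb_δ B x hx))

theorem base_ρ_δ (g : G) (B : (canMin G).BoundedSet) (x : G) (hx : x ∈ toSet B) :
    (((base k G).ρ g).hom.app B).hom.hom (δ B x hx) =
      δ (((canMin G).translate g).obj B) (g⁻¹ * x) (inv_mul_mem_translate g B x hx) :=
  emb_injective _ (by
    rw [emb_δ]
    refine (emb_suppIso g B _).trans ?_
    rw [emb_δ]
    exact Finsupp.mapDomain_single)

/-- The value of an endomorphism of `base k G` on the generator. -/
noncomputable def evMor (U : (canMin G).InvariantEntourage) :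
    Mor U (base k G) (base k G) →ₗ[k] G →₀ k where
  toFun φ := embHom (φ.1.app (pt 1)) (δ (pt 1) 1 (self_mem_pt 1))
  map_add' _ _ := map_add (emb _) _ _
  map_smul' _ _ := map_smul (emb _) _ _

/-- The function δ x is the image of δ 1 under ρ(x⁻¹), which acts by left translation by x, and φ
commutes with ρ. So the value on δ 1 determines φ. -/
theorem embHom_app_δ {U : (canMin G).InvariantEntourage} (φ : Mor U (base k G) (base k G))
    (B : (canMin G).BoundedSet) (x : G) (hx : x ∈ toSet B) :
    embHom (φ.1.app B) (δ B x hx) = push k (x * ·) (evMor U φ) := by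
  -- Equivariance compares {1} with its translate {x} only; naturality along the inclusion of {x}
  -- leads from there to B.
  have hle : ((canMin G).translate x⁻¹).obj (pt 1) ≤ B := translate_pt_le (by simpa using hx)
  have hmem : x ∈ toSet (((canMin G).translate x⁻¹).obj (pt 1)) := mem_translate.2 (by simp [mem_pt])
  have h1 := congrArg (fun f => embHom f (δ (k := k) (pt 1) 1 (self_mem_pt 1))) (φ.2 x⁻¹ (pt 1))
  have h2 := congrArg (fun f => embHom f (δ (k := k) _ x hmem)) (map_app φ hle)
  have h3 : (((base k G).ρ x⁻¹).hom.app (pt 1)).hom.hom (δ (pt 1) 1 (self_mem_pt 1)) =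
      δ _ x hmem :=
    (base_ρ_δ x⁻¹ (pt 1) 1 (self_mem_pt 1)).trans (by congr 1; simp)
  have h4 := base_map_δ (k := k) hle x hmem
  refine (congrArg (embHom (φ.1.app B)) h4.symm).trans (h2.trans ?_)
  refine Eq.trans ?_ (h1.symm.trans ?_)
  · refine (LinearMap.congr_fun (embHom_comp_map _ _) _).trans ?_
    symm
    refine (congrArg (embHom (φ.1.app _ ≫ (base k G).M.map
      (homOfLE (U.thicken_translate_le x⁻¹ (pt 1))))) h3).trans ?_
    exact LinearMap.congr_fun (embHom_comp_map _ _) _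
  · refine (emb_suppIso x⁻¹ _ _).trans ?_
    rw [inv_inv]
    rfl

theorem evMor_enlarge {U V : (canMin G).InvariantEntourage} (h : U ≤ V)
    (φ : Mor U (base k G) (base k G)) : evMor V (enlarge _ _ U V h φ) = evMor U φ :=
  LinearMap.congr_fun (embHom_comp_map _ _) _

open Classical in
/-- The value of an endomorphism of `base k G` on the generator. -/
noncomputable def evHom : (base k G ⟶ base k G) →ₗ[k] G →₀ k :=
  Module.DirectLimit.lift _ _ _ _ evMor fun _ _ h φ => evMor_enlarge h φ

theorem evHom_toHom (U : (canMin G).InvariantEntourage) (φ : Mor U (base k G) (base k G)) :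
    evHom (toHom U φ) = evMor U φ := by
  classical exact Module.DirectLimit.lift_of _ _ _

/-- Evaluation does not change when the entourage is enlarged, so a class with value zero has a
representative with value zero; such a representative vanishes on all δ x and is therefore zero
before passing to the colimit. -/
theorem evHom_injective : Function.Injective (evHom (k := k) (G := G)) := by
  rw [injective_iff_map_eq_zero]
  intro f hf
  obtain ⟨U, φ, rfl⟩ := exists_toHom f
  have h0 : evMor U φ = 0 := (evHom_toHom U φ).symm.trans hf
  have : φ = 0 := Mor.ext fun B => base_hom_ext B fun x hx => emb_injective _
    ((embHom_app_δ φ B x hx).trans (by rw [h0, map_zero]; exact (map_zero (emb _)).symm))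
  rw [this]
  exact map_zero (toHom U)

/-- The endomorphism of `base k G` given by right translation. -/
noncomputable def rightMor (s : G) : Mor (rightEntourage s) (base k G) (base k G) :=
  ⟨{ app := fun B => pushHom (· * s⁻¹) B ((rightEntourage s).thicken.obj B) (mem_thicken_right s B)
     naturality := fun B B' f =>
      (pushHom_comp id (· * s⁻¹) B B' _ (mem_of_le f.le) (mem_thicken_right s B')).trans
        (pushHom_comp (· * s⁻¹) id B _ _ (mem_thicken_right s B)
          (mem_of_le ((rightEntourage s).thicken.map f).le)).symm },
    fun g B => embHom_ext <| by
      rw [← Category.assoc]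
      refine Eq.trans ?_ (embHom_comp_map _ _).symm
      refine LinearMap.ext fun m => ?_
      refine (emb_suppIso g _ _).trans ?_
      refine (congrArg (push k (g⁻¹ * ·)) (emb_pushHom (· * s⁻¹) B _ (mem_thicken_right s B) m)).trans ?_
      symm
      refine (emb_pushHom (· * s⁻¹) _ _ (mem_thicken_right s _) _).trans ?_
      refine (congrArg (push k (· * s⁻¹)) (emb_suppIso g B m)).trans ?_
      -- Equivariance comes down to left translations commuting with right translations.
      rw [push_push, push_push]
      congr 2
      funext x
      simp [mul_assoc]⟩

theorem evHom_rightMor (s : G) :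
    evHom (k := k) (toHom _ (rightMor s)) = Finsupp.single s⁻¹ 1 := by
  rw [evHom_toHom]
  refine (emb_pushHom (· * s⁻¹) (pt 1) _ (mem_thicken_right s (pt 1)) _).trans ?_
  rw [emb_δ]
  exact Finsupp.mapDomain_single.trans (by rw [one_mul])

variable (k G) in
/-- The action of `G` on `base k G` by right translation. -/
noncomputable def rightHom : G →* End (base k G) where
  toFun s := toHom _ (rightMor s)
  map_one' := evHom_injective (by
    rw [evHom_rightMor]
    refine Eq.trans ?_ (evHom_toHom _ (idMor (base k G))).symm
    refine Eq.trans ?_ (LinearMap.congr_fun (embHom_map (InvariantEntourage.le_thicken_diag _)) _).symm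
    rw [inv_one]
    exact (emb_δ (pt 1) 1 (self_mem_pt 1)).symm)
  -- The product s t applies t first and sends x to x t⁻¹ s⁻¹ = x (s t)⁻¹; the inverse in the right
  -- translation is what makes this a homomorphism rather than an antihomomorphism.
  map_mul' s t := evHom_injective (by
    rw [evHom_rightMor]
    refine Eq.trans ?_ (congrArg evHom (compHom_toHom (rightMor t) (rightMor s))).symm
    rw [evHom_toHom]
    symm
    refine (LinearMap.congr_fun (embHom_comp_map (InvariantEntourage.thicken_thicken_le _ _ (pt 1))
      (pushHom (· * t⁻¹) (pt 1) _ (mem_thicken_right t (pt 1)) ≫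
        pushHom (· * s⁻¹) _ _ (mem_thicken_right s _))) _).trans ?_
    refine (emb_pushHom (· * s⁻¹) _ _ (mem_thicken_right s _) _).trans ?_
    refine (congrArg (push k (· * s⁻¹)) (emb_pushHom (· * t⁻¹) (pt 1) _
      (mem_thicken_right t (pt 1)) _)).trans ?_
    rw [emb_δ, push_push]
    exact Finsupp.mapDomain_single.trans (by simp))

variable (k G) in
/-- The endomorphisms of `base k G` form the group algebra. -/
noncomputable def endAlgEquiv : MonoidAlgebra k G ≃ₐ[k] End (base k G) :=
  -- On basis elements the composite is s ↦ s⁻¹, a permutation of the basis. Since evaluation is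
  -- injective and this composite bijective, the algebra map is bijective.
  have key : evHom ∘ₗ (MonoidAlgebra.lift k (End (base k G)) G (rightHom k G)).toLinearMap =
      ((MonoidAlgebra.coeffLinearEquiv k).trans (Finsupp.domLCongr (Equiv.inv G))).toLinearMap := by
    refine LinearMap.ext fun x => ?_
    induction x using MonoidAlgebra.induction_linear with
    | zero => rw [map_zero, map_zero]
    | add x y hx hy => rw [map_add, map_add, hx, hy]
    | single s a =>
      refine (congrArg evHom (MonoidAlgebra.lift_single (rightHom k G) s a)).trans ?_
      refine (map_smul evHom a _).trans ?_
      refine (congrArg (a • ·) (evHom_rightMor s)).trans ?_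
      simp
  AlgEquiv.ofBijective (MonoidAlgebra.lift k (End (base k G)) G (rightHom k G))
    ⟨fun x y h => by
      have := congrArg evHom h
      exact LinearEquiv.injective _ ((LinearMap.congr_fun key x).symm.trans
        (this.trans (LinearMap.congr_fun key y))),
     fun f => by
      obtain ⟨x, hx⟩ := LinearEquiv.surjective ((MonoidAlgebra.coeffLinearEquiv k).trans
        (Finsupp.domLCongr (Equiv.inv G))) (evHom f)
      exact ⟨x, evHom_injective ((LinearMap.congr_fun key x).trans hx)⟩⟩

end ControlledObject

/-! ### Controlled objects are determined by their values on points -/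

namespace ControlledObject
open GBornCoarse
variable {k : Type u} [Field k] {G : Type v} [Group G]

section Points
variable (P : ControlledObject k (canMin G))

/-- A finite set is obtained from the empty set by adding points, and at each stage the value is a
push-out; so the values on points jointly detect morphisms. -/
theorem hom_ext_ofFinite {Z : FGModuleCat.{u} k} (S : Set G) (hS : S.Finite) :
    ∀ f g : P.M.obj (ofFinite S hS) ⟶ Z,
      (∀ x (hx : x ∈ toSet (ofFinite S hS)), P.M.map (homOfLE (pt_le hx)) ≫ f =
        P.M.map (homOfLE (pt_le hx)) ≫ g) → f = g := by
  induction S, hS using Set.Finite.induction_on with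
  | empty => exact fun f g _ => P.isZero_empty.eq_of_src f g
  | @insert a S _ hS ih =>
    intro f g h
    -- The inserted set is {a} ∪ S by definition, so the push-out axiom applies to it directly.
    refine (P.isPushout (pt a) (ofFinite S hS)).hom_ext ?_ ?_
    · exact h a (Set.mem_insert a S)
    · refine ih _ _ fun x hx => ?_
      refine (P.map_comp_map _ _ _).trans (Eq.trans ?_ (P.map_comp_map _ _ _).symm)
      exact h x (Set.mem_insert_of_mem a hx)

theorem hom_ext {Z : FGModuleCat.{u} k} {B : (canMin G).BoundedSet} {f g : P.M.obj B ⟶ Z}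
    (h : ∀ x (hx : x ∈ toSet B), P.M.map (homOfLE (pt_le hx)) ≫ f =
      P.M.map (homOfLE (pt_le hx)) ≫ g) : f = g :=
  P.hom_ext_ofFinite (toSet B) (finite_toSet B) f g h

/-- The point added at each stage is new, so the push-out is taken over M(∅) = 0 and imposes no
compatibility: M(B) is the direct sum of the values on the points of B. -/
theorem exists_desc_ofFinite {Z : FGModuleCat.{u} k} (S : Set G) (hS : S.Finite) :
    ∀ f : ∀ x, x ∈ toSet (ofFinite S hS) → (P.M.obj (pt x) ⟶ Z),
      ∃ d : P.M.obj (ofFinite S hS) ⟶ Z, ∀ x (hx : x ∈ toSet (ofFinite S hS)),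
        P.M.map (homOfLE (pt_le hx)) ≫ d = f x hx := by
  induction S, hS using Set.Finite.induction_on with
  | empty => exact fun f => ⟨0, fun x hx => absurd hx (Set.notMem_empty x)⟩
  | @insert a S ha hS ih =>
    intro f
    obtain ⟨d, hd⟩ := ih fun x hx => f x (Set.mem_insert_of_mem a hx)
    have po := P.isPushout (pt a) (ofFinite S hS)
    -- The two maps agree on the intersection of {a} and S since it has no points, a not being in S.
    obtain ⟨d', hl, hr⟩ := po.exists_desc (f a (Set.mem_insert a S)) d (P.hom_ext fun x hx => by
      obtain rfl : x = a := hx.1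
      exact absurd hx.2 ha)
    refine ⟨d', ?_⟩
    rintro x (rfl | hx)
    · exact hl
    · refine (Eq.trans ?_ (congrArg (P.M.map (homOfLE (pt_le (B := ofFinite S hS) hx)) ≫ ·)
        hr)).trans (hd x hx)
      exact (P.map_comp_map _ _ _).symm

/-- The morphism out of `P(B)` given by morphisms out of `P({x})` for `x ∈ B`. -/
noncomputable def desc {Z : FGModuleCat.{u} k} {B : (canMin G).BoundedSet}
    (f : ∀ x, x ∈ toSet B → (P.M.obj (pt x) ⟶ Z)) : P.M.obj B ⟶ Z :=
  (P.exists_desc_ofFinite (toSet B) (finite_toSet B) f).choose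

theorem map_desc {Z : FGModuleCat.{u} k} {B : (canMin G).BoundedSet}
    (f : ∀ x, x ∈ toSet B → (P.M.obj (pt x) ⟶ Z)) (x : G) (hx : x ∈ toSet B) :
    P.M.map (homOfLE (pt_le hx)) ≫ P.desc f = f x hx :=
  (P.exists_desc_ofFinite (toSet B) (finite_toSet B) f).choose_spec x hx

end Points

section Translation
variable {X : GBornCoarse.{v, v'} G} (P : ControlledObject k X)

/-- The action of `g`, followed by an inclusion. -/
def tr (g : G) {B B' : X.BoundedSet} (h : (X.translate g).obj B ≤ B') : P.M.obj B ⟶ P.M.obj B' :=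
  (P.ρ g).hom.app B ≫ P.M.map (homOfLE h)

theorem tr_congr {g g' : G} (e : g = g') {B B' : X.BoundedSet}
    (h : (X.translate g).obj B ≤ B') (h' : (X.translate g').obj B ≤ B') :
    P.tr g h = P.tr g' h' := by subst e; rfl

theorem ρ_eq_tr (g : G) (B : X.BoundedSet) : (P.ρ g).hom.app B = P.tr g (le_refl _) := by
  refine (Category.comp_id _).symm.trans (congrArg ((P.ρ g).hom.app B ≫ ·) ?_)
  exact (P.M.map_id _).symm

theorem tr_comp_map (g : G) {B B' B'' : X.BoundedSet} (h : (X.translate g).obj B ≤ B')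
    (h' : B' ≤ B'') : P.tr g h ≫ P.M.map (homOfLE h') = P.tr g (h.trans h') := by
  rw [tr, tr, Category.assoc, map_comp_map']

theorem map_comp_tr (g : G) {B B' B'' : X.BoundedSet} (h : B ≤ B')
    (h' : (X.translate g).obj B' ≤ B'') : P.M.map (homOfLE h) ≫ P.tr g h' =
      P.tr g (((X.translate g).map (homOfLE h)).le.trans h') := by
  rw [tr, tr, ← Category.assoc, map_rho, Category.assoc, map_comp_map']

/-- The cocycle condition on ρ, with all identifications of translated sets absorbed into
inclusions. -/
theorem tr_comp_tr (g g' : G) {B B' B'' : X.BoundedSet} (h : (X.translate g).obj B ≤ B')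
    (h' : (X.translate g').obj B' ≤ B'') : P.tr g h ≫ P.tr g' h' =
      P.tr (g * g') ((translate_mul_le g g' B).trans
        (((X.translate g').map (homOfLE h)).le.trans h')) := by
  rw [tr, Category.assoc, map_comp_tr, tr, tr, ← Category.assoc, ← P.ρ_mul, Category.assoc,
    map_comp_map']

theorem le_translate_one (B : X.BoundedSet) : B ≤ (X.translate (1 : G)).obj B :=
  fun x hx => ⟨x, hx, by simp⟩

/-- That ρ(1) is the identity is not an axiom: multiplicativity makes it an idempotent isomorphism,
hence the identity. -/
theorem tr_one {B B' : X.BoundedSet} (h : (X.translate (1 : G)).obj B ≤ B') :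
    P.tr 1 h = P.M.map (homOfLE ((le_translate_one B).trans h)) := by
  have hB : (X.translate (1 : G)).obj B ≤ B := by
    rintro x ⟨y, hy, rfl⟩
    simpa using hy
  have : IsIso (P.tr 1 hB) := by
    have : IsIso (P.M.map (homOfLE hB)) :=
      ⟨P.M.map (homOfLE (le_translate_one B)), by
        rw [map_comp_map']; exact P.M.map_id _, by rw [map_comp_map']; exact P.M.map_id _⟩
    unfold tr; infer_instance
  have h1 : P.tr 1 hB ≫ P.tr 1 hB = P.tr 1 hB :=
    (P.tr_comp_tr 1 1 hB hB).trans (P.tr_congr (mul_one 1) _ _)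
  have h2 : P.tr 1 hB = 𝟙 _ := by rwa [← cancel_epi (P.tr 1 hB), Category.comp_id]
  rw [← P.tr_comp_map 1 hB ((le_translate_one B).trans h), h2, Category.id_comp]

end Translation

theorem hom_congr {V W : FGModuleCat.{u} k} {f g : V ⟶ W} (h : f = g) (v : V) :
    f.hom.hom v = g.hom.hom v := by rw [h]

theorem sum_apply {V W : FGModuleCat.{u} k} {ι : Type*} [Fintype ι] (f : ι → (V ⟶ W)) (v : V) :
    (∑ j, f j).hom.hom v = ∑ j, (f j).hom.hom v := by
  classical
  have : ∀ s : Finset ι, (∑ j ∈ s, f j).hom.hom v = ∑ j ∈ s, (f j).hom.hom v := by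
    intro s
    induction s using Finset.induction_on with
    | empty => rfl
    | insert a s ha ih => rw [Finset.sum_insert ha, Finset.sum_insert ha, ← ih]; rfl
  exact this _

/-! ### Every object is a summand of a finite sum of copies of the free object -/

section Generator
variable (P : ControlledObject k (canMin G))

/-- The map from supported functions sending `δ x` to `w x`. -/
noncomputable def suppDesc {V : FGModuleCat.{u} k} {B : (canMin G).BoundedSet}
    (w : ∀ x, x ∈ toSet B → V) : (base k G).M.obj B ⟶ V :=
  FGModuleCat.ofHom (exists_suppFun_lift B w).choose

theorem suppDesc_δ {V : FGModuleCat.{u} k} {B : (canMin G).BoundedSet}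
    (w : ∀ x, x ∈ toSet B → V) (x : G) (hx : x ∈ toSet B) :
    (suppDesc w).hom.hom (δ B x hx) = w x hx := (exists_suppFun_lift B w).choose_spec x hx

/-- The morphism `w ↦ ξ(w) δ x`. -/
noncomputable def coord {V : FGModuleCat.{u} k} (ξ : V →ₗ[k] k) (B : (canMin G).BoundedSet) (x : G)
    (hx : x ∈ toSet B) : V ⟶ (base k G).M.obj B :=
  FGModuleCat.ofHom (ξ.smulRight (δ B x hx : SuppFun k B))

theorem coord_comp {V W : FGModuleCat.{u} k} (ξ : V →ₗ[k] k) (B : (canMin G).BoundedSet) (x : G)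
    (hx : x ∈ toSet B) (f : (base k G).M.obj B ⟶ W) (w : V) :
    (coord ξ B x hx ≫ f).hom.hom w = ξ w • f.hom.hom (δ B x hx) :=
  map_smul f.hom.hom _ _

theorem coord_comp_congr {V W : FGModuleCat.{u} k} (ξ : V →ₗ[k] k) {B B' : (canMin G).BoundedSet}
    {x x' : G} (hx : x ∈ toSet B) (hx' : x' ∈ toSet B') (f : (base k G).M.obj B ⟶ W)
    (f' : (base k G).M.obj B' ⟶ W) (h : f.hom.hom (δ B x hx) = f'.hom.hom (δ B' x' hx')) :
    coord ξ B x hx ≫ f = coord ξ B' x' hx' ≫ f' :=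
  FGModuleCat.hom_ext (LinearMap.ext fun w => by
    refine (coord_comp ξ B x hx f w).trans (Eq.trans ?_ (coord_comp ξ B' x' hx' f' w).symm)
    rw [h])

theorem translate_inv_pt_le {x : G} {B : (canMin G).BoundedSet} (hx : x ∈ toSet B) :
    ((canMin G).translate x⁻¹).obj (pt 1) ≤ B := translate_pt_le (by simpa using hx)

theorem translate_self_pt_le (x : G) : ((canMin G).translate x).obj (pt x) ≤ pt 1 :=
  translate_pt_le (by simp [mem_pt])

/-- The morphism from `base k G` sending the generator to `v`. -/
noncomputable def genMor (v : P.M.obj (pt 1)) : Mor (InvariantEntourage.diag (canMin G)) (base k G) P :=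
  have mem : ∀ B : (canMin G).BoundedSet, ∀ x ∈ toSet B,
      x ∈ toSet ((InvariantEntourage.diag (canMin G)).thicken.obj B) := fun B =>
    mem_of_le (InvariantEntourage.le_thicken_diag B)
  let a (B : (canMin G).BoundedSet) :
      (base k G).M.obj B ⟶ P.M.obj ((InvariantEntourage.diag (canMin G)).thicken.obj B) :=
    -- Since δ x is the image of δ 1 under ρ(x⁻¹), equivariance leaves no other choice than ρ(x⁻¹)
    -- v.
    suppDesc fun x hx => (P.tr x⁻¹ (translate_inv_pt_le (mem B x hx))).hom.hom v
  have ha : ∀ B x (hx : x ∈ toSet B), (a B).hom.hom (δ B x hx) =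
      (P.tr x⁻¹ (translate_inv_pt_le (mem B x hx))).hom.hom v := fun B x hx => suppDesc_δ _ x hx
  ⟨{ app := a
     naturality := fun B B' f => base_hom_ext B fun x hx => by
      refine (congrArg (a B').hom.hom (base_map_δ f.le x hx)).trans ?_
      refine (ha B' x _).trans ?_
      symm
      refine (congrArg (P.M.map _).hom.hom (ha B x hx)).trans ?_
      exact hom_congr (P.tr_comp_map x⁻¹ _
        ((InvariantEntourage.diag (canMin G)).thicken.map f).le) v },
    fun g B => base_hom_ext B fun x hx => by
      refine (congrArg ((P.ρ g).hom.app _).hom.hom (ha B x hx)).trans ?_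
      refine Eq.trans ?_ (congrArg (a _ ≫ P.M.map
        (homOfLE (InvariantEntourage.thicken_translate_le _ g B))).hom.hom
        (base_ρ_δ g B x hx)).symm
      refine Eq.trans ?_ (congrArg (P.M.map
        (homOfLE (InvariantEntourage.thicken_translate_le _ g B))).hom.hom (ha _ _ _)).symm
      have h := inv_mul_mem_translate g B x hx
      refine hom_congr (f := P.tr x⁻¹ (translate_inv_pt_le (mem B x hx)) ≫ (P.ρ g).hom.app _)
        (g := P.tr (g⁻¹ * x)⁻¹ (translate_inv_pt_le (mem _ _ h)) ≫ P.M.map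
          (homOfLE (InvariantEntourage.thicken_translate_le _ g B))) ?_ v
      rw [ρ_eq_tr, tr_comp_tr, tr_comp_map]
      -- Both sides are the action on v of x⁻¹ g = (g⁻¹ x)⁻¹.
      exact P.tr_congr (by simp) _ _⟩

theorem genMor_app_δ (v : P.M.obj (pt 1)) (B : (canMin G).BoundedSet) (x : G) (hx : x ∈ toSet B) :
    ((P.genMor v).1.app B).hom.hom (δ B x hx) = (P.tr x⁻¹ (translate_inv_pt_le
        (mem_of_le (InvariantEntourage.le_thicken_diag B) x hx))).hom.hom v := suppDesc_δ _ x hx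

/-- The morphism to `base k G` given by a functional on the value at the unit. -/
noncomputable def coordMor (ξ : P.M.obj (pt 1) →ₗ[k] k) :
    Mor (InvariantEntourage.diag (canMin G)) P (base k G) :=
  have mem : ∀ B : (canMin G).BoundedSet, ∀ x ∈ toSet B,
      x ∈ toSet ((InvariantEntourage.diag (canMin G)).thicken.obj B) := fun B =>
    mem_of_le (InvariantEntourage.le_thicken_diag B)
  let a (B : (canMin G).BoundedSet) :
      P.M.obj B ⟶ (base k G).M.obj ((InvariantEntourage.diag (canMin G)).thicken.obj B) :=
    -- On M({x}) the element is moved to M({1}) by ρ(x), evaluated by ξ, and the resulting scalar is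
    -- put at x.
    P.desc fun x hx => P.tr x (translate_self_pt_le x) ≫ coord ξ _ x (mem B x hx)
  have ha : ∀ B x (hx : x ∈ toSet B), P.M.map (homOfLE (pt_le hx)) ≫ a B =
      P.tr x (translate_self_pt_le x) ≫ coord ξ _ x (mem B x hx) := fun B x hx =>
    P.map_desc _ x hx
  ⟨{ app := a
     naturality := fun B B' f => P.hom_ext fun x hx => by
      refine (P.map_comp_map (pt_le hx) f.le (a B')).trans ?_
      refine (ha B' x (mem_of_le f.le x hx)).trans ?_
      symm
      rw [← Category.assoc, ha B x hx, Category.assoc]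
      refine congrArg (P.tr x _ ≫ ·) ?_
      refine Eq.trans ?_ (Category.comp_id _)
      refine coord_comp_congr ξ _ _ _ _ ?_
      exact base_map_δ ((InvariantEntourage.diag (canMin G)).thicken.map f).le x (mem B x hx) },
    fun g B => P.hom_ext fun x hx => by
      rw [← Category.assoc, ha B x hx, Category.assoc]
      symm
      have hg := inv_mul_mem_translate g B x hx
      have h1 : P.M.map (homOfLE (pt_le hx)) ≫ (P.ρ g).hom.app B =
          P.tr g (translate_pt_le (self_mem_pt (g⁻¹ * x))) ≫ P.M.map (homOfLE (pt_le hg)) := by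
        rw [ρ_eq_tr, map_comp_tr, tr_comp_map]
      rw [← Category.assoc, h1, Category.assoc, ← Category.assoc (P.M.map (homOfLE (pt_le hg))),
        ha _ _ hg, Category.assoc, ← Category.assoc, tr_comp_tr]
      -- Going from x to g⁻¹ x and then to 1 is the action of g (g⁻¹ x) = x.
      refine (congrArg (· ≫ _) (P.tr_congr (mul_inv_cancel_left g x) _
        (translate_self_pt_le x))).trans ?_
      refine congrArg (P.tr x _ ≫ ·) (coord_comp_congr ξ _ _ _ _ ?_)
      exact (base_map_δ _ _ _).trans (base_ρ_δ g _ x (mem B x hx)).symm⟩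

theorem map_coordMor_app (ξ : P.M.obj (pt 1) →ₗ[k] k) (B : (canMin G).BoundedSet) (x : G)
    (hx : x ∈ toSet B) : P.M.map (homOfLE (pt_le hx)) ≫ (P.coordMor ξ).1.app B =
      P.tr x (translate_self_pt_le x) ≫
        coord ξ _ x (mem_of_le (InvariantEntourage.le_thicken_diag B) x hx) := P.map_desc _ x hx

/-- A basis of the finite-dimensional space M({1}) gives the morphisms: e_j sends the generator to
the j-th basis vector and p_j takes the j-th coordinate. On M({x}) the sum of the composites applies
ρ(x), expands in the basis, and returns by ρ(x⁻¹), so it is the identity; by `hom_ext` points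
suffice. -/
theorem exists_generation : ∃ (n : ℕ) (e : Fin n → (base k G ⟶ P)) (p : Fin n → (P ⟶ base k G)),
    ∑ l, p l ≫ e l = 𝟙 P := by
  let b := Module.finBasis k (P.M.obj (pt 1))
  refine ⟨_, fun j => toHom _ (P.genMor (b j)), fun j => toHom _ (P.coordMor (b.coord j)), ?_⟩
  refine (Finset.sum_congr rfl fun j _ => compHom_toHom (P.coordMor (b.coord j))
    (P.genMor (b j))).trans ?_
  rw [← map_sum]
  symm
  refine toHom_eq (InvariantEntourage.le_comp_diag _) _ _ fun B => P.hom_ext fun x hx => ?_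
  have hx' := mem_of_le (InvariantEntourage.le_thicken_diag B) x hx
  have hx'' := mem_of_le (InvariantEntourage.le_thicken_diag _) x hx'
  have hle := InvariantEntourage.thicken_thicken_le (InvariantEntourage.diag (canMin G))
    (InvariantEntourage.diag (canMin G)) B
  -- Linear expansion of w in the basis of M({1}), followed by the action of x⁻¹ on each basis
  -- vector.
  have key : P.tr x⁻¹ (translate_inv_pt_le (mem_of_le hle x hx'')) =
      ∑ j, coord (b.coord j) _ x hx' ≫ (P.genMor (b j)).1.app _ ≫ P.M.map (homOfLE hle) := by
    refine FGModuleCat.hom_ext (LinearMap.ext fun w => ?_)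
    refine (congrArg _ (b.sum_repr w).symm).trans ?_
    rw [map_sum]
    refine Eq.trans (Finset.sum_congr rfl fun j _ => ?_) (sum_apply _ w).symm
    refine (map_smul _ _ _).trans (Eq.trans ?_ (coord_comp _ _ _ _ _ w).symm)
    refine congrArg (b.coord j w • ·) ?_
    refine Eq.trans ?_ (congrArg (P.M.map (homOfLE hle)).hom.hom (P.genMor_app_δ _ _ x hx')).symm
    exact hom_congr (P.tr_comp_map _ _ _).symm (b j)
  have hsum : (∑ j, compMor P (base k G) P _ _ (P.genMor (b j)) (P.coordMor (b.coord j))).1.app B =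
      ∑ j, (P.coordMor (b.coord j)).1.app B ≫ (P.genMor (b j)).1.app _ ≫ P.M.map (homOfLE hle) := by
    rw [Submodule.coe_sum, NatTrans.app_sum]
    rfl
  rw [hsum, Preadditive.comp_sum, idMor_app, map_comp_map', map_comp_map']
  refine Eq.trans ?_ (Finset.sum_congr rfl fun j _ => ((Category.assoc _ _ _).symm.trans
    ((congrArg (· ≫ _) (P.map_coordMor_app (b.coord j) B x hx)).trans (Category.assoc _ _ _))).symm)
  rw [← Preadditive.comp_sum, ← key, tr_comp_tr]
  have hone : ((canMin G).translate (1 : G)).obj (pt x) ≤ _ :=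
    translate_pt_le (B := ((InvariantEntourage.diag (canMin G)).comp
      (InvariantEntourage.diag (canMin G))).thicken.obj B) (g := 1)
      (by rw [inv_one, one_mul]; exact mem_of_le hle x hx'')
  -- The round trip from x to 1 and back is the action of x x⁻¹ = 1, that is, the plain inclusion.
  exact ((P.tr_congr (mul_inv_cancel x) _ hone).trans (P.tr_one hone)).symm

end Generator
end ControlledObject

/-! ### Conclusion -/

open Classical in
/-- An object generates as soon as every object is a summand of a finite sum of copies of it. -/
noncomputable def AddCyclicNerve.Generation.ofExists {C : Type w} [Category.{v} C] [Preadditive C]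
    (E : C) (h : ∀ P : C, ∃ (n : ℕ) (e : Fin n → (E ⟶ P)) (p : Fin n → (P ⟶ E)),
      ∑ l, p l ≫ e l = 𝟙 P) : AddCyclicNerve.Generation E where
  -- The trivial presentation is forced on E itself, so that words on E are fixed exactly; indices
  -- beyond the number of summands get the zero morphism, which never contributes.
  N P := if P = E then 1 else (h P).choose
  e P l := if hP : P = E then eqToHom hP.symm else
    if hl : l < (h P).choose then (h P).choose_spec.choose ⟨l, hl⟩ else 0
  p P l := if hP : P = E then eqToHom hP else
    if hl : l < (h P).choose then (h P).choose_spec.choose_spec.choose ⟨l, hl⟩ else 0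
  sum_eq P := by
    by_cases hP : P = E
    · subst hP
      simp
    · simp only [hP, if_false, dif_neg, not_false_eq_true]
      refine Eq.trans ?_ (h P).choose_spec.choose_spec.choose_spec
      rw [Finset.sum_range]
      exact Finset.sum_congr rfl fun l _ => by rw [dif_pos l.2, dif_pos l.2]
  N_self := if_pos rfl
  e_self := dif_pos rfl
  p_self := dif_pos rfl

theorem ControlledObject.isAcyclic_endInclHom_base (k : Type u) [Field k] (G : Type v) [Group G] :
    (AddCyclicNerve.endInclHom k (endAlgEquiv k G)).toMixedComplex.IsAcyclic :=
  (AddCyclicNerve.Generation.ofExists (base k G) fun P => P.exists_generation).isAcyclic_endInclHom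
    k (endAlgEquiv k G)

theorem proposition3p10 (k : Type u) [Field k] (G : Type v) [Group G] :
    Nonempty (coarseHochschild k (GBornCoarse.canMin G) ≅
      algebraHochschild.{max u v, u, u + 1} k (MonoidAlgebra k G)) ∧
    Nonempty (coarseCyclic k (GBornCoarse.canMin G) ≅
      algebraCyclic.{max u v, u, u + 1} k (MonoidAlgebra k G)) :=
  -- One morphism of mixed complexes serves both statements: its cone is acyclic for b, and hence
  -- also on total complexes.
  have h := ControlledObject.isAcyclic_endInclHom_base k G
  ⟨h.nonempty_iso, (MixedComplex.Hom.isAcyclic_tot h).nonempty_iso⟩
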